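/- **Setting.** A randomized circuit $\psi$ is a Boolean circuit with $\wedge,\vee,\neg$ gates, $nk$ input bits, regarded as an array of $n$ records from $X=\{0,1\}^k$, $m$ random input bits and $\ell$ output bits. For $x\in X^n$ and $E\subseteq\{0,1\}^\ell$ let $$\Pr[\psi(x)\in E]=\frac{|\{r\in\{0,1\}^m:\psi(x,r)\in E\}|}{2^m}.$$ Arrays $x,x'\in X^n$ are neighboring if there is a position $i\in\{1,\dots,n\}$ with $x_j=x'_j$ for all $j\neq i$. The circuit $\psi$ is $(\varepsilon,\delta)$-differentially private if $\Pr[\psi(x)\in E]\le e^{\varepsilon}\Pr[\psi(x')\in E]+\delta$ for all neighboring $x,x'\in X^n$ and all $E\subseteq\{0,1\}^\ell$. For $o\in\{0,1\}^\ell$ put $$\delta_{x,x'}(o)=\max\left(\Pr[\psi(x)=o]-e^{\varepsilon}\Pr[\psi(x')=o],\,0\right).$$ The problem Decide-$\varepsilon,\delta$-DP asks, given $n$, $k$, a randomized circuit $\psi$, $e^\varepsilon=u/v$ with positive integers $u,v$ in binary, and $\delta=d/e$ with integers $d\ge 0$, $e>0$ in binary, whether $\psi$ is $(\varepsilon,\delta)$-differentially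 private. For a class $C$ of functions from bit strings to natural numbers, $\#\mathrm{P}^{C}$ is the class of functions that count the accepting computation paths of a nondeterministic polynomial-time machine with an oracle for one function of $C$, and $\mathrm{coNP}^{C}$ is the class of languages $L$ for which there is a nondeterministic polynomial-time machine with an oracle for one function of $C$ that has an accepting path on exactly the inputs $w\notin L$. The class $\#\mathrm{P}$ is $\#\mathrm{P}^C$ without an oracle. **Theorem.** 1. There is a nondeterministic oracle machine $\mathcal M$ with an oracle in $\#\mathrm{P}$, all of whose computation paths have polynomially bounded length, such that for every randomized circuit $\psi$, all integers $u,v>0$ with $e^{\varepsilon}=u/v$ and all $x,x'\in X^n$, the number of accepting computation paths of $\mathcal M$ on the input $(\psi,u,v,x,x')$ is exactly $$v\cdot 2^m\sum_{o\in\{0,1\}^\ell}\delta_{x,x'}(o).$$ Moreover, for the function $g\in\#\mathrm{P}^{\#\mathrm{P}}$ that maps an input of $\mathcal M$ to the number of accepting paths of $\mathcal M$ on it, Decide-$\varepsilon,\delta$-DP is in $\mathrm{coNP}^{\{g\}}$. 2. Consequently, Decide-$\varepsilon,\delta$-DP, for general randomized circuits, is in $\mathrm{coNP}^{\#\mathrm{P}^{\#\mathrm{P}}}$.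 -/

import Mathlib

namespace DPComplexity

/-! ### Nondeterministic oracle machines

The machines have finitely many control states and finitely many work stacks of bits (two stacks
make up one Turing tape), like the multi-stack Turing machines `Turing.TM2` of Mathlib, and in
addition a nondeterministic binary branching and a call to a function oracle. -/

/-- What a machine does in one control state. `K` names the stacks, `Λ` the control states. -/
inductive Instr (K Λ : Type) : Type
  /-- Push the bit `b` on the stack `s`. -/
  | push (s : K) (b : Bool) (next : Λ)
  /-- Pop the stack `s`; the next state depends on the popped bit (`none` if `s` was empty). -/
  | pop (s : K) (next : Option Bool → Λ)
  /-- Branch nondeterministically. -/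
  | guess (next : Bool → Λ)
  /-- Call the oracle. -/
  | query (next : Λ)
  /-- Halt and accept. -/
  | accept
  /-- Halt and reject. -/
  | reject

/-- A nondeterministic oracle machine. The oracle reads its argument from one stack and writes its
answer on a different one, so that every bit of a query has to be written by the machine. -/
structure OracleNTM where
  K : Type
  Λ : Type
  [decEqK : DecidableEq K]
  [finiteK : Finite K]
  [finiteΛ : Finite Λ]
  inputStack : K
  queryStack : K
  answerStack : K
  query_ne_answer : queryStack ≠ answerStack
  start : Λ
  code : Λ → Instr K Λ

attribute [instance] OracleNTM.decEqK OracleNTM.finiteK OracleNTM.finiteΛ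

namespace OracleNTM

/-- A configuration: the control state and the contents of all stacks (top of the stack first). -/
structure Cfg (M : OracleNTM) : Type where
  state : M.Λ
  stk : M.K → List Bool

/-- The initial configuration: the input `w` is on the input stack, all other stacks are empty. -/
def init (M : OracleNTM) (w : List Bool) : M.Cfg :=
  ⟨M.start, Function.update (fun _ => []) M.inputStack w⟩

/-- The successor configurations of `c`, for the oracle `f`. A call to the oracle takes one step; it
erases the query `q` and replaces the contents of the answer stack by the binary expansion of `f q`,
least significant bit on top. -/
def succs (M : OracleNTM) (f : List Bool → ℕ) (c : M.Cfg) : List M.Cfg :=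
  match M.code c.state with
  | .push s b l => [⟨l, Function.update c.stk s (b :: c.stk s)⟩]
  | .pop s l => [⟨l (c.stk s).head?, Function.update c.stk s (c.stk s).tail⟩]
  | .guess l => [⟨l false, c.stk⟩, ⟨l true, c.stk⟩]
  | .query l => [⟨l, Function.update (Function.update c.stk M.queryStack [])
      M.answerStack (f (c.stk M.queryStack)).bits⟩]
  | .accept => []
  | .reject => []

/-- `1` in an accepting state, `0` otherwise. -/
def acceptsNow (M : OracleNTM) (c : M.Cfg) : ℕ :=
  match M.code c.state with
  | .accept => 1
  | _ => 0

/-- Every computation path of `M` with oracle `f` that starts in `c` halts after at most `t` steps. -/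
def HaltsWithin (M : OracleNTM) (f : List Bool → ℕ) : ℕ → M.Cfg → Prop
  | 0, c => M.succs f c = []
  | t + 1, c => ∀ c' ∈ M.succs f c, HaltsWithin M f t c'

/-- The number of accepting computation paths of at most `t` steps of `M` with oracle `f` that start
in `c`. -/
def numAccept (M : OracleNTM) (f : List Bool → ℕ) : ℕ → M.Cfg → ℕ
  | 0, c => M.acceptsNow c
  | t + 1, c => M.acceptsNow c + ((M.succs f c).map (numAccept M f t)).sum

/-- `M` with oracle `f` runs in time `p`: on every input `w`, every computation path halts within
`p |w|` steps. -/
def RunsInTime (M : OracleNTM) (f : List Bool → ℕ) (p : Polynomial ℕ) : Prop :=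
  ∀ w : List Bool, M.HaltsWithin f (p.eval w.length) (M.init w)

/-- The number of accepting computation paths of `M` with oracle `f` on the input `w`, for a machine
that runs in time `p`. -/
def acceptingPaths (M : OracleNTM) (f : List Bool → ℕ) (p : Polynomial ℕ) (w : List Bool) : ℕ :=
  M.numAccept f (p.eval w.length) (M.init w)

end OracleNTM

/-! ### Complexity classes -/

/-- `#P^C`, for a class `C` of functions: the functions that count the accepting paths of a
polynomial-time nondeterministic machine that has an oracle in `C`. -/
def SharpPRel (C : Set (List Bool → ℕ)) : Set (List Bool → ℕ) :=
  {g | ∃ f ∈ C, ∃ (M : OracleNTM) (p : Polynomial ℕ),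
    M.RunsInTime f p ∧ ∀ w, g w = M.acceptingPaths f p w}

/-- `#P`: the only oracle available is the constant zero function, which is of no help. -/
def SharpP : Set (List Bool → ℕ) := SharpPRel {fun _ => 0}

/-- `coNP^C`, for a class `C` of functions: the languages membership in which is refuted by a
polynomial-time nondeterministic machine that has an oracle in `C`. -/
def coNPRel (C : Set (List Bool → ℕ)) : Set (Language Bool) :=
  {L | ∃ f ∈ C, ∃ (M : OracleNTM) (p : Polynomial ℕ),
    M.RunsInTime f p ∧ ∀ w, w ∉ L ↔ 0 < M.acceptingPaths f p w}

/-! ### Randomized circuits -/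

/-- An inner vertex of a circuit, given by its label and the indices of its predecessors. -/
inductive Gate : Type
  | and (a b : ℕ)
  | or (a b : ℕ)
  | not (a : ℕ)

namespace Gate

/-- The predecessors of a vertex. -/
def preds : Gate → List ℕ
  | and a b => [a, b]
  | or a b => [a, b]
  | not a => [a]

/-- The value of a vertex, from the list of the values of the earlier vertices. -/
def eval (vals : List Bool) : Gate → Bool
  | and a b => vals.getD a false && vals.getD b false
  | or a b => vals.getD a false || vals.getD b false
  | not a => !vals.getD a false

end Gate

/-- A randomized Boolean circuit whose input is an array of `n` records of `k` bits each, with `m`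
random input vertices and `ℓ` outputs. It is a directed acyclic graph with its vertices numbered in a
topological order: first the `n * k` input vertices (record by record), then the `m` random input
vertices, then the gates. The `j`-th output vertex has no label and no outgoing edge, and repeats the
value of the vertex number `outputs j`. -/
structure RandCircuit (n k ℓ m : ℕ) where
  gates : List Gate
  outputs : Fin ℓ → ℕ
  gates_wf : ∀ (i : ℕ) (hi : i < gates.length), ∀ a ∈ gates[i].preds, a < n * k + m + i
  outputs_wf : ∀ j, outputs j < n * k + m + gates.length

/-- Arrays `x`, `x'` of length `n` over `X = {0,1}^k` are neighboring if there is a position `i` such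
that they agree in all other positions. -/
def Neighboring {n k : ℕ} (x x' : Fin n → Fin k → Bool) : Prop :=
  ∃ i, ∀ j, j ≠ i → x j = x' j

/-- The bits of an array, record by record. -/
def flatBits {n k : ℕ} (x : Fin n → Fin k → Bool) : List Bool :=
  (List.ofFn x).flatMap fun y => List.ofFn y

namespace RandCircuit

variable {n k ℓ m : ℕ}

/-- The values of all vertices, in order, on the input `x` and the random bits `r`. -/
def values (ψ : RandCircuit n k ℓ m) (x : Fin n → Fin k → Bool) (r : Fin m → Bool) : List Bool :=
  ψ.gates.foldl (fun vals g => vals ++ [g.eval vals]) (flatBits x ++ List.ofFn r)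

/-- The output of the circuit on the input `x` and the random bits `r`. -/
def eval (ψ : RandCircuit n k ℓ m) (x : Fin n → Fin k → Bool) (r : Fin m → Bool) :
    Fin ℓ → Bool :=
  fun j => (ψ.values x r).getD (ψ.outputs j) false

/-- `Pr[ψ(x) ∈ E]`, over uniform random bits. -/
noncomputable def pr (ψ : RandCircuit n k ℓ m) (x : Fin n → Fin k → Bool)
    (E : Set (Fin ℓ → Bool)) : ℝ :=
  ({r : Fin m → Bool | ψ.eval x r ∈ E}.ncard : ℝ) / 2 ^ m

/-- `(ε, δ)`-differential privacy. -/
def IsDP (ψ : RandCircuit n k ℓ m) (ε δ : ℝ) : Prop :=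
  ∀ x x' : Fin n → Fin k → Bool, Neighboring x x' →
    ∀ E : Set (Fin ℓ → Bool), ψ.pr x E ≤ Real.exp ε * ψ.pr x' E + δ

/-- `δ_{x,x'}(o) = max (Pr[ψ(x) = o] - e^ε Pr[ψ(x') = o]) 0`. -/
noncomputable def pointwiseDelta (ψ : RandCircuit n k ℓ m) (ε : ℝ)
    (x x' : Fin n → Fin k → Bool) (o : Fin ℓ → Bool) : ℝ :=
  max (ψ.pr x {o} - Real.exp ε * ψ.pr x' {o}) 0

end RandCircuit

/-! ### Encodings as bit strings -/

/-- Self-delimiting code of a list, from a code of its entries. -/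
def encodeList {α : Type} (enc : α → List Bool) (l : List α) : List Bool :=
  (l.flatMap fun a => true :: enc a) ++ [false]

/-- Unary code of a natural number, used for vertex numbers. -/
def encodeUnary (a : ℕ) : List Bool := List.replicate a true ++ [false]

/-- Self-delimiting binary code of a natural number (least significant bit first), used for the
integers that make up a rational number. -/
def encodeBinary (a : ℕ) : List Bool := encodeList (fun b => [b]) a.bits

/-- Code of a gate. -/
def encodeGate : Gate → List Bool
  | .and a b => [true, true] ++ encodeUnary a ++ encodeUnary b
  | .or a b => [true, false] ++ encodeUnary a ++ encodeUnary b
  | .not a => [false] ++ encodeUnary a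

/-- Code of a randomized circuit; for `n, k > 0` its length is at most quadratic in the number of
vertices. -/
def encodeCircuit {n k ℓ m : ℕ} (ψ : RandCircuit n k ℓ m) : List Bool :=
  encodeUnary n ++ encodeUnary k ++ encodeUnary m ++ encodeList encodeGate ψ.gates ++
    encodeList encodeUnary (List.ofFn ψ.outputs)

/-- Code of a circuit `ψ`, of the number `e^ε = u / v` and of two inputs `x`, `x'` of `ψ`. -/
def encodeWithInputs {n k ℓ m : ℕ} (ψ : RandCircuit n k ℓ m) (u v : ℕ)
    (x x' : Fin n → Fin k → Bool) : List Bool :=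
  encodeCircuit ψ ++ encodeBinary u ++ encodeBinary v ++
    encodeList (fun b => [b]) (flatBits x) ++ encodeList (fun b => [b]) (flatBits x')

/-! ### The decision problem -/

/-- An instance of Decide-`ε,δ`-DP: a randomized circuit, the number `e^ε` as a fraction `u / v` of
positive integers, and the number `δ ≥ 0` as a fraction `d / e` of integers. -/
structure DPInstance where
  n : ℕ
  k : ℕ
  ℓ : ℕ
  m : ℕ
  ψ : RandCircuit n k ℓ m
  u : ℕ
  v : ℕ
  d : ℕ
  e : ℕ
  u_pos : 0 < u
  v_pos : 0 < v
  e_pos : 0 < e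

namespace DPInstance

/-- Code of an instance, with all integers in binary. -/
def encode (I : DPInstance) : List Bool :=
  encodeCircuit I.ψ ++ encodeBinary I.u ++ encodeBinary I.v ++ encodeBinary I.d ++ encodeBinary I.e

/-- The parameter `ε`, with `e^ε = u / v`. -/
noncomputable def ε (I : DPInstance) : ℝ := Real.log ((I.u : ℝ) / (I.v : ℝ))

/-- The parameter `δ`. -/
noncomputable def δ (I : DPInstance) : ℝ := (I.d : ℝ) / (I.e : ℝ)

end DPInstance

/-- The problem Decide-`ε,δ`-DP: the codes of all instances whose circuit is `(ε, δ)`-differentially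
private. -/
def DecideDP : Language Bool :=
  {w | ∃ I : DPInstance, w = I.encode ∧ I.ψ.IsDP I.ε I.δ}

end DPComplexity

namespace DPComplexity

/-! ### Program fragments -/

/-! For fixed x and x' let c(o) and c'(o) be the numbers of random strings that lead to the output o
on x and on x'. Then Pr[ψ(x) = o] = c(o)/2^m and e^ε = u/v, so that v·2^m·δ_{x,x'}(o) is the natural
number v·c(o) - u·c'(o) with truncated subtraction (`RandCircuit.sum_pointwiseDelta`). Both products
are values of one #P function: guess the random string, evaluate the circuit, and branch into v or u
accepting paths if the output is o (`Frag.counts_outputCount`, `outputSum_ofFn`). A machine with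
this oracle guesses o, asks for both products, and guesses a number that is at least the second and
smaller than the first. The number of successful guesses is exactly the truncated difference
(`Frag.runs_guessBetween`), and the sum over o is the required value (`differenceFun_encode`).

For privacy, the worst event E for a pair x, x' consists of the outputs o with Pr[ψ(x) = o] ≥ e^ε
Pr[ψ(x') = o], so privacy means that the sum of the δ_{x,x'}(o) is at most δ for all neighboring
pairs (`RandCircuit.isDP_iff`). With denominators cleared, a violation is d·v·2^m < g·e, where g is
the value counted above. The refuting machine guesses neighboring inputs, asks for g once,
multiplies and compares. It also has to accept every word that is not the code of an instance. All
codes are therefore prefix-free and are read from left to right, with every failure to read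
detected.

The machines are composed from fragments. `Eval` follows all paths at once and tracks the total
weight of the exits and a bound on the time; `Frag.halts_and_count` turns this into statements about
machines. Four specifications are derived from it: `Det` for deterministic parts, `Counts` for
numbers of accepting paths, and `Reach` and `Accepts` where only the existence of a path matters. -/

/-- Relabelling of the successor states of an instruction. -/
def Instr.map {K Λ Λ' : Type} (φ : Λ → Λ') : Instr K Λ → Instr K Λ'
  | .push s b l => .push s b (φ l)
  | .pop s l => .pop s fun b => φ (l b)
  | .guess l => .guess fun b => φ (l b)
  | .query l => .query (φ l)
  | .accept => .accept
  | .reject => .reject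

/-- The stacks of the machines constructed below. Queries are written on `Q` and answered on `R`. -/
inductive Reg : Type
  | I | P | V | T | A | B | C | X | Y | Q | R | O | U | W | D | S
  deriving DecidableEq

instance : Finite Reg := by
  refine Finite.of_injective
    (fun r : Reg => (Reg.casesOn r 0 1 2 3 4 5 6 7 8 9 10 11 12 13 14 15 : Fin 16)) ?_
  intro a b h
  cases a <;> cases b <;> first | rfl | (exfalso; revert h; decide)

/-- The contents of all stacks. -/
@[ext]
structure Store : Type where
  I : List Bool
  P : List Bool
  V : List Bool
  T : List Bool
  A : List Bool
  B : List Bool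
  C : List Bool
  X : List Bool
  Y : List Bool
  Q : List Bool
  R : List Bool
  O : List Bool
  U : List Bool
  W : List Bool
  D : List Bool
  S : List Bool

namespace Store

@[reducible]
def get (σ : Store) : Reg → List Bool
  | .I => σ.I | .P => σ.P | .V => σ.V | .T => σ.T | .A => σ.A | .B => σ.B | .C => σ.C | .X => σ.X
  | .Y => σ.Y | .Q => σ.Q | .R => σ.R | .O => σ.O | .U => σ.U | .W => σ.W | .D => σ.D | .S => σ.S

@[reducible]
def set (σ : Store) (s : Reg) (l : List Bool) : Store :=
  match s with
  | .I => { σ with I := l } | .P => { σ with P := l } | .V => { σ with V := l }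
  | .T => { σ with T := l } | .A => { σ with A := l } | .B => { σ with B := l }
  | .C => { σ with C := l } | .X => { σ with X := l } | .Y => { σ with Y := l }
  | .Q => { σ with Q := l } | .R => { σ with R := l } | .O => { σ with O := l }
  | .U => { σ with U := l } | .W => { σ with W := l } | .D => { σ with D := l }
  | .S => { σ with S := l }

theorem get_set (σ : Store) (s : Reg) (l : List Bool) :
    (σ.set s l).get = Function.update σ.get s l := by
  funext t
  by_cases h : t = s
  · subst h
    rw [Function.update_self]
    cases t <;> rfl
  · rw [Function.update_of_ne h]
    cases s <;> cases t <;> first | rfl | exact absurd rfl h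

@[simp]
theorem get_set_self (σ : Store) (s : Reg) (l : List Bool) : (σ.set s l).get s = l := by
  rw [get_set, Function.update_self]

theorem get_set_of_ne (σ : Store) {s t : Reg} (l : List Bool) (h : t ≠ s) :
    (σ.set s l).get t = σ.get t := by
  rw [get_set, Function.update_of_ne h]

@[simp]
theorem set_get_self (σ : Store) (s : Reg) : σ.set s (σ.get s) = σ := by
  cases s <;> rfl

@[simp]
theorem set_set (σ : Store) (s : Reg) (l l' : List Bool) : (σ.set s l).set s l' = σ.set s l' := by
  cases s <;> rfl

theorem get_injective : Function.Injective get := fun σ τ h => by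
  have H : ∀ s, σ.get s = τ.get s := congrFun h
  exact Store.ext (H .I) (H .P) (H .V) (H .T) (H .A) (H .B) (H .C) (H .X) (H .Y) (H .Q) (H .R) (H .O)
    (H .U) (H .W) (H .D) (H .S)

theorem set_comm (σ : Store) {s t : Reg} (l l' : List Bool) (h : s ≠ t) :
    (σ.set s l).set t l' = (σ.set t l').set s l :=
  get_injective (by rw [get_set, get_set, get_set, get_set, Function.update_comm h])

end Store

namespace Store

/-- Loops that transfer bits from `s` to `t` are treated by induction with an already modified
store; this collapses the nested updates that result. -/
theorem set_overwrite (σ : Store) {s t : Reg} (a b c d : List Bool) (h : s ≠ t) :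
    (((σ.set s a).set t b).set s c).set t d = (σ.set s c).set t d := by
  rw [set_comm _ b c h.symm, set_set, set_set]

end Store

/-- The store with `w` on the stack `I` and all other stacks empty. -/
def initStore (w : List Bool) : Store := ⟨w, [], [], [], [], [], [], [], [], [], [], [], [], [], [], []⟩

/-- `Eval code f Q l σ N t`: started in the state `l` with the store `σ`, all paths of `code` with
oracle `f` reach an exit `e`, where `Q e σ' N' t'` holds for the store `σ'` reached there, and the sum
of the numbers `N'` over all paths is `N`, while the number of steps plus `t'` is at most `t`. -/
inductive Eval {Λ E : Type} (code : Λ → Instr Reg (Λ ⊕ E)) (f : List Bool → ℕ)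
    (Q : E → Store → ℕ → ℕ → Prop) : Λ ⊕ E → Store → ℕ → ℕ → Prop
  | exit {e σ N t t'} : Q e σ N t → t ≤ t' → Eval code f Q (.inr e) σ N t'
  | push {l s b l' σ N t t'} : code l = .push s b l' →
      Eval code f Q l' (σ.set s (b :: σ.get s)) N t → t < t' → Eval code f Q (.inl l) σ N t'
  | pop {l s l' σ N t t'} : code l = .pop s l' →
      Eval code f Q (l' (σ.get s).head?) (σ.set s (σ.get s).tail) N t → t < t' →
      Eval code f Q (.inl l) σ N t'
  | guess {l l' σ N₀ N₁ t t'} : code l = .guess l' →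
      Eval code f Q (l' false) σ N₀ t → Eval code f Q (l' true) σ N₁ t → t < t' →
      Eval code f Q (.inl l) σ (N₀ + N₁) t'
  | query {l l' σ N t t'} : code l = .query l' →
      Eval code f Q l' { σ with Q := [], R := (f σ.Q).bits } N t → t < t' →
      Eval code f Q (.inl l) σ N t'

namespace Eval

variable {Λ Λ' E E' : Type} {code : Λ → Instr Reg (Λ ⊕ E)} {code' : Λ' → Instr Reg (Λ' ⊕ E')}
  {f : List Bool → ℕ} {Q : E → Store → ℕ → ℕ → Prop} {Q' : E' → Store → ℕ → ℕ → Prop}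

theorem mono {l : Λ ⊕ E} {σ : Store} {N t t' : ℕ} (h : Eval code f Q l σ N t) (ht : t ≤ t') :
    Eval code f Q l σ N t' := by
  cases h with
  | exit h h' => exact .exit h (h'.trans ht)
  | push h h' h'' => exact .push h h' (h''.trans_le ht)
  | pop h h' h'' => exact .pop h h' (h''.trans_le ht)
  | guess h h' h'' h''' => exact .guess h h' h'' (h'''.trans_le ht)
  | query h h' h'' => exact .query h h' (h''.trans_le ht)

/-- Transport along an embedding of code. -/
theorem transport (φ : Λ ⊕ E → Λ' ⊕ E') (ι : Λ → Λ') (hι : ∀ l, φ (.inl l) = .inl (ι l))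
    (hcode : ∀ l, code' (ι l) = (code l).map φ)
    (hQ : ∀ e σ N t, Q e σ N t → Eval code' f Q' (φ (.inr e)) σ N t)
    {l : Λ ⊕ E} {σ : Store} {N t : ℕ} (h : Eval code f Q l σ N t) :
    Eval code' f Q' (φ l) σ N t := by
  induction h with
  | exit h h' => exact (hQ _ _ _ _ h).mono h'
  | push h _ h'' ih => rw [hι]; exact .push (by rw [hcode, h]; rfl) ih h''
  | pop h _ h'' ih => rw [hι]; exact .pop (by rw [hcode, h]; rfl) ih h''
  | guess h _ _ h'' ih ih' => rw [hι]; exact .guess (by rw [hcode, h]; rfl) ih ih' h''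
  | query h _ h'' ih => rw [hι]; exact .query (by rw [hcode, h]; rfl) ih h''

end Eval

/-- A program fragment, which is left at one of the exits `E`. -/
structure Frag (E : Type) where
  Λ : Type
  [finiteΛ : Finite Λ]
  start : Λ ⊕ E
  code : Λ → Instr Reg (Λ ⊕ E)

attribute [instance] Frag.finiteΛ

namespace Frag

variable {E E' A : Type}

/-- `Eval` from the entry of a fragment. -/
def Runs (p : Frag E) (f : List Bool → ℕ) (Q : E → Store → ℕ → ℕ → Prop) (σ : Store) (N t : ℕ) :
    Prop :=
  Eval p.code f Q p.start σ N t

theorem Runs.mono {p : Frag E} {f : List Bool → ℕ} {Q : E → Store → ℕ → ℕ → Prop} {σ : Store}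
    {N t t' : ℕ} (h : p.Runs f Q σ N t) (ht : t ≤ t') : p.Runs f Q σ N t' :=
  Eval.mono h ht

/-! #### Constructors of fragments -/

/-- The entry is itself an exit, so leaving costs no step. -/
def ret (e : E) : Frag E where
  Λ := Empty
  start := .inr e
  code := Empty.elim

def push (s : Reg) (b : Bool) : Frag Unit where
  Λ := Unit
  start := .inl ()
  code _ := .push s b (.inr ())

def pop (s : Reg) : Frag (Option Bool) where
  Λ := Unit
  start := .inl ()
  code _ := .pop s .inr

def guess : Frag Bool where
  Λ := Unit
  start := .inl ()
  code _ := .guess .inr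

def query : Frag Unit where
  Λ := Unit
  start := .inl ()
  code _ := .query (.inr ())

/-- Run `p`, and then `q a` if `p` was left at the exit `a`. -/
def bind [Finite A] (p : Frag A) (q : A → Frag E) : Frag E where
  Λ := p.Λ ⊕ Σ a, (q a).Λ
  start := p.start.elim (fun l => .inl (.inl l))
    fun a => (q a).start.map (fun l => .inr ⟨a, l⟩) id
  code := Sum.elim
    (fun l => (p.code l).map fun l => l.elim (fun l => .inl (.inl l))
      fun a => (q a).start.map (fun l => .inr ⟨a, l⟩) id)
    fun l => ((q l.1).code l.2).map fun l' => l'.map (fun l' => .inr ⟨l.1, l'⟩) id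

/-- Repeatedly pop `s` and run the body, which depends on the popped bit and on a control variable;
the body either continues with a new value of the control variable, or leaves the loop. -/
def loop [Finite A] (s : Reg) (body : A → Option Bool → Frag (A ⊕ E)) (a : A) : Frag E where
  Λ := A ⊕ Σ x : A × Option Bool, (body x.1 x.2).Λ
  start := .inl (.inl a)
  code := Sum.elim
    (fun a => .pop s fun b => (body a b).start.elim (fun l => .inl (.inr ⟨(a, b), l⟩))
      fun e => e.map .inl id)
    fun l => ((body l.1.1 l.1.2).code l.2).map fun l' => l'.elim (fun l' => .inl (.inr ⟨l.1, l'⟩))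
      fun e => e.map .inl id

variable {f : List Bool → ℕ} {Q : E → Store → ℕ → ℕ → Prop} {σ : Store} {N N₀ N₁ t t' : ℕ}

theorem runs_ret {e : E} (h : Q e σ N t) : (ret e).Runs f Q σ N t :=
  .exit h le_rfl

theorem runs_guess {Q : Bool → Store → ℕ → ℕ → Prop} (h₀ : Q false σ N₀ t) (h₁ : Q true σ N₁ t) :
    guess.Runs f Q σ (N₀ + N₁) (t + 1) :=
  .guess rfl (.exit h₀ le_rfl) (.exit h₁ le_rfl) t.lt_succ_self

theorem runs_query {Q : Unit → Store → ℕ → ℕ → Prop}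
    (h : Q () { σ with Q := [], R := (f σ.Q).bits } N t) : query.Runs f Q σ N (t + 1) :=
  .query rfl (.exit h le_rfl) t.lt_succ_self

/-- Continuation style: the postcondition of `p` is the statement about the runs of `q`. The numbers
of paths of different branches are thus added without any intermediate store being named. -/
theorem runs_bind [Finite A] {p : Frag A} {q : A → Frag E}
    (h : p.Runs f (fun a σ N t => (q a).Runs f Q σ N t) σ N t) : (bind p q).Runs f Q σ N t := by
  refine Eval.transport (code' := (bind p q).code) (Q' := Q)
    (fun l => l.elim (fun l => .inl (.inl l)) fun a => (q a).start.map (fun l => .inr ⟨a, l⟩) id)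
    .inl (fun _ => rfl) (fun _ => rfl) ?_ h
  intro a σ N t h
  exact Eval.transport (code' := (bind p q).code)
    (fun l' : (q a).Λ ⊕ E => l'.map (fun l' => .inr ⟨a, l'⟩) id)
    (fun l => .inr ⟨a, l⟩) (fun _ => rfl) (fun _ => rfl) (fun e σ N t h => .exit h le_rfl) h

/-- Unrolls a single round. The loop reappears in the postcondition of its body, so termination is
left to an induction on the data wherever a loop is used. -/
theorem runs_loop [Finite A] {s : Reg} {body : A → Option Bool → Frag (A ⊕ E)} {a : A}
    (h : (body a (σ.get s).head?).Runs f
      (fun e σ N t => e.elim (fun a => (loop s body a).Runs f Q σ N t) (fun e => Q e σ N t))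
      (σ.set s (σ.get s).tail) N t) : (loop s body a).Runs f Q σ N (t + 1) := by
  refine Eval.pop (l := Sum.inl a) rfl ?_ t.lt_succ_self
  refine Eval.transport (code' := (loop s body a).code)
    (fun l' : (body a (σ.get s).head?).Λ ⊕ (A ⊕ E) =>
      l'.elim (fun l' => .inl (.inr ⟨(a, (σ.get s).head?), l'⟩)) fun e => e.map .inl id)
    (fun l => .inr ⟨(a, (σ.get s).head?), l⟩) (fun _ => rfl) (fun _ => rfl) ?_ h
  rintro (a' | e) σ N t h
  · exact h
  · exact .exit h le_rfl

/-! #### Deterministic fragments -/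

/-- From the store `σ`, the fragment `p` reaches the exit `e` with the store `σ'`, without branching
and within `c` steps. -/
def Det (p : Frag E) (f : List Bool → ℕ) (σ : Store) (e : E) (σ' : Store) (c : ℕ) : Prop :=
  ∀ (Q : E → Store → ℕ → ℕ → Prop) (N t : ℕ), Q e σ' N t → p.Runs f Q σ N (t + c)

theorem Det.mono {p : Frag E} {e : E} {σ' : Store} {c c' : ℕ} (h : p.Det f σ e σ' c) (hc : c ≤ c') :
    p.Det f σ e σ' c' :=
  fun Q N t hQ => (h Q N t hQ).mono (by omega)

theorem det_ret (e : E) : (ret e).Det f σ e σ 0 :=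
  fun _ _ _ h => runs_ret h

theorem det_ret_of_eq {σ' : Store} (e : E) (h : σ = σ') : (ret e).Det f σ e σ' 0 :=
  h ▸ det_ret e

theorem Det.congr {p : Frag E} {e : E} {σ' σ'' : Store} {c : ℕ} (h : p.Det f σ e σ' c)
    (h' : σ' = σ'') : p.Det f σ e σ'' c :=
  h' ▸ h

theorem det_push (s : Reg) (b : Bool) : (push s b).Det f σ () (σ.set s (b :: σ.get s)) 1 :=
  fun _ _ t h => .push rfl (.exit h le_rfl) t.lt_succ_self

theorem det_pop_nil {s : Reg} (h : σ.get s = []) : (pop s).Det f σ none σ 1 := by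
  intro Q N t hQ
  refine .pop rfl (.exit ?_ le_rfl) t.lt_succ_self
  have : σ.set s [] = σ := by rw [← h, Store.set_get_self]
  simpa [h, this] using hQ

theorem det_pop_cons {s : Reg} {b : Bool} {l : List Bool} (h : σ.get s = b :: l) :
    (pop s).Det f σ (some b) (σ.set s l) 1 := by
  intro Q N t hQ
  refine .pop rfl (.exit ?_ le_rfl) t.lt_succ_self
  simpa [h] using hQ

theorem det_query : query.Det f σ () { σ with Q := [], R := (f σ.Q).bits } 1 :=
  fun _ _ _ h => runs_query h

theorem Det.runs_bind [Finite A] {p : Frag A} {q : A → Frag E} {a : A} {σ' : Store} {c : ℕ}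
    (h : p.Det f σ a σ' c) (h' : (q a).Runs f Q σ' N t) : (bind p q).Runs f Q σ N (t + c) :=
  Frag.runs_bind (h _ _ _ h')

theorem Det.bind [Finite A] {p : Frag A} {q : A → Frag E} {a : A} {e : E} {σ' σ'' : Store}
    {c c' : ℕ} (h : p.Det f σ a σ' c) (h' : (q a).Det f σ' e σ'' c') :
    (Frag.bind p q).Det f σ e σ'' (c' + c) :=
  fun Q N t hQ => (h.runs_bind (h' Q N t hQ)).mono (by omega)

section Loop

variable [Finite A] {s : Reg} {body : A → Option Bool → Frag (A ⊕ E)} {a a' : A} {b : Bool}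
  {l : List Bool} {e : E} {σ' σ'' : Store} {c c' : ℕ}

theorem det_loop_nil (h : σ.get s = []) (h' : (body a none).Det f σ (.inr e) σ' c) :
    (loop s body a).Det f σ e σ' (c + 1) := by
  intro Q N t hQ
  refine (runs_loop (t := t + c) ?_).mono (by omega)
  have : σ.set s [] = σ := by rw [← h, Store.set_get_self]
  simp only [h, List.head?_nil, List.tail_nil, this]
  exact h' _ _ _ hQ

theorem det_loop_exit (h : σ.get s = b :: l)
    (h' : (body a (some b)).Det f (σ.set s l) (.inr e) σ' c) :
    (loop s body a).Det f σ e σ' (c + 1) := by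
  intro Q N t hQ
  refine (runs_loop (t := t + c) ?_).mono (by omega)
  simp only [h, List.head?_cons, List.tail_cons]
  exact h' _ _ _ hQ

theorem det_loop_cons (h : σ.get s = b :: l)
    (h' : (body a (some b)).Det f (σ.set s l) (.inl a') σ' c)
    (h'' : (loop s body a').Det f σ' e σ'' c') :
    (loop s body a).Det f σ e σ'' (c' + c + 1) := by
  intro Q N t hQ
  refine (runs_loop (t := t + c' + c) ?_).mono (by omega)
  simp only [h, List.head?_cons, List.tail_cons]
  exact h' _ _ _ (h'' _ _ _ hQ)

/-- A loop may go on although its stack is empty; addition needs this when the number on the loop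
stack is the shorter one. -/
theorem det_loop_nil_cons (h : σ.get s = [])
    (h' : (body a none).Det f σ (.inl a') σ' c)
    (h'' : (loop s body a').Det f σ' e σ'' c') :
    (loop s body a).Det f σ e σ'' (c' + c + 1) := by
  intro Q N t hQ
  refine (runs_loop (t := t + c' + c) ?_).mono (by omega)
  have : σ.set s [] = σ := by rw [← h, Store.set_get_self]
  simp only [h, List.head?_nil, List.tail_nil, this]
  exact h' _ _ _ (h'' _ _ _ hQ)

theorem runs_loop_nil (h : σ.get s = []) (h' : (body a none).Runs f
      (fun e σ N t => e.elim (fun a => (loop s body a).Runs f Q σ N t) (fun e => Q e σ N t)) σ N t) :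
    (loop s body a).Runs f Q σ N (t + 1) := by
  refine runs_loop ?_
  have : σ.set s [] = σ := by rw [← h, Store.set_get_self]
  simpa only [h, List.head?_nil, List.tail_nil, this] using h'

theorem runs_loop_cons (h : σ.get s = b :: l) (h' : (body a (some b)).Runs f
      (fun e σ N t => e.elim (fun a => (loop s body a).Runs f Q σ N t) (fun e => Q e σ N t))
      (σ.set s l) N t) :
    (loop s body a).Runs f Q σ N (t + 1) := by
  refine runs_loop ?_
  simpa only [h, List.head?_cons, List.tail_cons] using h'

end Loop

/-! #### Composition with a budget of steps -/

section Budget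

variable {e : E} {σ' σ'' : Store} {c C : ℕ}

theorem det_done (h : σ = σ') : (ret e).Det f σ e σ' C :=
  (det_ret_of_eq e h).mono C.zero_le

/-- The budget `C` is fixed in advance and reduced by each part, so that cost estimates become
linear inequalities between explicit terms. -/
theorem Det.step [Finite A] {p : Frag A} {q : A → Frag E} {a : A} (h : p.Det f σ a σ' c) (hc : c ≤ C)
    (h' : (q a).Det f σ' e σ'' (C - c)) : (Frag.bind p q).Det f σ e σ'' C :=
  (h.bind h').mono (by omega)

theorem det_push_bind {q : Unit → Frag E} {s : Reg} {b : Bool} (hc : 1 ≤ C)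
    (h' : (q ()).Det f (σ.set s (b :: σ.get s)) e σ' (C - 1)) :
    (Frag.bind (push s b) q).Det f σ e σ' C :=
  (det_push s b).step hc h'

theorem det_pop_cons_bind {q : Option Bool → Frag E} {s : Reg} {b : Bool} {l : List Bool}
    (h : σ.get s = b :: l) (hc : 1 ≤ C) (h' : (q (some b)).Det f (σ.set s l) e σ' (C - 1)) :
    (Frag.bind (pop s) q).Det f σ e σ' C :=
  (det_pop_cons h).step hc h'

theorem det_pop_nil_bind {q : Option Bool → Frag E} {s : Reg}
    (h : σ.get s = []) (hc : 1 ≤ C) (h' : (q none).Det f σ e σ' (C - 1)) :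
    (Frag.bind (pop s) q).Det f σ e σ' C :=
  (det_pop_nil h).step hc h'

end Budget

/-! #### Machines from fragments -/

/-- The machine that runs `p` and accepts at the exit `true`. -/
def machine (p : Frag Bool) : OracleNTM where
  K := Reg
  Λ := p.Λ ⊕ Bool
  inputStack := .I
  queryStack := .Q
  answerStack := .R
  query_ne_answer := by decide
  start := p.start
  code := Sum.elim p.code fun b => if b then .accept else .reject

/-- The number of accepting paths that remain at an exit of a machine. -/
def AtExit (e : Bool) (_ : Store) (N _ : ℕ) : Prop := N = e.toNat

/-- The rules of `Eval` mirror `succs`, and every rule other than `exit` spends at least one unit of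
time; induction on the derivation gives halting and the count together. -/
theorem halts_and_count (p : Frag Bool) {l : p.Λ ⊕ Bool} {σ : Store} {N t : ℕ}
    (h : Eval p.code f AtExit l σ N t) :
    p.machine.HaltsWithin f t ⟨l, σ.get⟩ ∧ p.machine.numAccept f t ⟨l, σ.get⟩ = N := by
  have key : ∀ (c : p.machine.Cfg) (L : List p.machine.Cfg) (t t' : ℕ) (N : ℕ),
      p.machine.succs f c = L → L ≠ [] → p.machine.acceptsNow c = 0 → t < t' →
      (∀ t', t ≤ t' → (∀ c' ∈ L, p.machine.HaltsWithin f t' c') ∧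
        (L.map (p.machine.numAccept f t')).sum = N) →
      p.machine.HaltsWithin f t' c ∧ p.machine.numAccept f t' c = N := by
    intro c L t t' N hL _ hA htt hS
    obtain ⟨t', rfl⟩ : ∃ s, t' = s + 1 := ⟨t' - 1, by omega⟩
    have := hS t' (by omega)
    subst hL
    exact ⟨this.1, by simp only [OracleNTM.numAccept, hA, this.2, zero_add]⟩
  -- The two branches of a guess share one bound, and bounds may have slack, so the claim is needed
  -- for every larger number of remaining steps.
  suffices H : ∀ t', t ≤ t' →
      p.machine.HaltsWithin f t' ⟨l, σ.get⟩ ∧ p.machine.numAccept f t' ⟨l, σ.get⟩ = N from H t le_rfl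
  induction h with
  | @exit e σ N t t' h h' =>
    intro t'' _
    unfold AtExit at h
    subst h
    have hs : p.machine.succs f ⟨.inr e, σ.get⟩ = [] := by cases e <;> rfl
    have ha : p.machine.acceptsNow ⟨.inr e, σ.get⟩ = e.toNat := by cases e <;> rfl
    cases t'' with
    | zero => exact ⟨hs, ha⟩
    | succ t'' =>
      simp only [OracleNTM.HaltsWithin, OracleNTM.numAccept, hs, ha]
      simp
  | @push l s b l' σ N t t' h _ h'' ih =>
    intro t'' ht
    have hc : p.machine.code (.inl l) = .push s b l' := h
    refine key _ [⟨l', (σ.set s (b :: σ.get s)).get⟩] t t'' N ?_ (by simp) ?_ (by omega) ?_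
    · simp only [OracleNTM.succs, hc, Store.get_set]; rfl
    · simp only [OracleNTM.acceptsNow, hc]
    · intro t' ht; simpa using ih t' ht
  | @pop l s l' σ N t t' h _ h'' ih =>
    intro t'' ht
    have hc : p.machine.code (.inl l) = .pop s l' := h
    refine key _ [⟨l' (σ.get s).head?, (σ.set s (σ.get s).tail).get⟩] t t'' N ?_ (by simp) ?_
      (by omega) ?_
    · simp only [OracleNTM.succs, hc, Store.get_set]; rfl
    · simp only [OracleNTM.acceptsNow, hc]
    · intro t' ht; simpa using ih t' ht
  | @guess l l' σ N₀ N₁ t t' h _ _ h'' ih ih' =>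
    intro t'' ht
    have hc : p.machine.code (.inl l) = .guess l' := h
    refine key _ [⟨l' false, σ.get⟩, ⟨l' true, σ.get⟩] t t'' _ ?_ (by simp) ?_ (by omega) ?_
    · simp only [OracleNTM.succs, hc]
    · simp only [OracleNTM.acceptsNow, hc]
    · intro t' ht
      have h1 := ih t' ht
      have h2 := ih' t' ht
      simp [h1, h2]
  | @query l l' σ N t t' h _ h'' ih =>
    intro t'' ht
    have hc : p.machine.code (.inl l) = .query l' := h
    refine key _ [⟨l', ((σ.set .Q []).set .R (f σ.Q).bits).get⟩] t t'' N ?_ (by simp) ?_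
      (by omega) ?_
    · simp only [OracleNTM.succs, hc]
      rw [Store.get_set, Store.get_set]
      rfl
    · simp only [OracleNTM.acceptsNow, hc]
    · intro t' ht
      have : (σ.set .Q []).set .R (f σ.Q).bits = { σ with Q := [], R := (f σ.Q).bits } := rfl
      simpa [this] using ih t' ht

theorem Runs.machine {p : Frag Bool} {w : List Bool} (h : p.Runs f AtExit (initStore w) N t) :
    p.machine.HaltsWithin f t (p.machine.init w) ∧
      p.machine.numAccept f t (p.machine.init w) = N := by
  have h1 := p.halts_and_count h
  have : p.machine.init w = ⟨p.start, (initStore w).get⟩ := by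
    unfold OracleNTM.init
    congr 1
    funext s
    cases s <;> rfl
  rwa [this]

end Frag

/-- The computation tree is at most binary. This keeps the binary answers of a counting oracle
polynomially long, so that the calling machine has time to read them. -/
theorem OracleNTM.numAccept_le (M : OracleNTM) (f : List Bool → ℕ) (t : ℕ) (c : M.Cfg) :
    M.numAccept f t c ≤ 2 ^ t := by
  induction t generalizing c with
  | zero =>
    simp only [numAccept, acceptsNow]
    split <;> simp
  | succ t ih =>
    simp only [numAccept, acceptsNow, succs]
    have := Nat.one_le_two_pow (n := t)
    split <;> split <;> simp_all [pow_succ] <;> grind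

theorem OracleNTM.length_bits_acceptingPaths_le (M : OracleNTM) (f : List Bool → ℕ)
    (p : Polynomial ℕ) (w : List Bool) :
    (M.acceptingPaths f p w).bits.length ≤ p.eval w.length + 1 := by
  rw [Nat.size_eq_bits_len, ← Nat.size_pow]
  exact Nat.size_le_size (M.numAccept_le f _ _)

/-! ### Codes -/

/-- Every string has at most one prefix that is a code. -/
def PrefixFree {α : Type} (enc : α → List Bool) : Prop :=
  ∀ a b r s, enc a ++ r = enc b ++ s → a = b ∧ r = s

theorem prefixFree_bit : PrefixFree fun b : Bool => [b] := by
  intro a b r s h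
  simpa using h

theorem encodeUnary_succ (a : ℕ) : encodeUnary (a + 1) = true :: encodeUnary a := by
  simp [encodeUnary, List.replicate_succ]

theorem prefixFree_encodeUnary : PrefixFree encodeUnary := by
  intro a
  induction a with
  | zero =>
    rintro (_ | b) r s h
    · simpa [encodeUnary] using h
    · simp [encodeUnary, List.replicate_succ] at h
  | succ a ih =>
    rintro (_ | b) r s h
    · simp [encodeUnary, List.replicate_succ] at h
    · simp only [encodeUnary_succ, List.cons_append, List.cons.injEq, true_and] at h
      have := ih b r s h
      exact ⟨by omega, this.2⟩

theorem length_encodeUnary (a : ℕ) : (encodeUnary a).length = a + 1 := by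
  simp [encodeUnary]

theorem encodeList_nil {α : Type} (enc : α → List Bool) : encodeList enc [] = [false] := rfl

theorem encodeList_cons {α : Type} (enc : α → List Bool) (a : α) (l : List α) :
    encodeList enc (a :: l) = true :: (enc a ++ encodeList enc l) := by
  simp [encodeList]

/-- The marker in front of each entry decides whether the list goes on, and prefix-freeness of `enc`
separates the entry from what follows. -/
theorem PrefixFree.encodeList {α : Type} {enc : α → List Bool} (h : PrefixFree enc) :
    PrefixFree (encodeList enc) := by
  intro l
  induction l with
  | nil =>
    rintro (_ | ⟨b, l'⟩) r s h
    · simpa [encodeList_nil] using h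
    · simp [encodeList_nil, encodeList_cons] at h
  | cons a l ih =>
    rintro (_ | ⟨b, l'⟩) r s h'
    · simp [encodeList_nil, encodeList_cons] at h'
    · simp only [encodeList_cons, List.cons_append, List.cons.injEq, true_and,
        List.append_assoc] at h'
      obtain ⟨rfl, h'⟩ := h _ _ _ _ h'
      obtain ⟨rfl, hr⟩ := ih l' r s (List.append_cancel_left h')
      exact ⟨rfl, hr⟩

theorem prefixFree_encodeGate : PrefixFree encodeGate := by
  rintro (⟨a, b⟩ | ⟨a, b⟩ | a) (⟨a', b'⟩ | ⟨a', b'⟩ | a') r s h <;>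
    simp only [encodeGate, List.cons_append, List.nil_append, List.cons.injEq, List.append_assoc,
      true_and, Bool.false_eq_true, false_and, Bool.true_eq_false] at h
  · obtain ⟨h1, h⟩ := prefixFree_encodeUnary _ _ _ _ h
    obtain ⟨h2, h⟩ := prefixFree_encodeUnary _ _ _ _ h
    exact ⟨by rw [h1, h2], h⟩
  · obtain ⟨h1, h⟩ := prefixFree_encodeUnary _ _ _ _ h
    obtain ⟨h2, h⟩ := prefixFree_encodeUnary _ _ _ _ h
    exact ⟨by rw [h1, h2], h⟩
  · obtain ⟨h1, h⟩ := prefixFree_encodeUnary _ _ _ _ h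
    exact ⟨by rw [h1], h⟩

/-- Code of a list of bits. -/
abbrev encodeBits (l : List Bool) : List Bool := encodeList (fun b => [b]) l

theorem prefixFree_encodeBits : PrefixFree encodeBits := prefixFree_bit.encodeList

theorem encodeBits_cons (b : Bool) (l : List Bool) :
    encodeBits (b :: l) = true :: b :: encodeBits l := encodeList_cons _ _ _

theorem length_encodeBits (l : List Bool) : (encodeBits l).length = 2 * l.length + 1 := by
  induction l with
  | nil => rfl
  | cons b l ih => rw [encodeBits_cons]; simp only [List.length_cons, ih]; ring

theorem length_le_length_encodeList {α : Type} (enc : α → List Bool) (l : List α) :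
    l.length + 1 ≤ (encodeList enc l).length := by
  induction l with
  | nil => simp [encodeList_nil]
  | cons a l ih => simp only [encodeList_cons, List.length_cons, List.length_append]; omega

namespace Frag

variable {f : List Bool → ℕ} {σ : Store}

/-! ### Subroutines -/

/-- Move the contents of `s` to `t`, in reverse order. -/
def move (s t : Reg) : Frag Unit :=
  loop (A := Unit) s (fun _ b => match b with
    | none => ret (.inr ())
    | some b => bind (push t b) fun _ => ret (.inl ())) ()

theorem det_move {s t : Reg} (h : s ≠ t) :
    (move s t).Det f σ () ((σ.set s []).set t ((σ.get s).reverse ++ σ.get t))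
      (2 * (σ.get s).length + 1) := by
  generalize hl : σ.get s = l
  induction l generalizing σ with
  | nil =>
    refine Det.mono (det_loop_nil hl (det_ret_of_eq _ ?_)) (by simp)
    have : σ.set s [] = σ := by rw [← hl, Store.set_get_self]
    simp [this]
  | cons b l ih =>
    have := ih (σ := (σ.set s l).set t (b :: (σ.set s l).get t))
      (by rw [Store.get_set_of_ne _ _ h, Store.get_set_self])
    refine ((det_loop_cons hl (c := 1) ?_ this).congr ?_).mono (by simp only [List.length_cons]; omega)
    · exact (det_push t b).bind (det_ret _)
    rw [Store.set_overwrite _ _ _ _ _ h, Store.get_set_self, Store.get_set_of_ne _ _ h.symm]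
    simp

/-- Read a number in unary code to the stack `s`. -/
def readUnary (s : Reg) : Frag Bool :=
  loop (A := Unit) .I (fun _ b => match b with
    | none => ret (.inr false)
    | some true => bind (push s true) fun _ => ret (.inl ())
    | some false => ret (.inr true)) ()

theorem det_readUnary {s : Reg} (hI : s ≠ .I) {a : ℕ} {rest : List Bool}
    (h : σ.I = encodeUnary a ++ rest) :
    (readUnary s).Det f σ true
      ((σ.set .I rest).set s (List.replicate a true ++ σ.get s)) (2 * a + 1) := by
  induction a generalizing σ with
  | zero =>
    refine Det.mono (det_loop_exit (s := .I) (b := false) (l := rest) h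
      (det_ret_of_eq _ ?_)) (by omega)
    rw [← Store.get_set_of_ne σ rest hI]
    simp
  | succ a ih =>
    rw [encodeUnary_succ] at h
    have := ih (σ := (σ.set .I (encodeUnary a ++ rest)).set s
      (true :: (σ.set .I (encodeUnary a ++ rest)).get s)) (Store.get_set_of_ne _ _ hI.symm)
    refine ((det_loop_cons (s := .I) h (c := 1) ?_ this).congr ?_).mono (by omega)
    · exact (det_push s true).bind (det_ret _)
    rw [Store.set_overwrite _ _ _ _ _ hI.symm, Store.get_set_self, Store.get_set_of_ne _ _ hI]
    simp [List.replicate_succ']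

/-- Every reader needs a statement about failure, since the refuting machine has to accept malformed
words. Here failure means that the input consists of ones only, and the loop stops at its end. -/
theorem det_readUnary_fail {s : Reg} (hI : s ≠ .I)
    (h : ¬ ∃ a rest, σ.I = encodeUnary a ++ rest) :
    ∃ σ', (readUnary s).Det f σ false σ' (2 * σ.I.length + 1) := by
  generalize hl : σ.I = l at h
  induction l generalizing σ with
  | nil => exact ⟨_, det_loop_nil (s := .I) hl (det_ret _)⟩
  | cons b l ih =>
    cases b with
    | false => exact absurd ⟨0, l, rfl⟩ h
    | true =>
      obtain ⟨σ', h'⟩ := ih (σ := (σ.set .I l).set s (true :: (σ.set .I l).get s))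
        (Store.get_set_of_ne _ _ hI.symm)
        (fun ⟨a, rest, h'⟩ => h ⟨a + 1, rest, by rw [h', encodeUnary_succ]; rfl⟩)
      refine ⟨σ', Det.mono (det_loop_cons (s := .I) hl (c := 1) ?_ h')
        (by simp only [List.length_cons]; omega)⟩
      exact (det_push _ _).bind (det_ret _)

/-- Read a list of bits to the stack `s`, in reverse order. The exit is `none` if this fails, and
otherwise tells the last bit. -/
def readBits (s : Reg) : Frag (Option (Option Bool)) :=
  loop (A := Option Bool) .I (fun a b => match b with
    | none => ret (.inr none)
    | some false => ret (.inr (some a))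
    | some true => bind (pop .I) fun b => match b with
      | none => ret (.inr none)
      | some b => bind (push s b) fun _ => ret (.inl (some b))) none

theorem det_readBits {s : Reg} (hI : s ≠ .I) {l rest : List Bool}
    (h : σ.I = encodeBits l ++ rest) :
    (readBits s).Det f σ (some l.getLast?)
      ((σ.set .I rest).set s (l.reverse ++ σ.get s)) (3 * l.length + 1) := by
  -- The control variable remembers the last bit read. Its initial value `a` survives only if no bit
  -- is read, which is what `Option.or` expresses.
  suffices H : ∀ a, Det (loop _ _ a) f σ (some (l.getLast?.or a)) _ _ by
    have := H none
    rwa [Option.or_none] at this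
  intro a
  induction l generalizing σ a with
  | nil =>
    refine Det.mono (det_loop_exit (s := .I) (b := false) (l := rest) h
      (det_ret_of_eq _ ?_)) (by omega)
    rw [← Store.get_set_of_ne σ rest hI]
    simp
  | cons b l ih =>
    rw [encodeBits_cons] at h
    have := ih (σ := ((σ.set .I (b :: (encodeBits l ++ rest))).set .I (encodeBits l ++ rest)).set s
      (b :: ((σ.set .I (b :: (encodeBits l ++ rest))).set .I (encodeBits l ++ rest)).get s))
      (Store.get_set_of_ne _ _ hI.symm) (some b)
    have he : l.getLast?.or (some b) = (b :: l).getLast?.or a := by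
      simp only [List.getLast?_cons]
      cases l.getLast? <;> simp
    rw [← he]
    refine ((det_loop_cons (s := .I) h (c := 2) ?_ this).congr ?_).mono
      (by simp only [List.length_cons]; omega)
    · exact (det_pop_cons (s := .I) (Store.get_set_self _ _ _)).bind
        ((det_push s b).bind (det_ret _))
    rw [Store.set_overwrite _ _ _ _ _ hI.symm, Store.get_set_self, Store.set_set,
      Store.set_set]
    simp [Store.get_set_of_ne _ _ hI]

theorem det_readBits_fail {s : Reg} (hI : s ≠ .I)
    (h : ¬ ∃ l rest, σ.I = encodeBits l ++ rest) :
    ∃ σ', (readBits s).Det f σ none σ' (2 * σ.I.length + 2) := by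
  suffices H : ∀ a, ∃ σ', Det (loop _ _ a) f σ none σ' _ from H none
  intro a
  -- A full round consumes two bits, the marker and the entry, so the induction is on the length.
  induction hn : σ.I.length using Nat.strong_induction_on generalizing σ a with
  | _ n ih =>
  subst hn
  generalize hl : σ.I = l at h
  match l, hl with
  | [], hl => exact ⟨_, (det_loop_nil (s := .I) hl (det_ret _)).mono (by omega)⟩
  | false :: l, hl => exact absurd ⟨[], l, rfl⟩ h
  | [true], hl =>
    refine ⟨_, (det_loop_exit (s := .I) (σ' := σ.set .I []) hl (c := 1) ?_).mono (by simp)⟩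
    exact (det_pop_nil (s := .I) (Store.get_set_self _ _ _)).bind (det_ret _)
  | true :: b :: l, hl =>
    have hI' : (((σ.set .I (b :: l)).set .I l).set s (b :: ((σ.set .I (b :: l)).set .I l).get s)).I
      = l := Store.get_set_of_ne _ _ hI.symm
    obtain ⟨σ', h'⟩ := ih l.length (by simp [hl])
      (σ := (((σ.set .I (b :: l)).set .I l).set s (b :: ((σ.set .I (b :: l)).set .I l).get s)))
      (fun ⟨l', rest, h'⟩ => h ⟨b :: l', rest, by
        rw [hI'] at h'; rw [encodeBits_cons, h']; rfl⟩) (some b) (by rw [hI'])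
    refine ⟨σ', (det_loop_cons (s := .I) hl (c := 2) ?_ h').mono (by simp; omega)⟩
    exact (det_pop_cons (s := .I) (Store.get_set_self _ _ _)).bind
      ((det_push s b).bind (det_ret _))

/-- Read a unary number `a` from the input and move `a` bits from `V` to `T`. -/
def seek : Frag Bool :=
  loop (A := Unit) .I (fun _ b => match b with
    | none => ret (.inr false)
    | some false => ret (.inr true)
    | some true => bind (pop .V) fun b => match b with
      | none => ret (.inr false)
      | some b => bind (push .T b) fun _ => ret (.inl ())) ()

theorem det_seek {a : ℕ} {rest : List Bool} (h : σ.I = encodeUnary a ++ rest)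
    (ha : a ≤ σ.V.length) :
    seek.Det f σ true
      { σ with I := rest, V := σ.V.drop a, T := (σ.V.take a).reverse ++ σ.T } (3 * a + 1) := by
  induction a generalizing σ with
  | zero => exact det_loop_exit (s := .I) (b := false) (l := rest) h (det_ret _)
  | succ a ih =>
    rw [encodeUnary_succ] at h
    obtain ⟨b, V, hV⟩ := List.exists_cons_of_length_pos (l := σ.V) (by omega)
    have := ih (σ := { σ with I := encodeUnary a ++ rest, V := V, T := b :: σ.T }) rfl
      (by rw [hV] at ha; simpa using ha)
    refine ((det_loop_cons (s := .I) h (c := 2) ?_ this).congr ?_).mono (by omega)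
    · exact det_pop_cons_bind hV (by omega) (det_push_bind (by omega) (det_done rfl))
    · simp [hV]

theorem det_seek_fail (h : ¬ ∃ a rest, σ.I = encodeUnary a ++ rest ∧ a ≤ σ.V.length) :
    ∃ σ', seek.Det f σ false σ' (3 * σ.V.length + 2) := by
  generalize hV : σ.V = V
  induction V generalizing σ with
  | nil =>
    generalize hl : σ.I = l at h
    match l, hl with
    | [], hl => exact ⟨_, (det_loop_nil (s := .I) hl (det_ret _)).mono (by omega)⟩
    | false :: l, hl => exact absurd ⟨0, l, rfl, by omega⟩ h
    | true :: l, hl =>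
      refine ⟨_, det_loop_exit (s := .I) (σ' := σ.set .I l) hl (c := 1) ?_⟩
      exact det_pop_nil_bind (s := .V) hV (by omega) (det_done rfl)
  | cons b V ih =>
    generalize hl : σ.I = l at h
    match l, hl with
    | [], hl => exact ⟨_, (det_loop_nil (s := .I) hl (det_ret _)).mono (by omega)⟩
    | false :: l, hl => exact absurd ⟨0, l, rfl, by omega⟩ h
    | true :: l, hl =>
      obtain ⟨σ', h'⟩ := ih (σ := { σ with I := l, V := V, T := b :: σ.T })
        (fun ⟨a, rest, h1, h2⟩ => h ⟨a + 1, rest, by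
          rw [encodeUnary_succ]
          exact ⟨congrArg (true :: ·) h1, by rw [hV]; simpa using h2⟩⟩) rfl
      refine ⟨σ', (det_loop_cons (s := .I) hl (c := 2) ?_ h').mono (by simp only [List.length_cons]; omega)⟩
      exact det_pop_cons_bind hV (by omega) (det_push_bind (by omega) (det_done rfl))

/-- Read a unary number `a` from the input and look up entry number `a` of `V`. -/
def lookup : Frag (Option Bool) :=
  bind seek fun ok => match ok with
    | false => ret none
    | true => bind (pop .V) fun b => match b with
      | none => ret none
      | some b => bind (push .V b) fun _ => bind (move .T .V) fun _ => ret (some b)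

theorem det_lookup {a : ℕ} {rest : List Bool} (h : σ.I = encodeUnary a ++ rest)
    (ha : a < σ.V.length) (hT : σ.T = []) :
    lookup.Det f σ (some (σ.V.getD a false)) { σ with I := rest, T := [] }
      (5 * σ.V.length + 4) := by
  have h1 := det_seek (f := f) h ha.le
  -- After `seek`, the wanted entry is on top of `V` and the earlier ones are reversed on `T`;
  -- moving them back restores `V`.
  have hd : σ.V.drop a = σ.V.getD a false :: σ.V.drop (a + 1) := by
    rw [List.getD_eq_getElem _ _ ha]; exact List.drop_eq_getElem_cons ha
  refine h1.step (by omega) (det_pop_cons_bind (s := .V) hd (by omega) (det_push_bind (by omega)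
    ((det_move (by decide)).step ?_ (det_done ?_))))
  · simp only [Store.get, hT, List.append_nil, List.length_reverse, List.length_take]
    omega
  · simp only [Store.set, Store.get, hT, List.append_nil, List.reverse_reverse]
    rw [← hd, List.take_append_drop]

theorem det_lookup_fail (h : ¬ ∃ a rest, σ.I = encodeUnary a ++ rest ∧ a < σ.V.length) :
    ∃ σ', lookup.Det f σ none σ' (5 * σ.V.length + 4) := by
  -- The borderline case is `a = σ.V.length`: all of `V` can be moved away, but then no entry is
  -- left to pop.
  by_cases h' : ∃ a rest, σ.I = encodeUnary a ++ rest ∧ a ≤ σ.V.length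
  · obtain ⟨a, rest, h1, h2⟩ := h'
    have : a = σ.V.length := by
      by_contra h3
      exact h ⟨a, rest, h1, by omega⟩
    refine ⟨_, (det_seek h1 h2).step (by omega) (det_pop_nil_bind (s := .V) ?_ (by omega)
      (det_done rfl))⟩
    simp [Store.get, this]
  · obtain ⟨σ', h'⟩ := det_seek_fail (f := f) h'
    exact ⟨σ', h'.step (by omega) (det_done rfl)⟩

/-- Add a bit at the end of `V`. -/
def appendBit (b : Bool) : Frag Unit :=
  bind (move .V .T) fun _ => bind (push .T b) fun _ => move .T .V

/-- The first vertex is on top of `V`, so that positions are vertex numbers; a new value has to go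
to the bottom, below everything else. -/
theorem det_appendBit {b : Bool} (hT : σ.T = []) :
    (appendBit b).Det f σ () { σ with V := σ.V ++ [b], T := [] } (4 * σ.V.length + 5) := by
  refine (((det_move (by decide)).bind ((det_push _ _).bind
    (det_move (by decide)))).congr ?_).mono ?_
  · simp [Store.set, Store.get, hT]
  · simp only [Store.get, hT, List.append_nil, List.length_reverse, List.length_cons]
    omega

/-- Read a gate and add its value at the end of `V`. -/
def readGate : Frag (Unit ⊕ Bool) :=
  bind (pop .I) fun b => match b with
    | none => ret (.inr false)
    | some false => bind lookup fun x => match x with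
      | none => ret (.inr false)
      | some x => bind (appendBit !x) fun _ => ret (.inl ())
    | some true => bind (pop .I) fun b => match b with
      | none => ret (.inr false)
      | some b => bind lookup fun x => match x with
        | none => ret (.inr false)
        | some x => bind lookup fun y => match y with
          | none => ret (.inr false)
          | some y => bind (appendBit (if b then x && y else x || y)) fun _ => ret (.inl ())

/-- The tags of conjunction and disjunction differ only in the second bit, so one proof serves both.
Two lookups of cost 5|V| + 4 and one insertion of cost 4|V| + 5 account for the factor 14. -/
theorem det_readGate_binary {b : Bool} {x y : ℕ} {rest : List Bool}
    (h : σ.I = [true, b] ++ encodeUnary x ++ encodeUnary y ++ rest)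
    (hx : x < σ.V.length) (hy : y < σ.V.length) (hT : σ.T = []) :
    readGate.Det f σ (.inl ()) { σ with
      I := rest, T := []
      V := σ.V ++ [if b then σ.V.getD x false && σ.V.getD y false
        else σ.V.getD x false || σ.V.getD y false] } (14 * σ.V.length + 20) := by
  have h' : σ.get .I = true :: b :: (encodeUnary x ++ (encodeUnary y ++ rest)) := by
    rw [show σ.get .I = σ.I from rfl, h]; simp
  refine det_pop_cons_bind h' (by omega) ?_
  refine det_pop_cons_bind rfl (by omega) ?_
  have h1 := det_lookup (f := f) (σ := { σ with I := encodeUnary x ++ (encodeUnary y ++ rest) })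
    rfl hx hT
  have h2 := det_lookup (f := f) (σ := { σ with I := encodeUnary y ++ rest, T := [] }) rfl hy rfl
  refine h1.step (by dsimp only; omega) (h2.step (by dsimp only; omega) ?_)
  exact (det_appendBit rfl).step (by dsimp only; omega) (det_done rfl)

theorem det_readGate {g : Gate} {rest : List Bool} (h : σ.I = encodeGate g ++ rest)
    (hg : ∀ a ∈ g.preds, a < σ.V.length) (hT : σ.T = []) :
    readGate.Det f σ (.inl ()) { σ with I := rest, T := [], V := σ.V ++ [g.eval σ.V] }
      (14 * σ.V.length + 20) := by
  match g, h, hg with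
  | .and x y, h, hg =>
    exact det_readGate_binary (b := true) h (hg x (by simp [Gate.preds]))
      (hg y (by simp [Gate.preds])) hT
  | .or x y, h, hg =>
    exact det_readGate_binary (b := false) h (hg x (by simp [Gate.preds]))
      (hg y (by simp [Gate.preds])) hT
  | .not x, h, hg =>
    refine det_pop_cons_bind (s := .I) (b := false) (l := encodeUnary x ++ rest) h (by omega) ?_
    have h1 := det_lookup (f := f) (σ := { σ with I := encodeUnary x ++ rest }) rfl
      (hg x (by simp [Gate.preds])) hT
    refine h1.step (by dsimp only; omega) ?_
    exact (det_appendBit rfl).step (by dsimp only; omega) (det_done rfl)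

/-- A reference to a vertex that has no value yet is a lookup beyond the end of `V`; acyclicity thus
needs no separate check. -/
theorem det_readGate_fail
    (h : ¬ ∃ g rest, σ.I = encodeGate g ++ rest ∧ ∀ a ∈ g.preds, a < σ.V.length) (hT : σ.T = []) :
    ∃ σ', readGate.Det f σ (.inr false) σ' (14 * σ.V.length + 20) := by
  generalize hl : σ.I = l at h
  match l, hl with
  | [], hl => exact ⟨_, det_pop_nil_bind (s := .I) hl (by omega) (det_done rfl)⟩
  | false :: l, hl =>
    obtain ⟨σ', h'⟩ := det_lookup_fail (f := f) (σ := { σ with I := l }) (fun ⟨a, rest, h1, h2⟩ =>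
      h ⟨.not a, rest, congrArg (false :: ·) h1, fun x hx => by
        rw [Gate.preds, List.mem_singleton] at hx; rw [hx]; exact h2⟩)
    exact ⟨σ', det_pop_cons_bind (s := .I) hl (by omega) (h'.step (by dsimp only; omega) (det_done rfl))⟩
  | [true], hl =>
    exact ⟨_, det_pop_cons_bind (s := .I) hl (by omega)
      (det_pop_nil_bind rfl (by omega) (det_done rfl))⟩
  | true :: b :: l, hl =>
    by_cases h1 : ∃ a rest, l = encodeUnary a ++ rest ∧ a < σ.V.length
    · obtain ⟨x, rest, h1, hx⟩ := h1
      have h2 := det_lookup (f := f) (σ := { σ with I := l }) h1 hx hT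
      obtain ⟨σ', h'⟩ := det_lookup_fail (f := f) (σ := { σ with I := rest, T := [] })
        (fun ⟨y, rest', h3, hy⟩ => by
          have h3 : rest = encodeUnary y ++ rest' := h3
          cases b with
          | true =>
            refine h ⟨.and x y, rest', by simp [h1, h3, encodeGate], fun z hz => ?_⟩
            rcases List.mem_pair.mp hz with rfl | rfl
            exacts [hx, hy]
          | false =>
            refine h ⟨.or x y, rest', by simp [h1, h3, encodeGate], fun z hz => ?_⟩
            rcases List.mem_pair.mp hz with rfl | rfl
            exacts [hx, hy])
      exact ⟨σ', det_pop_cons_bind (s := .I) hl (by omega) (det_pop_cons_bind rfl (by omega)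
        (h2.step (by dsimp only; omega) (h'.step (by dsimp only; omega) (det_done rfl))))⟩
    · obtain ⟨σ', h'⟩ := det_lookup_fail (f := f) (σ := { σ with I := l }) h1
      exact ⟨σ', det_pop_cons_bind (s := .I) hl (by omega) (det_pop_cons_bind rfl (by omega)
        (h'.step (by dsimp only; omega) (det_done rfl)))⟩

end Frag

/-! ### Evaluation of a circuit along its code, and comparison of stacks -/

/-- All predecessors of the gates are among the earlier vertices, if there are `b` vertices before the
first gate. -/
def GatesWf : ℕ → List Gate → Prop
  | _, [] => True
  | b, g :: gs => (∀ a ∈ g.preds, a < b) ∧ GatesWf (b + 1) gs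

/-- Append the values of gates to the values of the earlier vertices. -/
abbrev evalGates (gs : List Gate) (vals : List Bool) : List Bool :=
  gs.foldl (fun vals g => vals ++ [g.eval vals]) vals

theorem length_evalGates (gs : List Gate) (vals : List Bool) :
    (evalGates gs vals).length = vals.length + gs.length := by
  induction gs generalizing vals with
  | nil => rfl
  | cons g gs ih =>
    rw [evalGates, List.foldl_cons]
    exact (ih _).trans (by simp; ring)

namespace Frag

variable {f : List Bool → ℕ} {σ : Store}

/-- Read a list of gates and add their values at the end of `V`. -/
def readGates : Frag Bool :=
  loop (A := Unit) .I (fun _ b => match b with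
    | none => ret (.inr false)
    | some false => ret (.inr true)
    | some true => readGate) ()

/-- `M` bounds the length of `V` during the whole loop, so each of the at most |gs| + 1 rounds fits
into 14M + 21 steps. -/
theorem det_readGates {gs : List Gate} {rest : List Bool} (h : σ.I = encodeList encodeGate gs ++ rest)
    (hgs : GatesWf σ.V.length gs) (hT : σ.T = []) {M : ℕ} (hM : σ.V.length + gs.length ≤ M) :
    readGates.Det f σ true { σ with I := rest, T := [], V := evalGates gs σ.V }
      ((gs.length + 1) * (14 * M + 21)) := by
  induction gs generalizing σ with
  | nil =>
    refine ((det_loop_exit (s := .I) (b := false) (l := rest) h (c := 0) (det_done rfl)).congr ?_).mono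
      (by simp)
    rw [show evalGates [] σ.V = σ.V from rfl, ← hT]
  | cons g gs ih =>
    rw [encodeList_cons] at h
    simp only [List.length_cons] at hM ⊢
    have h1 := det_readGate (f := f)
      (σ := { σ with I := encodeGate g ++ (encodeList encodeGate gs ++ rest) }) rfl hgs.1 hT
    have h2 := ih (σ := { σ with
        I := encodeList encodeGate gs ++ rest, T := [], V := σ.V ++ [g.eval σ.V] }) rfl
      (by simpa using hgs.2) rfl (by simp; omega)
    refine (det_loop_cons (s := .I) (b := true) (l := encodeGate g ++ (encodeList encodeGate gs ++ rest))
      (h.trans (by simp)) h1 h2).mono ?_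
    rw [add_mul (gs.length + 1) 1]
    dsimp only
    omega

theorem det_readGates_fail
    (h : ¬ ∃ gs rest, σ.I = encodeList encodeGate gs ++ rest ∧ GatesWf σ.V.length gs)
    (hT : σ.T = []) {M : ℕ} (hM : σ.V.length + σ.I.length ≤ M) :
    ∃ σ', readGates.Det f σ false σ' ((σ.I.length + 1) * (14 * M + 21)) := by
  -- A gate that is read shortens `I` by at least one bit and lengthens `V` by one, so |V| + |I| ≤ M
  -- persists.
  induction hn : σ.I.length using Nat.strong_induction_on generalizing σ with
  | _ n ih =>
  subst hn
  generalize hl : σ.I = l at h hM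
  match l, hl with
  | [], hl => exact ⟨_, (det_loop_nil (s := .I) hl (c := 0) (det_done rfl)).mono (by simp)⟩
  | false :: l, hl => exact absurd ⟨[], l, rfl, trivial⟩ h
  | true :: l, hl =>
    simp only [List.length_cons] at hM ⊢
    by_cases h' : ∃ g rest, l = encodeGate g ++ rest ∧ ∀ a ∈ g.preds, a < σ.V.length
    · obtain ⟨g, rest, h1, hg⟩ := h'
      have hl1 : rest.length ≤ l.length := by rw [h1]; simp
      have h2 := det_readGate (f := f) (σ := { σ with I := l }) h1 hg hT
      obtain ⟨σ', h3⟩ := ih rest.length (by rw [hl, List.length_cons]; omega)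
        (σ := { σ with I := rest, T := [], V := σ.V ++ [g.eval σ.V] })
        (fun ⟨gs, rest', h3, h4⟩ => h ⟨g :: gs, rest', by
          rw [encodeList_cons, h1, show rest = _ from h3]; simp, hg, by simpa using h4⟩) rfl
        (by simp; omega) rfl
      refine ⟨σ', (det_loop_cons (s := .I) hl h2 h3).mono ?_⟩
      have := Nat.mul_le_mul_right (14 * M + 21) hl1
      rw [add_mul (l.length + 1) 1, add_mul l.length, add_mul rest.length]
      dsimp only
      omega
    · obtain ⟨σ', h1⟩ := det_readGate_fail (f := f) (σ := { σ with I := l }) h' hT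
      refine ⟨σ', (det_loop_exit (s := .I) hl h1).mono ?_⟩
      rw [add_mul (l.length + 1) 1]
      dsimp only
      omega

/-- Read a list of vertex numbers and push the values of these vertices on `O`. -/
def readOutputs : Frag Bool :=
  loop (A := Unit) .I (fun _ b => match b with
    | none => ret (.inr false)
    | some false => ret (.inr true)
    | some true => bind lookup fun b => match b with
      | none => ret (.inr false)
      | some b => bind (push .O b) fun _ => ret (.inl ())) ()

theorem det_readOutputs {os : List ℕ} {rest : List Bool} (h : σ.I = encodeList encodeUnary os ++ rest)
    (hos : ∀ j ∈ os, j < σ.V.length) (hT : σ.T = []) :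
    readOutputs.Det f σ true
      { σ with I := rest, T := [], O := (os.map (σ.V.getD · false)).reverse ++ σ.O }
      ((os.length + 1) * (5 * σ.V.length + 6)) := by
  induction os generalizing σ with
  | nil =>
    refine ((det_loop_exit (s := .I) (b := false) (l := rest) h (c := 0) (det_done rfl)).congr ?_).mono
      (by simp)
    rw [← hT]
    rfl
  | cons j os ih =>
    rw [encodeList_cons] at h
    simp only [List.length_cons, List.mem_cons, forall_eq_or_imp] at hos ⊢
    have h1 := det_lookup (f := f)
      (σ := { σ with I := encodeUnary j ++ (encodeList encodeUnary os ++ rest) }) rfl hos.1 hT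
    have h2 := ih (σ := { σ with
        I := encodeList encodeUnary os ++ rest, T := [], O := σ.V.getD j false :: σ.O }) rfl
      hos.2 rfl
    refine ((det_loop_cons (s := .I) (b := true) (l := encodeUnary j ++ (encodeList encodeUnary os ++ rest))
      (h.trans (by simp)) (c := 5 * σ.V.length + 5) ?_ h2).congr ?_).mono ?_
    · exact h1.step (by simp) (det_push_bind (by simp) (det_done rfl))
    · simp
    · rw [add_mul (os.length + 1) 1]
      dsimp only
      omega

theorem det_readOutputs_fail
    (h : ¬ ∃ os rest, σ.I = encodeList encodeUnary os ++ rest ∧ ∀ j ∈ os, j < σ.V.length)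
    (hT : σ.T = []) :
    ∃ σ', readOutputs.Det f σ false σ' ((σ.I.length + 1) * (5 * σ.V.length + 6)) := by
  induction hn : σ.I.length using Nat.strong_induction_on generalizing σ with
  | _ n ih =>
  subst hn
  generalize hl : σ.I = l at h
  match l, hl with
  | [], hl => exact ⟨_, (det_loop_nil (s := .I) hl (c := 0) (det_done rfl)).mono (by simp)⟩
  | false :: l, hl => exact absurd ⟨[], l, rfl, by simp⟩ h
  | true :: l, hl =>
    simp only [List.length_cons]
    by_cases h' : ∃ j rest, l = encodeUnary j ++ rest ∧ j < σ.V.length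
    · obtain ⟨j, rest, h1, hj⟩ := h'
      have hl1 : rest.length ≤ l.length := by rw [h1]; simp
      have h2 := det_lookup (f := f) (σ := { σ with I := l }) h1 hj hT
      obtain ⟨σ', h3⟩ := ih rest.length (by rw [hl, List.length_cons]; omega)
        (σ := { σ with I := rest, T := [], O := σ.V.getD j false :: σ.O })
        (fun ⟨os, rest', h3, h4⟩ => h ⟨j :: os, rest', by
          rw [encodeList_cons, h1, show rest = _ from h3]; simp, by simpa using ⟨hj, h4⟩⟩) rfl rfl
      refine ⟨σ', (det_loop_cons (s := .I) hl (c := 5 * σ.V.length + 5) ?_ h3).mono ?_⟩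
      · exact h2.step (by simp) (det_push_bind (by simp) (det_done rfl))
      have := Nat.mul_le_mul_right (5 * σ.V.length + 6) hl1
      rw [add_mul (l.length + 1) 1, add_mul l.length, add_mul rest.length]
      dsimp only
      omega
    · obtain ⟨σ', h1⟩ := det_lookup_fail (f := f) (σ := { σ with I := l }) h'
      refine ⟨σ', (det_loop_exit (s := .I) hl (c := 5 * σ.V.length + 5) ?_).mono ?_⟩
      · exact h1.step (by simp) (det_done rfl)
      · rw [add_mul (l.length + 1) 1]
        omega

/-- Compare the contents of two stacks. -/
def compare (s t : Reg) : Frag Bool :=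
  loop (A := Unit) s (fun _ b => match b with
    | none => bind (pop t) fun b' => ret (.inr b'.isNone)
    | some b => bind (pop t) fun b' => match b' with
      | none => ret (.inr false)
      | some b' => ret (if b = b' then .inl () else .inr false)) ()

theorem det_compare {s t : Reg} (h : s ≠ t) (hst : σ.get s = σ.get t) :
    (compare s t).Det f σ true ((σ.set s []).set t []) (2 * (σ.get s).length + 2) := by
  generalize hl : σ.get s = l at hst
  induction l generalizing σ with
  | nil =>
    refine (det_loop_nil hl (c := 1) ?_).mono (by simp)
    refine det_pop_nil_bind hst.symm le_rfl (det_done ?_)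
    rw [← hl, Store.set_get_self, hl, hst, Store.set_get_self]
  | cons b l ih =>
    have := ih (σ := (σ.set s l).set t l) (by rw [Store.get_set_of_ne _ _ h, Store.get_set_self])
      (by rw [Store.get_set_self])
    refine ((det_loop_cons hl (c := 1) ?_ this).congr ?_).mono (by simp only [List.length_cons]; omega)
    · refine det_pop_cons_bind (b := b) (l := l) ?_ (by omega) ?_
      · rw [Store.get_set_of_ne _ _ h.symm, hst]
      · simp only [if_true]
        exact det_done rfl
    · rw [Store.set_overwrite _ _ _ _ _ h]

theorem det_compare_fail {s t : Reg} (h : s ≠ t) (hst : σ.get s ≠ σ.get t) :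
    ∃ σ', (compare s t).Det f σ false σ' (2 * (σ.get s).length + 2) := by
  generalize hl : σ.get s = l at hst
  generalize hl' : σ.get t = l' at hst
  induction l generalizing σ l' with
  | nil =>
    obtain ⟨b, l', rfl⟩ := List.exists_cons_of_ne_nil hst.symm
    refine ⟨_, (det_loop_nil hl (c := 1) (σ' := σ.set t l') ?_).mono (by simp)⟩
    exact det_pop_cons_bind hl' le_rfl (det_done rfl)
  | cons b l ih =>
    cases l' with
    | nil =>
      refine ⟨_, (det_loop_exit hl (c := 1) (σ' := σ.set s l) ?_).mono (by simp)⟩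
      refine det_pop_nil_bind (s := t) ?_ le_rfl (det_done rfl)
      rw [Store.get_set_of_ne _ _ h.symm, hl']
    | cons b' l' =>
      by_cases hb : b = b'
      · subst hb
        obtain ⟨σ', h'⟩ := ih (σ := (σ.set s l).set t l') (l' := l')
          (by rw [Store.get_set_of_ne _ _ h, Store.get_set_self]) (Store.get_set_self _ _ _)
          (by simpa using hst)
        refine ⟨σ', (det_loop_cons hl (c := 1) ?_ h').mono (by simp only [List.length_cons]; omega)⟩
        refine det_pop_cons_bind (b := b) (l := l') ?_ (by omega) ?_
        · rw [Store.get_set_of_ne _ _ h.symm, hl']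
        · simp only [if_true]
          exact det_done rfl
      · refine ⟨_, (det_loop_exit hl (c := 1) (σ' := (σ.set s l).set t l') ?_).mono (by simp)⟩
        refine det_pop_cons_bind (b := b') (l := l') ?_ (by omega) ?_
        · rw [Store.get_set_of_ne _ _ h.symm, hl']
        · simp only [hb, if_false]
          exact det_done rfl

end Frag

/-! ### Binary numbers -/

/-- The number with the binary digits `l`, least significant bit first. -/
def binVal : List Bool → ℕ
  | [] => 0
  | b :: l => b.toNat + 2 * binVal l

theorem binVal_append (l l' : List Bool) : binVal (l ++ l') = binVal l + 2 ^ l.length * binVal l' := by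
  induction l with
  | nil => simp [binVal]
  | cons b l ih => simp only [List.cons_append, binVal, ih, List.length_cons, pow_succ]; ring

theorem binVal_replicate_false (m : ℕ) : binVal (List.replicate m false) = 0 := by
  induction m with
  | zero => rfl
  | succ m ih => simp [List.replicate_succ, binVal, ih]

theorem binVal_bits (n : ℕ) : binVal n.bits = n := by
  induction n using Nat.binaryRec' with
  | zero => rfl
  | bit b n h ih =>
    rw [Nat.bits_append_bit _ _ h, binVal, ih, Nat.bit_val]
    omega

/-- Together with `getLast?_bits`: the canonical binary expansions are the lists that do not end in
`false`. Looking at the last bit thus decides whether a list of bits is the expansion of a number.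
-/
theorem bits_binVal {l : List Bool} (h : l.getLast? ≠ some false) : (binVal l).bits = l := by
  induction l with
  | nil => simp [binVal]
  | cons b l ih =>
    have hl : l.getLast? ≠ some false := by
      intro h'
      rw [List.getLast?_cons, h'] at h
      exact h rfl
    have : binVal (b :: l) = Nat.bit b (binVal l) := by rw [binVal, Nat.bit_val]; omega
    rw [this, Nat.bits_append_bit, ih hl]
    intro h0
    have := ih hl
    rw [h0, Nat.zero_bits] at this
    subst this
    cases b
    · exact absurd rfl h
    · rfl

theorem getLast?_bits (n : ℕ) : n.bits.getLast? ≠ some false := by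
  induction n using Nat.binaryRec' with
  | zero => simp
  | bit b n h ih =>
    rw [Nat.bits_append_bit _ _ h, List.getLast?_cons]
    cases hl : n.bits.getLast? with
    | none =>
      have h0 : n = 0 := by rw [← binVal_bits n, List.getLast?_eq_none_iff.mp hl]; rfl
      simp [h h0]
    | some c =>
      rw [hl] at ih
      simpa using ih

namespace Frag

variable {f : List Bool → ℕ} {σ : Store}

/-- `c < b + a` for bits. -/
def bitLt (c b a : Bool) : Bool := if c then b && a else b || a

/-- Guess a number, and accept if it is smaller than the number on `s` plus `a` but not smaller than
the number on `t` plus `b`, where `(a, b)` is the control variable. -/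
def guessBetween (s t : Reg) : Frag Bool :=
  loop (A := Bool × Bool) s (fun a x => bind (pop t) fun y =>
    if x.isNone ∧ y.isNone then ret (.inr (a.1 && !a.2))
    else bind guess fun c => ret (.inl (bitLt c (x.getD false) a.1, bitLt c (y.getD false) a.2)))
    (false, false)

theorem binVal_head_tail (l : List Bool) :
    binVal l = (l.head?.getD false).toNat + 2 * binVal l.tail := by
  cases l <;> simp [binVal]

/-- The bits of a number z are guessed from the least significant one on. With carries a and b the
paths to be counted are the z with t + b ≤ z < s + a. Writing z = c + 2z', s = p + 2s', the bound z
< s + a becomes z' < s' + `bitLt c p a`, and likewise for t, so the same problem remains for the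
tails. Once both stacks are empty only z = 0 is left. -/
theorem runs_guessBetween {s t : Reg} (h : s ≠ t) {n : ℕ} (hs : (σ.get s).length ≤ n)
    (ht : (σ.get t).length ≤ n) :
    (guessBetween s t).Runs f AtExit σ (binVal (σ.get s) - binVal (σ.get t)) (3 * n + 2) := by
  suffices H : ∀ a : Bool × Bool, (loop _ _ a).Runs f AtExit σ
      (binVal (σ.get s) + a.1.toNat - (binVal (σ.get t) + a.2.toNat)) (3 * n + 2) from H (false, false)
  intro a
  induction n generalizing σ a with
  | zero =>
    have hs' := List.length_eq_zero_iff.mp (Nat.le_zero.mp hs)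
    have ht' := List.length_eq_zero_iff.mp (Nat.le_zero.mp ht)
    refine runs_loop_nil hs' ((det_pop_nil ht').runs_bind (t := 0) ?_)
    refine runs_ret ?_
    rw [hs', ht']
    obtain ⟨a, b⟩ := a
    cases a <;> cases b <;> rfl
  | succ n ih =>
    refine (runs_loop (t := 3 * n + 4) ?_).mono (by omega)
    have hpop : (pop t).Det f (σ.set s (σ.get s).tail) (σ.get t).head?
        ((σ.set s (σ.get s).tail).set t (σ.get t).tail) 1 := by
      have : (σ.set s (σ.get s).tail).get t = σ.get t := Store.get_set_of_ne _ _ h.symm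
      cases ht' : σ.get t with
      | nil =>
        have h1 := det_pop_nil (f := f) (this.trans ht')
        refine h1.congr ?_
        rw [List.tail_nil, ← this.trans ht', Store.set_get_self]
      | cons b l => exact det_pop_cons (this.trans ht')
    refine hpop.runs_bind (t := 3 * n + 3) ?_
    split_ifs with hc
    · have hs' : σ.get s = [] := by simpa using hc.1
      have ht' : σ.get t = [] := by simpa using hc.2
      refine runs_ret ?_
      rw [hs', ht']
      obtain ⟨a, b⟩ := a
      cases a <;> cases b <;> rfl
    · have key := fun c => ih (σ := (σ.set s (σ.get s).tail).set t (σ.get t).tail)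
        (by rw [Store.get_set_of_ne _ _ h, Store.get_set_self, List.length_tail]; omega)
        (by rw [Store.get_set_self, List.length_tail]; omega)
        (bitLt c ((σ.get s).head?.getD false) a.1, bitLt c ((σ.get t).head?.getD false) a.2)
      rw [Store.get_set_of_ne _ _ h, Store.get_set_self, Store.get_set_self] at key
      refine Eq.subst (motive := fun N => Runs _ _ _ _ N _) ?_
        (runs_bind (runs_guess (runs_ret (key false)) (runs_ret (key true))))
      rw [binVal_head_tail (σ.get s), binVal_head_tail (σ.get t)]
      generalize binVal (σ.get s).tail = x
      generalize binVal (σ.get t).tail = y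
      generalize (σ.get s).head?.getD false = p
      generalize (σ.get t).head?.getD false = q
      obtain ⟨a, b⟩ := a
      -- The two values of c split the interval into its even and odd members; for fixed bits the
      -- identity of the counts is linear.
      cases p <;> cases q <;> cases a <;> cases b <;> simp [bitLt] <;> omega

/-- Add the numbers on `I` and `R`. The digits of the sum are pushed on `X`, those of `R` on `Y`. -/
def addDigits (c : Bool) : Frag Unit :=
  loop (A := Bool) .I (fun c a => bind (pop .R) fun r => match r with
    | some r => bind (push .X (xor (xor (a.getD false) r) c)) fun _ => bind (push .Y r) fun _ =>
        ret (.inl (if c then a.getD false || r else a.getD false && r))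
    | none => match a with
      | some a => bind (push .X (xor a c)) fun _ => ret (.inl (a && c))
      | none => match c with
        | true => bind (push .X true) fun _ => ret (.inr ())
        | false => ret (.inr ())) c

/-- The digits `L` may contain leading zeros, inherited from the operands, so only their value and
length are specified; the extra digit is the final carry. -/
theorem det_addDigits {n : ℕ} (c : Bool) (hI : σ.I.length ≤ n) (hR : σ.R.length ≤ n) :
    ∃ L : List Bool, binVal L = binVal σ.I + binVal σ.R + c.toNat ∧ L.length ≤ n + 1 ∧
      (addDigits c).Det f σ () { σ with
        I := [], R := [], X := L.reverse ++ σ.X, Y := σ.R.reverse ++ σ.Y } (4 * n + 3) := by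
  induction n generalizing σ c with
  | zero =>
    have hI := List.length_eq_zero_iff.mp (Nat.le_zero.mp hI)
    have hR := List.length_eq_zero_iff.mp (Nat.le_zero.mp hR)
    have hσ : σ = { σ with I := [], R := [] } := Store.ext hI rfl rfl rfl rfl rfl rfl rfl rfl rfl hR
      rfl rfl rfl rfl rfl
    cases c with
    | true =>
      refine ⟨[true], by simp [hI, hR, binVal], by simp, ?_⟩
      refine (det_loop_nil (s := .I) hI (c := 2) ?_)
      refine det_pop_nil_bind (s := .R) hR (by omega) (det_push_bind (by omega) (det_done ?_))
      rw [hσ]; rfl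
    | false =>
      refine ⟨[], by simp [hI, hR, binVal], by simp, ?_⟩
      refine (det_loop_nil (s := .I) hI (c := 2) ?_)
      refine det_pop_nil_bind (s := .R) hR (by omega) (det_done ?_)
      rw [hσ]; rfl
  | succ n ih =>
    match hIl : σ.I, hRl : σ.R with
    | [], [] =>
      have hσ : σ = { σ with I := [], R := [] } := Store.ext hIl rfl rfl rfl rfl rfl rfl rfl rfl rfl
        hRl rfl rfl rfl rfl rfl
      cases c with
      | true =>
        refine ⟨[true], by simp [binVal], by simp, ?_⟩
        refine (det_loop_nil (s := .I) hIl (c := 2) ?_).mono (by omega)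
        refine det_pop_nil_bind (s := .R) hRl (by omega) (det_push_bind (by omega) (det_done ?_))
        rw [hσ]; rfl
      | false =>
        refine ⟨[], by simp [binVal], by simp, ?_⟩
        refine (det_loop_nil (s := .I) hIl (c := 2) ?_).mono (by omega)
        refine det_pop_nil_bind (s := .R) hRl (by omega) (det_done ?_)
        rw [hσ]; rfl
    | a :: I, [] =>
      obtain ⟨L, hL, hn, h⟩ := ih (σ := { σ with I := I, X := xor a c :: σ.X }) (a && c)
        (by rw [hIl] at hI; simpa using hI) (by simp [hRl])
      refine ⟨xor a c :: L, ?_, by simpa using hn, ?_⟩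
      · simp only [binVal, hL, hRl]
        cases a <;> cases c <;> simp <;> omega
      · refine ((det_loop_cons (s := .I) hIl (c := 2) ?_ h).congr ?_).mono (by omega)
        · exact det_pop_nil_bind (s := .R) hRl (by omega) (det_push_bind (by omega) (det_done rfl))
        · simp [hRl]
    | [], r :: R =>
      obtain ⟨L, hL, hn, h⟩ := ih (σ := { σ with I := [], R := R, X := xor r c :: σ.X, Y := r :: σ.Y })
        (r && c) (by simp) (by rw [hRl] at hR; simpa using hR)
      refine ⟨xor r c :: L, ?_, by simpa using hn, ?_⟩
      · simp only [binVal, hL]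
        cases r <;> cases c <;> simp <;> omega
      · refine ((det_loop_nil_cons (s := .I) hIl (c := 3) ?_ h).congr ?_).mono (by omega)
        · refine det_pop_cons_bind (s := .R) hRl (by omega) (det_push_bind (by omega)
            (det_push_bind (by omega) ?_))
          have : (if c then (none : Option Bool).getD false || r else (none : Option Bool).getD false && r)
            = (r && c) := by cases r <;> cases c <;> rfl
          rw [this]
          refine det_done ?_
          rw [show σ = { σ with I := [] } from by rw [← hIl]]
          simp
        · simp
    | a :: I, r :: R =>
      obtain ⟨L, hL, hn, h⟩ := ih
        (σ := { σ with I := I, R := R, X := xor (xor a r) c :: σ.X, Y := r :: σ.Y })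
        (if c then a || r else a && r) (by rw [hIl] at hI; simpa using hI)
        (by rw [hRl] at hR; simpa using hR)
      refine ⟨xor (xor a r) c :: L, ?_, by simpa using hn, ?_⟩
      · simp only [binVal, hL]
        cases a <;> cases r <;> cases c <;> simp <;> omega
      · refine ((det_loop_cons (s := .I) hIl (c := 3) ?_ h).congr ?_).mono (by omega)
        · exact det_pop_cons_bind (s := .R) hRl (by omega) (det_push_bind (by omega)
            (det_push_bind (by omega) (det_done rfl)))
        · simp

/-- Add the number on `R` to the number on `I`. -/
def add : Frag Unit :=
  bind (addDigits false) fun _ => bind (move .X .I) fun _ => move .Y .R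

theorem det_add {n : ℕ} (hI : σ.I.length ≤ n) (hR : σ.R.length ≤ n) (hX : σ.X = []) (hY : σ.Y = []) :
    ∃ L : List Bool, binVal L = binVal σ.I + binVal σ.R ∧ L.length ≤ n + 1 ∧
      add.Det f σ () { σ with I := L } (8 * n + 7) := by
  obtain ⟨L, hL, hn, h⟩ := det_addDigits (f := f) false hI hR
  refine ⟨L, by simpa using hL, hn, ?_⟩
  have h1 := det_move (f := f) (s := .X) (t := .I)
    (σ := { σ with I := [], R := [], X := L.reverse ++ σ.X, Y := σ.R.reverse ++ σ.Y }) (by decide)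
  have h2 := det_move (f := f) (s := .Y) (t := .R)
    (σ := { σ with I := L, R := [], X := [], Y := σ.R.reverse ++ σ.Y }) (by decide)
  have hI : L.length = (L.reverse ++ σ.X).length := by simp [hX]
  have hR : σ.R.length = (σ.R.reverse ++ σ.Y).length := by simp [hY]
  have h1 := h1.congr (σ'' := { σ with I := L, R := [], X := [], Y := σ.R.reverse ++ σ.Y })
    (by simp [Store.get, hX])
  refine h.step (by omega) (h1.step ?_ ((h2.mono ?_).congr ?_))
  · simp only [Store.get]; omega
  · simp only [Store.get]; omega
  · simp [Store.get, hX, hY]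

/-- Multiply the number on `S`, most significant bit first, by the number on `R`, and leave the result
on `I`, which has to be empty before. -/
def mul : Frag Unit :=
  loop (A := Unit) .S (fun _ b => match b with
    | none => ret (.inr ())
    | some b => bind (push .I false) fun _ => match b with
      | false => ret (.inl ())
      | true => bind add fun _ => ret (.inl ())) ()

/-- Horner's scheme: each digit of `S` doubles `I` and possibly adds `R`. A round lengthens `I` by
at most two digits, one for the shift and one for the carry, hence the reserve of 2|S| below `M`. -/
theorem det_mul {M : ℕ} (hX : σ.X = []) (hY : σ.Y = []) (hR : σ.R.length + 2 * σ.S.length ≤ M)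
    (hI : σ.I.length + 2 * σ.S.length ≤ M) :
    ∃ L : List Bool, binVal L = binVal σ.I * 2 ^ σ.S.length + binVal σ.S.reverse * binVal σ.R ∧
      L.length ≤ M ∧
      mul.Det f σ () { σ with S := [], I := L } ((σ.S.length + 1) * (8 * M + 9)) := by
  generalize hS : σ.S = S at hI hR
  induction S generalizing σ with
  | nil =>
    refine ⟨σ.I, by simp [binVal], by simpa using hI, ?_⟩
    refine (det_loop_nil (s := .S) hS (c := 0) (det_done ?_)).mono (by simp)
    rw [← hS]
  | cons b S ih =>
    simp only [List.length_cons] at hI hR ⊢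
    have hcost : (S.length + 1 + 1) * (8 * M + 9) = (S.length + 1) * (8 * M + 9) + (8 * M + 9) := by
      ring
    cases b with
    | false =>
      obtain ⟨L, hL, hn, h⟩ := ih (σ := { σ with S := S, I := false :: σ.I }) hX hY rfl
        (by simp only [List.length_cons]; omega) (by dsimp only; omega)
      refine ⟨L, ?_, hn, ?_⟩
      · rw [hL, List.reverse_cons, binVal_append]
        simp [binVal, pow_succ]
        ring
      · refine (det_loop_cons (s := .S) hS (c := 1) ?_ h).mono (by omega)
        exact det_push_bind le_rfl (det_done rfl)
    | true =>
      -- With this `n` the sum has at most M - 2|S| digits, which is the length condition for the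
      -- remaining rounds.
      obtain ⟨L', hL', hn', h'⟩ := det_add (f := f) (σ := { σ with S := S, I := false :: σ.I })
        (n := M - 1 - 2 * S.length) (by simp only [List.length_cons]; omega) (by dsimp only; omega)
        hX hY
      obtain ⟨L, hL, hn, h⟩ := ih (σ := { σ with S := S, I := L' }) hX hY rfl
        (by dsimp only; omega) (by dsimp only; omega)
      refine ⟨L, ?_, hn, ?_⟩
      · rw [hL, hL', List.reverse_cons, binVal_append]
        simp [binVal, pow_succ]
        ring
      · refine (det_loop_cons (s := .S) hS (c := 8 * M + 8) ?_ h).mono (by omega)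
        exact det_push_bind (by omega) (h'.step (by omega) (det_done rfl))

end Frag

/-! ### Guessing bit strings and summing over them -/

/-- All bit lists of a given length. -/
def bitLists : ℕ → List (List Bool)
  | 0 => [[]]
  | n + 1 => (bitLists n).map (· ++ [false]) ++ (bitLists n).map (· ++ [true])

/-- The last entry is split off, because the bit guessed first ends up deepest in the stack. -/
theorem sum_bitLists_succ (n : ℕ) (F : List Bool → ℕ) :
    ((bitLists (n + 1)).map F).sum =
      ((bitLists n).map fun l => F (l ++ [false])).sum +
        ((bitLists n).map fun l => F (l ++ [true])).sum := by
  simp [bitLists, Function.comp_def]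

theorem sum_bitLists_add (a b : ℕ) (F : List Bool → ℕ) :
    ((bitLists (a + b)).map F).sum =
      ((bitLists b).map fun l => ((bitLists a).map fun l' => F (l' ++ l)).sum).sum := by
  induction b generalizing F with
  | zero => simp [bitLists]
  | succ b ih =>
    rw [← add_assoc, sum_bitLists_succ, sum_bitLists_succ, ih, ih]
    simp only [List.append_assoc]

theorem sum_bitLists (m : ℕ) (F : List Bool → ℕ) :
    ((bitLists m).map F).sum = ∑ r : Fin m → Bool, F (List.ofFn r) := by
  induction m generalizing F with
  | zero => simp [bitLists]
  | succ m ih =>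
    rw [sum_bitLists_succ, ih, ih, ← (Fin.snocEquiv fun _ => Bool).sum_comp, Fintype.sum_prod_type]
    simp only [Fintype.sum_bool, Fin.snocEquiv, Equiv.coe_fn_mk]
    rw [add_comm]
    congr 1 <;> refine Finset.sum_congr rfl fun r _ => congrArg F ?_ <;>
      rw [List.ofFn_succ'] <;> simp

theorem length_of_mem_bitLists {n : ℕ} {l : List Bool} (h : l ∈ bitLists n) : l.length = n := by
  induction n generalizing l with
  | zero => simpa [bitLists] using h
  | succ n ih =>
    simp only [bitLists, List.mem_append, List.mem_map] at h
    obtain ⟨l, h, rfl⟩ | ⟨l, h, rfl⟩ := h <;> simp [ih h]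

namespace Frag

variable {f : List Bool → ℕ} {σ : Store}

/-- Guess a bit for each bit on `B`, and push it on `V` and on `X`. -/
def guessRow : Frag Unit :=
  loop (A := Unit) .B (fun _ b => match b with
    | none => ret (.inr ())
    | some _ => bind (push .T true) fun _ => bind guess fun b => bind (push .V b) fun _ =>
        bind (push .X b) fun _ => ret (.inl ())) ()

/-- `F y` is the number of accepting paths that remain after y has been guessed; every y arises on
exactly one path. The unary length passes from `B` to `T` so that it can be used again. -/
theorem runs_guessRow {Q : Unit → Store → ℕ → ℕ → Prop} {k t : ℕ} {F : List Bool → ℕ}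
    (hB : σ.B = List.replicate k true)
    (h : ∀ y, y.length = k → Q () { σ with
      B := [], T := List.replicate k true ++ σ.T, V := y ++ σ.V, X := y ++ σ.X } (F y) t) :
    guessRow.Runs f Q σ ((bitLists k).map F).sum (t + (5 * k + 1)) := by
  induction k generalizing σ F with
  | zero =>
    refine runs_loop_nil (s := .B) hB (runs_ret ?_)
    have e : σ = { σ with B := [] } := by rw [show ([] : List Bool) = σ.B from hB.symm]
    rw [e]
    simpa [bitLists] using h [] rfl
  | succ k ih =>
    rw [sum_bitLists_succ]
    refine Runs.mono (runs_loop_cons (s := .B) (t := t + (5 * k + 5)) (hB.trans List.replicate_succ)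
      ((det_push _ _).runs_bind (t := t + (5 * k + 4)) (runs_bind
        (runs_guess (t := t + (5 * k + 3)) ?_ ?_)))) (by omega)
    · refine (det_push _ _).runs_bind (t := t + (5 * k + 2)) ((det_push _ _).runs_bind
        (t := t + (5 * k + 1)) (runs_ret ?_))
      refine ih (F := fun l => F (l ++ [false])) rfl fun y hy => ?_
      have := h (y ++ [false]) (by simp [hy])
      simpa [List.replicate_succ'] using this
    · refine (det_push _ _).runs_bind (t := t + (5 * k + 2)) ((det_push _ _).runs_bind
        (t := t + (5 * k + 1)) (runs_ret ?_))
      refine ih (F := fun l => F (l ++ [true])) rfl fun y hy => ?_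
      have := h (y ++ [true]) (by simp [hy])
      simpa [List.replicate_succ'] using this

/-- For each bit on `A`, guess a row. -/
def guessRows : Frag Unit :=
  loop (A := Unit) .A (fun _ b => match b with
    | none => ret (.inr ())
    | some _ => bind guessRow fun _ => bind (move .T .B) fun _ => ret (.inl ())) ()

/-- Nested loops over two unary numbers produce n·k guesses without any arithmetic; `B` is restored
from `T` after each row. -/
theorem runs_guessRows {Q : Unit → Store → ℕ → ℕ → Prop} {n k t : ℕ} {F : List Bool → ℕ}
    (hA : σ.A = List.replicate n true) (hB : σ.B = List.replicate k true) (hT : σ.T = [])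
    (h : ∀ y, y.length = n * k → Q () { σ with A := [], V := y ++ σ.V, X := y ++ σ.X } (F y) t) :
    guessRows.Runs f Q σ ((bitLists (n * k)).map F).sum (t + (n * (7 * k + 3) + 1)) := by
  induction n generalizing σ F with
  | zero =>
    rw [zero_mul, zero_mul]
    refine runs_loop_nil (s := .A) hA (runs_ret ?_)
    have e : σ = { σ with A := [] } := by rw [show ([] : List Bool) = σ.A from hA.symm]
    rw [e]
    simpa [bitLists] using h [] (by simp)
  | succ n ih =>
    rw [add_mul n 1 k, one_mul, sum_bitLists_add]
    refine Runs.mono (runs_loop_cons (s := .A) (t := t + (n * (7 * k + 3) + 1) + (2 * k + 1) + (5 * k + 1))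
      (hA.trans List.replicate_succ) (runs_bind (runs_guessRow (k := k) hB fun y hy => ?_)))
      (by rw [add_mul n 1]; omega)
    have hmove := det_move (f := f) (s := .T) (t := .B) (σ := { σ with
      A := List.replicate n true, B := [], T := List.replicate k true ++ σ.T, V := y ++ σ.V,
      X := y ++ σ.X }) (by decide)
    have hmove := (hmove.congr (σ'' := { σ with
      A := List.replicate n true, V := y ++ σ.V, X := y ++ σ.X })
      (by simp [Store.get, hB, hT])).mono (c' := 2 * k + 1) (by simp [Store.get, hT])
    refine hmove.runs_bind (t := t + (n * (7 * k + 3) + 1)) (runs_ret ?_)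
    refine ih rfl hB hT fun y' hy' => ?_
    have := h (y' ++ y) (by rw [List.length_append, hy, hy', add_mul, one_mul])
    simpa using this

/-! ### Counting accepting paths after parsing -/

/-- `p` has, on all paths from the store `σ`, at most `t` steps, and its number of paths to the exit
`true` satisfies `P`. -/
def Counts (p : Frag Bool) (f : List Bool → ℕ) (σ : Store) (t : ℕ) (P : ℕ → Prop) : Prop :=
  ∃ N, p.Runs f AtExit σ N t ∧ P N

theorem Counts.imp {p : Frag Bool} {t : ℕ} {P P' : ℕ → Prop} (h : p.Counts f σ t P)
    (h' : ∀ N, P N → P' N) : p.Counts f σ t P' :=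
  Exists.imp (fun N hN => ⟨hN.1, h' N hN.2⟩) h

theorem counts_ret (b : Bool) (t : ℕ) : (ret b).Counts f σ t fun N => N = b.toNat :=
  ⟨_, runs_ret rfl, rfl⟩

theorem Det.counts_bind {A : Type} [Finite A] {p : Frag A} {q : A → Frag Bool} {a : A} {σ' : Store}
    {c t' : ℕ} {P : ℕ → Prop} (h : p.Det f σ a σ' c) (ht : c ≤ t')
    (h' : (q a).Counts f σ' (t' - c) P) : (Frag.bind p q).Counts f σ t' P :=
  Exists.imp (fun _ hN => ⟨(h.runs_bind hN.1).mono (by omega), hN.2⟩) h'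

/-- Run `p`; leave at `b` if it fails, and continue with `q` otherwise. -/
def guard (b : Bool) (p q : Frag Bool) : Frag Bool :=
  bind p fun ok => match ok with
    | false => ret b
    | true => q

theorem counts_guard {b : Bool} {p q : Frag Bool} {c t : ℕ} {P : ℕ → Prop} {C : Prop} {σ' : Store}
    (ht : c ≤ t) (h1 : C → p.Det f σ true σ' c) (h0 : ¬C → ∃ σ', p.Det f σ false σ' c)
    (hq : C → q.Counts f σ' (t - c) P) :
    (guard b p q).Counts f σ t fun N => (C → P N) ∧ (¬C → N = b.toNat) := by
  by_cases hC : C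
  · exact (Det.counts_bind (h1 hC) ht (hq hC)).imp fun N hN => ⟨fun _ => hN, fun h => absurd hC h⟩
  · obtain ⟨σ', h⟩ := h0 hC
    exact (Det.counts_bind h ht (counts_ret b _)).imp fun N hN => ⟨fun h => absurd h hC, fun _ => hN⟩

/-- By prefix-freeness the parse found by `p` is the only one, so the count obtained for it proves
the statement quantified over all parses. -/
theorem counts_guard_decode {α : Type} {enc : α → List Bool} (henc : PrefixFree enc) {b : Bool}
    {p q : Frag Bool} {c t : ℕ} {ok : α → Prop} {P : α → List Bool → ℕ → Prop}
    {σ' : α → List Bool → Store} (ht : c ≤ t)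
    (h1 : ∀ a rest, σ.I = enc a ++ rest → ok a → p.Det f σ true (σ' a rest) c)
    (h0 : (¬ ∃ a rest, σ.I = enc a ++ rest ∧ ok a) → ∃ σ', p.Det f σ false σ' c)
    (hq : ∀ a rest, σ.I = enc a ++ rest → ok a → q.Counts f (σ' a rest) (t - c) (P a rest)) :
    (guard b p q).Counts f σ t fun N =>
      (∀ a rest, σ.I = enc a ++ rest → ok a → P a rest N) ∧
        ((¬ ∃ a rest, σ.I = enc a ++ rest ∧ ok a) → N = b.toNat) := by
  by_cases hC : ∃ a rest, σ.I = enc a ++ rest ∧ ok a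
  · obtain ⟨a, rest, h, ha⟩ := hC
    refine (Det.counts_bind (h1 a rest h ha) ht (hq a rest h ha)).imp fun N hN =>
      ⟨fun a' rest' h' _ => ?_, fun h' => absurd ⟨a, rest, h, ha⟩ h'⟩
    obtain ⟨rfl, rfl⟩ := henc _ _ _ _ (h.symm.trans h')
    exact hN
  · obtain ⟨σ', h⟩ := h0 hC
    exact (Det.counts_bind h ht (counts_ret b _)).imp fun N hN =>
      ⟨fun a rest h ha => absurd ⟨a, rest, h, ha⟩ hC, fun _ => hN⟩

/-- A count is chosen for every guessed y, and the resulting function is the `F` that is summed by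
the guessing fragment. -/
theorem counts_bind_of_sum {p : Frag Unit} {q : Unit → Frag Bool} {k c t t' : ℕ}
    {P : List Bool → ℕ → Prop} {σ' : List Bool → Store}
    (hp : ∀ (F : List Bool → ℕ) (Q : Unit → Store → ℕ → ℕ → Prop) (t : ℕ),
      (∀ y, y.length = k → Q () (σ' y) (F y) t) → p.Runs f Q σ ((bitLists k).map F).sum (t + c))
    (ht : t + c ≤ t') (hq : ∀ y, y.length = k → (q ()).Counts f (σ' y) t (P y)) :
    (bind p q).Counts f σ t' fun N =>
      ∃ F : List Bool → ℕ, N = ((bitLists k).map F).sum ∧ ∀ y, y.length = k → P y (F y) := by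
  classical
  choose! F hF using hq
  exact ⟨_, (runs_bind (hp F _ t fun y hy => (hF y hy).1)).mono ht, F, rfl, fun y hy => (hF y hy).2⟩

/-- Read a list of bits to the stack `s`, in reverse order. -/
def readList (s : Reg) : Frag Bool :=
  bind (readBits s) fun r => ret r.isSome

theorem counts_guard_readList {b : Bool} {s : Reg} (hI : s ≠ .I) {q : Frag Bool} {t : ℕ}
    {P : List Bool → List Bool → ℕ → Prop} (ht : 3 * σ.I.length + 2 ≤ t)
    (hq : ∀ l rest, σ.I = encodeBits l ++ rest → q.Counts f
      ((σ.set .I rest).set s (l.reverse ++ σ.get s)) (t - (3 * σ.I.length + 2)) (P l rest)) :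
    (guard b (readList s) q).Counts f σ t fun N =>
      ∀ l rest, σ.I = encodeBits l ++ rest → P l rest N := by
  refine (counts_guard_decode (ok := fun _ => True) prefixFree_encodeBits ht ?_ ?_
    fun l rest h _ => hq l rest h).imp fun N hN l rest h => hN.1 l rest h trivial
  · intro l rest h _
    refine (det_readBits hI h).step ?_ (det_done rfl)
    rw [h, List.length_append, length_encodeBits]
    omega
  · intro h
    simp only [and_true] at h
    obtain ⟨σ', h'⟩ := det_readBits_fail (f := f) hI h
    exact ⟨σ', h'.step (by omega) (det_done rfl)⟩

/-- Check that the lists on `X` and, reversed, on `s` are equal, and count up to the number on `t`, most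
significant bit first. -/
def checkInputAndCount (s t : Reg) : Frag Bool :=
  bind (move .X .T) fun _ => guard false (compare .T s) <| bind (move t .T) fun _ =>
    guessBetween .T .R

theorem counts_checkInputAndCount {s t : Reg} (hsT : s ≠ .T) (hsX : s ≠ .X) (htX : t ≠ .X)
    (hts : t ≠ s) (htT : t ≠ .T) (htR : t ≠ .R) (hsR : s ≠ .R) (hT : σ.T = []) (hR : σ.R = [])
    {L T : ℕ} (hX : σ.X.length ≤ L) (ht : (σ.get t).length ≤ L) (hL : 10 * (L + 1) ≤ T) :
    (checkInputAndCount s t).Counts f σ T fun N =>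
      N = if σ.X = (σ.get s).reverse then binVal (σ.get t).reverse else 0 := by
  have h1 := (det_move (f := f) (s := .X) (t := .T) (σ := σ) (by decide)).congr
    (σ'' := { σ with X := [], T := σ.X.reverse }) (by simp [Store.get, hT])
  have hs1 : Store.get { σ with X := [], T := σ.X.reverse } s = σ.get s := by
    change ((σ.set .X []).set .T σ.X.reverse).get s = _
    rw [Store.get_set_of_ne _ _ hsT, Store.get_set_of_ne _ _ hsX]
  have ht1 : Store.get { σ with X := [], T := σ.X.reverse } t = σ.get t := by
    change ((σ.set .X []).set .T σ.X.reverse).get t = _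
    rw [Store.get_set_of_ne _ _ htT, Store.get_set_of_ne _ _ htX]
  refine Det.counts_bind (h1.mono (c' := 2 * L + 1) (by simpa [Store.get] using hX)) (by omega) ?_
  refine (counts_guard (c := 2 * L + 2) (C := σ.X.reverse = σ.get s)
    (P := fun N => N = binVal (σ.get t).reverse)
    (σ' := Store.set (Store.set { σ with X := [], T := σ.X.reverse } .T []) s []) (by omega)
    (fun h => (det_compare hsT.symm (h.trans hs1.symm)).mono (by simpa [Store.get] using hX))
    (fun h => ?_) fun h => ?_).imp ?_
  · obtain ⟨σ', h'⟩ := det_compare_fail (f := f) (σ := { σ with X := [], T := σ.X.reverse }) hsT.symm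
      (fun h' => h (h'.trans hs1))
    exact ⟨σ', h'.mono (by simpa [Store.get] using hX)⟩
  · have ht2 : (Store.set (Store.set { σ with X := [], T := σ.X.reverse } .T []) s []).get t =
        σ.get t := by
      rw [Store.get_set_of_ne _ _ hts, Store.get_set_of_ne _ _ htT, ht1]
    have hT2 : (Store.set (Store.set { σ with X := [], T := σ.X.reverse } .T []) s []).get .T = [] := by
      rw [Store.get_set_of_ne _ _ hsT.symm, Store.get_set_self]
    have hR2 : (Store.set (Store.set { σ with X := [], T := σ.X.reverse } .T []) s []).get .R = [] := by
      rw [Store.get_set_of_ne _ _ hsR.symm]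
      exact hR
    have h2 := det_move (f := f) (s := t) (t := .T)
      (σ := Store.set (Store.set { σ with X := [], T := σ.X.reverse } .T []) s []) htT
    rw [ht2, hT2, List.append_nil] at h2
    refine Det.counts_bind (h2.mono (c' := 2 * L + 1) (by omega)) (by omega) ?_
    -- `R` is empty and stands for zero, so the number of paths is the number on `T` itself.
    have h3 := runs_guessBetween (f := f) (s := .T) (t := .R) (n := L)
      (σ := ((((Store.set { σ with X := [], T := σ.X.reverse } .T []).set s []).set t []).set .T
        (σ.get t).reverse)) (by decide) (by rw [Store.get_set_self]; simpa using ht)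
      (by rw [Store.get_set_of_ne _ _ (by decide), Store.get_set_of_ne _ _ htR.symm, hR2]; simp)
    rw [Store.get_set_self, Store.get_set_of_ne _ _ (by decide), Store.get_set_of_ne _ _ htR.symm,
      hR2] at h3
    exact ⟨_, h3.mono (by omega), by simp [binVal]⟩
  · rintro N ⟨hN, hN'⟩
    split_ifs with h
    · exact hN (List.reverse_eq_iff.mpr h)
    · exact hN' fun h' => h (List.reverse_eq_iff.mp h')

/-- After a circuit has been evaluated: read two numbers and two lists, check that the outputs are the
expected ones and that the input is the first or the second list, and count up to one of the numbers. -/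
def checkAndCount (b : Bool) : Frag Bool :=
  guard false (readList .U) <| guard false (readList .W) <| guard false (readList .D) <|
  guard false (readList .S) <| guard false (compare .O .Y) <| match b with
  | true => checkInputAndCount .D .W
  | false => checkInputAndCount .S .U

/-- The multiplication by v or u is done by branching: a path that passes both comparisons splits
into that many accepting paths, and any other path contributes none. -/
theorem counts_checkAndCount {b : Bool} {L t : ℕ} (hI : σ.I.length ≤ L) (hO : σ.O.length ≤ L)
    (hX : σ.X.length ≤ L) (hT : σ.T = []) (hU : σ.U = []) (hW : σ.W = []) (hD : σ.D = [])
    (hS : σ.S = []) (hR : σ.R = []) (ht : 30 * (L + 1) ≤ t) :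
    (checkAndCount b).Counts f σ t fun N => ∀ u v x x' rest,
      σ.I = encodeBits u ++ (encodeBits v ++ (encodeBits x ++ (encodeBits x' ++ rest))) →
      N = if σ.O = σ.Y then if σ.X = (if b then x else x') then binVal (if b then v else u) else 0
        else 0 := by
  refine Counts.imp (counts_guard_readList (by decide) (by omega) fun u rest h1 =>
    counts_guard_readList (P := fun v r₂ N => ∀ x r₃, r₂ = encodeBits x ++ r₃ →
      ∀ x' r₄, r₃ = encodeBits x' ++ r₄ → N = if σ.O = σ.Y then
        if σ.X = (if b then x else x') then binVal (if b then v else u) else 0 else 0)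
      (by decide) ?_ fun v r₂ h2 => counts_guard_readList (by decide) ?_ fun x r₃ h3 =>
      counts_guard_readList (by decide) ?_ fun x' r₄ h4 => ?_) ?_
  rotate_left 4
  · intro N hN u v x x' rest h
    exact hN u _ h v _ rfl x _ rfl x' _ rfl
  all_goals
    dsimp only [Store.set, Store.get] at *
    have l1 := congrArg List.length h1
    rw [List.length_append, length_encodeBits] at l1
  · omega
  all_goals
    have l2 := congrArg List.length h2
    rw [List.length_append, length_encodeBits] at l2
  · omega
  all_goals
    have l3 := congrArg List.length h3
    rw [List.length_append, length_encodeBits] at l3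
  · omega
  have l4 := congrArg List.length h4
  rw [List.length_append, length_encodeBits] at l4
  simp only [hU, hW, hD, hS, List.append_nil]
  generalize hσ : ({ σ with
    I := r₄, U := u.reverse, W := v.reverse, D := x.reverse, S := x'.reverse } : Store) = τ
  have hO' : τ.O = σ.O := by rw [← hσ]
  have hY' : τ.Y = σ.Y := by rw [← hσ]
  refine (counts_guard (c := 2 * L + 2) (C := σ.O = σ.Y) (σ' := { τ with O := [], Y := [] }) (by omega)
    (fun h => (det_compare (σ := τ) (s := .O) (t := .Y) (by decide) (hO'.trans (h.trans hY'.symm))).mono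
      (by rw [show τ.get .O = σ.O from hO']; omega))
    (fun h => ?_) fun h => ?_).imp (P := fun N => (σ.O = σ.Y → N = if σ.X = (if b then x else x') then
      binVal (if b then v else u) else 0) ∧ (σ.O ≠ σ.Y → N = 0)) ?_
  · obtain ⟨σ', h'⟩ := det_compare_fail (f := f) (σ := τ) (s := .O) (t := .Y) (by decide)
      (fun h' => h (hO'.symm.trans (h'.trans hY')))
    exact ⟨σ', h'.mono (by rw [show τ.get .O = σ.O from hO']; omega)⟩
  · have hT' : τ.T = [] := by rw [← hσ]; exact hT
    have hR' : τ.R = [] := by rw [← hσ]; exact hR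
    have hX' : τ.X = σ.X := by rw [← hσ]
    have hD' : τ.D = x.reverse := by rw [← hσ]
    have hS' : τ.S = x'.reverse := by rw [← hσ]
    have hU' : τ.U = u.reverse := by rw [← hσ]
    have hW' : τ.W = v.reverse := by rw [← hσ]
    cases b with
    | true =>
      refine (counts_checkInputAndCount (σ := { τ with O := [], Y := [] }) (s := .D) (t := .W)
        (by decide) (by decide) (by decide) (by decide) (by decide) (by decide) (by decide) hT' hR'
        (L := L) ?_ ?_ ?_).imp ?_
      · rw [hX']; omega
      · simp only [Store.get, hW', List.length_reverse]; omega
      · omega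
      · intro N hN; simpa [Store.get, hX', hD', hW'] using hN
    | false =>
      refine (counts_checkInputAndCount (σ := { τ with O := [], Y := [] }) (s := .S) (t := .U)
        (by decide) (by decide) (by decide) (by decide) (by decide) (by decide) (by decide) hT' hR'
        (L := L) ?_ ?_ ?_).imp ?_
      · rw [hX']; omega
      · simp only [Store.get, hU', List.length_reverse]; omega
      · omega
      · intro N hN; simpa [Store.get, hX', hS', hU'] using hN
  · rintro N ⟨hN, hN'⟩
    split_ifs at * with h <;> simp_all

end Frag

/-! ### Parsing a whole circuit -/

theorem PrefixFree.append {α β : Type} {enc : α → List Bool} {enc' : β → List Bool}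
    (h : PrefixFree enc) (h' : PrefixFree enc') :
    PrefixFree fun x : α × β => enc x.1 ++ enc' x.2 := by
  rintro ⟨a, b⟩ ⟨a', b'⟩ r s hrs
  simp only [List.append_assoc] at hrs
  obtain ⟨h1, h2⟩ := h _ _ _ _ hrs
  obtain ⟨h3, h4⟩ := h' _ _ _ _ h2
  exact ⟨by rw [h1, h3], h4⟩

/-- Code of the dimensions of a circuit. -/
abbrev encodeDims (x : ℕ × ℕ × ℕ) : List Bool :=
  encodeUnary x.1 ++ (encodeUnary x.2.1 ++ encodeUnary x.2.2)

theorem prefixFree_encodeDims : PrefixFree encodeDims :=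
  prefixFree_encodeUnary.append (prefixFree_encodeUnary.append prefixFree_encodeUnary)

/-- Code of the gates and the outputs of a circuit. -/
abbrev encodeBody (x : List Gate × List ℕ) : List Bool :=
  encodeList encodeGate x.1 ++ encodeList encodeUnary x.2

theorem prefixFree_encodeBody : PrefixFree encodeBody :=
  prefixFree_encodeGate.encodeList.append prefixFree_encodeUnary.encodeList

/-- The gates and the outputs `x` belong to a circuit with `b` input vertices. -/
def BodyWf (b : ℕ) (x : List Gate × List ℕ) : Prop :=
  GatesWf b x.1 ∧ ∀ j ∈ x.2, j < b + x.1.length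

/-- The values of the outputs `x.2` of a circuit with the gates `x.1` on the inputs `vals`. -/
def evalBody (x : List Gate × List ℕ) (vals : List Bool) : List Bool :=
  x.2.map ((evalGates x.1 vals).getD · false)

namespace Frag

variable {f : List Bool → ℕ} {σ : Store}

/-- Read the dimensions of a circuit. -/
def readDims : Frag Bool :=
  guard false (readUnary .A) <| guard false (readUnary .C) (readUnary .B)

theorem det_readDims {n k m : ℕ} {rest : List Bool} (h : σ.I = encodeDims (n, k, m) ++ rest)
    (hA : σ.A = []) (hB : σ.B = []) (hC : σ.C = []) :
    readDims.Det f σ true { σ with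
        I := rest, A := List.replicate n true, B := List.replicate m true, C := List.replicate k true }
      (2 * σ.I.length) := by
  rw [h]
  simp only [encodeDims, List.append_assoc, List.length_append, length_encodeUnary] at h ⊢
  have h1 := (det_readUnary (f := f) (s := .A) (by decide) h).congr (σ'' := { σ with
    I := encodeUnary k ++ (encodeUnary m ++ rest), A := List.replicate n true })
    (by simp [Store.get, hA])
  have h2 := (det_readUnary (f := f) (s := .C) (σ := { σ with
    I := encodeUnary k ++ (encodeUnary m ++ rest), A := List.replicate n true }) (by decide) rfl).congr
    (σ'' := { σ with
      I := encodeUnary m ++ rest, A := List.replicate n true, C := List.replicate k true })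
    (by simp [Store.get, hC])
  have h3 := (det_readUnary (f := f) (s := .B) (σ := { σ with
      I := encodeUnary m ++ rest, A := List.replicate n true, C := List.replicate k true })
    (by decide) rfl).congr
    (σ'' := { σ with
      I := rest, A := List.replicate n true, B := List.replicate m true, C := List.replicate k true })
      (by simp [Store.get, hB])
  exact h1.step (by omega) (h2.step (by omega) (h3.mono (by omega)))

theorem det_readDims_fail (h : ¬ ∃ x rest, σ.I = encodeDims x ++ rest) :
    ∃ σ', readDims.Det f σ false σ' (6 * σ.I.length + 3) := by
  by_cases h1 : ∃ a rest, σ.I = encodeUnary a ++ rest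
  · obtain ⟨n, r, h1⟩ := h1
    have l1 := congrArg List.length h1
    rw [List.length_append, length_encodeUnary] at l1
    have d1 := det_readUnary (f := f) (s := .A) (by decide) h1
    have d2 : (∃ a rest, r = encodeUnary a ++ rest) →
        ∃ σ', (guard false (readUnary .C) (readUnary .B)).Det f
          ((σ.set .I r).set .A (List.replicate n true ++ σ.A)) false σ' (4 * r.length + 2) := by
      rintro ⟨k, r', h2⟩
      have l2 := congrArg List.length h2
      rw [List.length_append, length_encodeUnary] at l2
      obtain ⟨σ', d3⟩ := det_readUnary_fail (f := f) (s := .B) (σ := ((((σ.set .I r).set .A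
        (List.replicate n true ++ σ.A)).set .I r').set .C (List.replicate k true ++ σ.C)))
        (by decide) (fun ⟨m, r'', h3⟩ => h ⟨(n, k, m), r'', by
          rw [h1, h2, show r' = _ from h3]; simp [encodeDims]⟩)
      exact ⟨σ', (det_readUnary (by decide) h2).step (by omega)
        (d3.mono (by dsimp only [Store.set]; omega))⟩
    by_cases h2 : ∃ a rest, r = encodeUnary a ++ rest
    · obtain ⟨σ', d2⟩ := d2 h2
      exact ⟨σ', d1.step (by omega) (d2.mono (by omega))⟩
    · obtain ⟨σ', d2⟩ := det_readUnary_fail (f := f) (s := .C)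
        (σ := ((σ.set .I r).set .A (List.replicate n true ++ σ.A))) (by decide) h2
      exact ⟨σ', d1.step (by omega) (d2.step (by dsimp only [Store.set]; omega) (det_done rfl))⟩
  · obtain ⟨σ', d⟩ := det_readUnary_fail (f := f) (s := .A) (by decide) h1
    exact ⟨σ', d.step (by omega) (det_done rfl)⟩

/-- Read the gates and the outputs of a circuit, and evaluate them. -/
def readBody : Frag Bool :=
  guard false readGates readOutputs

theorem det_readBody {x : List Gate × List ℕ} {rest : List Bool} (h : σ.I = encodeBody x ++ rest)
    (hx : BodyWf σ.V.length x) (hT : σ.T = []) {M : ℕ} (hM : σ.V.length + σ.I.length ≤ M) :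
    readBody.Det f σ true { σ with
      I := rest, T := [], V := evalGates x.1 σ.V, O := (evalBody x σ.V).reverse ++ σ.O }
      ((σ.I.length + 1) * (19 * M + 27)) := by
  have h' : σ.I = encodeList encodeGate x.1 ++ (encodeList encodeUnary x.2 ++ rest) := by
    rw [h, encodeBody, List.append_assoc]
  have l1 := congrArg List.length h'
  rw [List.length_append, List.length_append] at l1
  have l2 := length_le_length_encodeList encodeGate x.1
  have l3 := length_le_length_encodeList encodeUnary x.2
  have h1 := det_readGates (f := f) h' hx.1 hT (M := M) (by omega)
  have h2 := det_readOutputs (f := f) (σ := { σ with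
    I := encodeList encodeUnary x.2 ++ rest, T := [], V := evalGates x.1 σ.V })
    rfl (by rw [length_evalGates]; exact hx.2) rfl
  have e1 : (x.1.length + 1) * (14 * M + 21) ≤ (σ.I.length + 1) * (14 * M + 21) :=
    Nat.mul_le_mul_right _ (by omega)
  have e2 : (x.2.length + 1) * (5 * (evalGates x.1 σ.V).length + 6) ≤
      (σ.I.length + 1) * (5 * M + 6) :=
    Nat.mul_le_mul (by omega) (by rw [length_evalGates]; omega)
  -- The budget is split into a part for the gates and a part for the outputs.
  have e3 : (σ.I.length + 1) * (19 * M + 27) =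
      (σ.I.length + 1) * (14 * M + 21) + (σ.I.length + 1) * (5 * M + 6) := by ring
  rw [e3]
  exact h1.step (by omega) (h2.mono (by dsimp only; omega))

theorem det_readBody_fail
    (h : ¬ ∃ x rest, σ.I = encodeBody x ++ rest ∧ BodyWf σ.V.length x)
    (hT : σ.T = []) {M : ℕ} (hM : σ.V.length + σ.I.length ≤ M) :
    ∃ σ', readBody.Det f σ false σ' ((σ.I.length + 1) * (19 * M + 27)) := by
  have e3 : (σ.I.length + 1) * (19 * M + 27) =
      (σ.I.length + 1) * (14 * M + 21) + (σ.I.length + 1) * (5 * M + 6) := by ring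
  rw [e3]
  by_cases h1 : ∃ gs rest, σ.I = encodeList encodeGate gs ++ rest ∧ GatesWf σ.V.length gs
  · obtain ⟨gs, rest, h1, hgs⟩ := h1
    have l1 := congrArg List.length h1
    rw [List.length_append] at l1
    have l2 := length_le_length_encodeList encodeGate gs
    have d1 := det_readGates (f := f) h1 hgs hT (M := M) (by omega)
    obtain ⟨σ', d2⟩ := det_readOutputs_fail (f := f)
      (σ := { σ with I := rest, T := [], V := evalGates gs σ.V })
      (fun ⟨os, rest', h2, hos⟩ => h ⟨(gs, os), rest', by
        rw [h1, show rest = _ from h2]; simp [encodeBody], hgs, by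
        rw [length_evalGates] at hos; exact hos⟩) rfl
    have e1 : (gs.length + 1) * (14 * M + 21) ≤ (σ.I.length + 1) * (14 * M + 21) :=
      Nat.mul_le_mul_right _ (by omega)
    have e2 : (rest.length + 1) * (5 * (evalGates gs σ.V).length + 6) ≤
        (σ.I.length + 1) * (5 * M + 6) :=
      Nat.mul_le_mul (by omega) (by rw [length_evalGates]; omega)
    exact ⟨σ', d1.step (by omega) (d2.mono (by dsimp only; omega))⟩
  · obtain ⟨σ', d⟩ := det_readGates_fail (f := f) h1 hT hM
    exact ⟨σ', d.step (by omega) (det_done rfl)⟩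

theorem counts_guard_readDims {b : Bool} {q : Frag Bool} {t : ℕ}
    {P : ℕ × ℕ × ℕ → List Bool → ℕ → Prop} (hA : σ.A = []) (hB : σ.B = []) (hC : σ.C = [])
    (ht : 6 * σ.I.length + 3 ≤ t)
    (hq : ∀ n k m rest, σ.I = encodeDims (n, k, m) ++ rest → q.Counts f { σ with
        I := rest, A := List.replicate n true, B := List.replicate m true, C := List.replicate k true }
      (t - (6 * σ.I.length + 3)) (P (n, k, m) rest)) :
    (guard b readDims q).Counts f σ t fun N =>
      (∀ x rest, σ.I = encodeDims x ++ rest → P x rest N) ∧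
        ((¬ ∃ x rest, σ.I = encodeDims x ++ rest) → N = b.toNat) := by
  refine (counts_guard_decode (ok := fun _ => True) prefixFree_encodeDims ht
    (σ' := fun x rest => { σ with
      I := rest, A := List.replicate x.1 true, B := List.replicate x.2.2 true,
      C := List.replicate x.2.1 true })
    (fun x rest h _ => (det_readDims h hA hB hC).mono (by omega)) ?_
    fun x rest h _ => hq x.1 x.2.1 x.2.2 rest h).imp fun N hN => ⟨fun a rest h => hN.1 a rest h trivial,
      fun h => hN.2 (by simpa using h)⟩
  intro h
  simp only [and_true] at h
  exact det_readDims_fail h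

theorem counts_guard_readBody {b : Bool} {q : Frag Bool} {t M : ℕ}
    {P : List Gate × List ℕ → List Bool → ℕ → Prop} (hT : σ.T = [])
    (hM : σ.V.length + σ.I.length ≤ M) (ht : (σ.I.length + 1) * (19 * M + 27) ≤ t)
    (hq : ∀ x rest, σ.I = encodeBody x ++ rest → BodyWf σ.V.length x → q.Counts f { σ with
        I := rest, T := [], V := evalGates x.1 σ.V, O := (evalBody x σ.V).reverse ++ σ.O }
      (t - ((σ.I.length + 1) * (19 * M + 27))) (P x rest)) :
    (guard b readBody q).Counts f σ t fun N =>
      (∀ x rest, σ.I = encodeBody x ++ rest → BodyWf σ.V.length x → P x rest N) ∧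
        ((¬ ∃ x rest, σ.I = encodeBody x ++ rest ∧ BodyWf σ.V.length x) → N = b.toNat) :=
  counts_guard_decode prefixFree_encodeBody ht (fun _ _ h hx => det_readBody h hx hT hM)
    (fun h => det_readBody_fail h hT hM) hq

/-! ### Counting the random strings for a given output -/

/-- On a flag, a list of outputs, a circuit, two multiplicities and two inputs: count, with
multiplicity, the random bits for which the circuit has the given outputs on the input chosen by the
flag. The input is guessed and compared, so that the circuit can be read from left to right. -/
def outputCount : Frag Bool :=
  bind (pop .I) fun c => match c with
  | none => ret false
  | some b => guard false (readList .Y) <| guard false readDims <| bind guessRow fun _ =>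
      bind (move .T .P) fun _ => bind (move .X .P) fun _ => bind (move .C .B) fun _ =>
      bind guessRows fun _ => guard false readBody (checkAndCount b)

/-- The value computed by `outputCount`. -/
def outputSum (b : Bool) (o : List Bool) (d : ℕ × ℕ × ℕ) (c : List Gate × List ℕ)
    (u v x x' : List Bool) : ℕ :=
  ((bitLists d.2.2).map fun r => ((bitLists (d.1 * d.2.1)).map fun y =>
    if (evalBody c (y ++ r)).reverse = o.reverse then
      if y = (if b then x else x') then binVal (if b then v else u) else 0 else 0).sum).sum

/-- The work after the dimensions have been read. Vertices and unread code together have length at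
most n·k + m + |rest| ≤ (s + 1)², and at most s + 1 entries are processed, whence the cubic bound.
-/
theorem counts_outputCount_aux {b : Bool} {o rest : List Bool} {n k m s t : ℕ}
    (hσ : σ = { initStore rest with
      Y := o.reverse, A := List.replicate n true, B := List.replicate m true,
      C := List.replicate k true })
    (hs : o.length + n + k + m + rest.length ≤ s)
    (ht : 100 * (s + 1) ^ 3 ≤ t) :
    (bind guessRow fun _ => bind (move .T .P) fun _ => bind (move .X .P) fun _ =>
      bind (move .C .B) fun _ => bind guessRows fun _ =>
      guard false readBody (checkAndCount b)).Counts f σ t fun N => ∀ c u v x x' rest',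
      rest = encodeBody c ++ (encodeBits u ++ (encodeBits v ++ (encodeBits x ++
        (encodeBits x' ++ rest')))) → BodyWf (n * k + m) c →
      N = outputSum b o (n, k, m) c u v x x' := by
  have hnk : n * k ≤ s * s := Nat.mul_le_mul (by omega) (by omega)
  obtain ⟨M, hM⟩ : ∃ M, M = (s + 1) ^ 2 := ⟨_, rfl⟩
  have hM1 : s * s + 2 * s + 1 = M := by rw [hM]; ring
  have hsM : (s + 1) * M ≤ t := by
    rw [hM]; refine le_trans ?_ ht; nlinarith [Nat.zero_le ((s+1)^3)]
  have e1 : (rest.length + 1) * (19 * M + 27) ≤ (s + 1) * (46 * M) :=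
    Nat.mul_le_mul (by omega) (by omega)
  have e2 : (s + 1) * (46 * M) = 46 * ((s + 1) * M) := by ring
  have e3 : 100 * ((s + 1) * M) ≤ t := by rw [hM]; convert ht using 1; ring
  have e4 : M ≤ (s + 1) * M := Nat.le_mul_of_pos_left _ (by omega)
  have e5 : n * (7 * k + 3) = 7 * (n * k) + 3 * n := by ring
  subst hσ
  -- The random bits are guessed before the input, so that the input lies above them on `V`, in the
  -- order of the vertex numbers.
  refine (counts_bind_of_sum (k := m) (c := 5 * m + 1) (t := t - (5 * m + 1))
    (σ' := fun r => { initStore rest with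
      Y := o.reverse, A := List.replicate n true, C := List.replicate k true,
      T := List.replicate m true, V := r, X := r })
    (P := fun r N => ∀ c u v x x' rest',
      rest = encodeBody c ++ (encodeBits u ++ (encodeBits v ++ (encodeBits x ++
        (encodeBits x' ++ rest')))) → BodyWf (n * k + m) c →
      N = ((bitLists (n * k)).map fun y =>
        if (evalBody c (y ++ r)).reverse = o.reverse then
          if y = (if b then x else x') then binVal (if b then v else u) else 0 else 0).sum)
    (fun F Q t h => runs_guessRow rfl fun y hy => ?_) (by omega) fun r hr => ?_).imp ?_
  · simpa [initStore] using h y hy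
  -- Guessing the random bits left copies on `T` and `X`; they are discarded to `P`, since `T` has
  -- to be empty and `X` is to hold the guessed input alone.
  · refine Det.counts_bind ((det_move (by decide)).mono (c' := 2 * m + 1) (by simp [Store.get]))
      (by omega) ?_
    refine Det.counts_bind ((det_move (by decide)).mono (c' := 2 * m + 1) (by simp [Store.get, hr]))
      (by omega) ?_
    refine Det.counts_bind (((det_move (by decide)).congr (σ'' := { initStore rest with
      Y := o.reverse, A := List.replicate n true, B := List.replicate k true, V := r,
      P := r.reverse ++ List.replicate m true }) (by simp [Store.get, initStore])).mono
      (c' := 2 * k + 1) (by simp [Store.get])) (by omega) ?_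
    refine (counts_bind_of_sum (k := n * k) (c := n * (7 * k + 3) + 1)
      (t := t - (5 * m + 1) - (2 * m + 1) - (2 * m + 1) - (2 * k + 1) - (n * (7 * k + 3) + 1))
      (σ' := fun y => { initStore rest with
        Y := o.reverse, B := List.replicate k true, V := y ++ r,
        P := r.reverse ++ List.replicate m true, X := y })
      (P := fun y N => ∀ c u v x x' rest',
        rest = encodeBody c ++ (encodeBits u ++ (encodeBits v ++ (encodeBits x ++
          (encodeBits x' ++ rest')))) → BodyWf (n * k + m) c →
        N = if (evalBody c (y ++ r)).reverse = o.reverse then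
          if y = (if b then x else x') then binVal (if b then v else u) else 0 else 0)
      (fun F Q t h => runs_guessRows rfl rfl rfl fun y hy => ?_) (by omega) fun y hy => ?_).imp ?_
    · simpa [initStore] using h y hy
    · have hV : (y ++ r).length = n * k + m := by rw [List.length_append, hy, hr]
      refine (counts_guard_readBody (M := M)
        (P := fun c r₂ N => ∀ u v x x' rest', r₂ = encodeBits u ++ (encodeBits v ++ (encodeBits x ++
            (encodeBits x' ++ rest'))) → N = if (evalBody c (y ++ r)).reverse = o.reverse then
          if y = (if b then x else x') then binVal (if b then v else u) else 0 else 0)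
        rfl ?_ ?_ fun c r₂ h hc => ?_).imp ?_
      · simp only [initStore, hV]; omega
      · simp only [initStore]; omega
      · have l := congrArg List.length h
        have l2 := length_le_length_encodeList encodeUnary c.2
        simp only [initStore, encodeBody, List.length_append] at l
        refine (counts_checkAndCount (L := M) ?_ ?_ ?_ rfl rfl rfl rfl rfl rfl ?_).imp ?_
        · dsimp only; omega
        · simp [initStore, evalBody]; omega
        · dsimp only; omega
        · simp only [initStore]; omega
        · intro N hN u v x x' rest' hr
          have := hN u v x x' rest' hr
          simpa [initStore] using this
      · intro N hN c u v x x' rest' hr hc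
        exact hN.1 c _ hr (by rw [hV]; exact hc) u v x x' rest' rfl
    · rintro N ⟨F, rfl, hF⟩ c u v x x' rest' hr hc
      exact congrArg List.sum (List.map_congr_left fun y hy =>
        hF y (length_of_mem_bitLists hy) c u v x x' rest' hr hc)
  · rintro N ⟨F, rfl, hF⟩ c u v x x' rest' hr hc
    exact congrArg List.sum (List.map_congr_left fun y hy =>
      hF y (length_of_mem_bitLists hy) c u v x x' rest' hr hc)

theorem counts_outputCount (q : List Bool) :
    outputCount.Counts f (initStore q) (200 * (q.length + 1) ^ 3) fun N =>
      ∀ b o d c u v x x' rest, q = b :: (encodeBits o ++ (encodeDims d ++ (encodeBody c ++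
        (encodeBits u ++ (encodeBits v ++ (encodeBits x ++ (encodeBits x' ++ rest))))))) →
      BodyWf (d.1 * d.2.1 + d.2.2) c → N = outputSum b o d c u v x x' := by
  cases q with
  | nil =>
    exact (Det.counts_bind (det_pop_nil rfl) (by simp) (counts_ret _ _)).imp
      fun N _ b o d c u v x x' rest h =>
      by simp at h
  | cons b q =>
    have e : 200 * ((b :: q).length + 1) ^ 3 ≥ 100 * (q.length + 1 + 1) ^ 3 + 100 * (q.length + 2) := by
      rw [List.length_cons]
      nlinarith [Nat.pow_le_pow_right (n := q.length + 2) (by omega) (show 1 ≤ 3 by omega)]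
    refine Det.counts_bind (det_pop_cons (b := b) (l := q) rfl) (by omega) ?_
    refine (counts_guard_readList (by decide) ?_ fun o r h1 => counts_guard_readDims
      (P := fun d r N => ∀ c u v x x' rest', r = encodeBody c ++ (encodeBits u ++ (encodeBits v ++
        (encodeBits x ++ (encodeBits x' ++ rest')))) → BodyWf (d.1 * d.2.1 + d.2.2) c →
        N = outputSum b o d c u v x x')
      rfl rfl rfl ?_ fun n k m r₂ h2 => ?_).imp ?_
    all_goals dsimp only [initStore, Store.set] at *
    · omega
    · have l1 := congrArg List.length h1
      rw [List.length_append, length_encodeBits] at l1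
      omega
    · have l1 := congrArg List.length h1
      rw [List.length_append, length_encodeBits] at l1
      have l2 := congrArg List.length h2
      simp only [List.length_append, length_encodeUnary] at l2
      refine counts_outputCount_aux (s := q.length + 1) (by simp [initStore]) (by omega) (by omega)
    · intro N hN b' o d c u v x x' rest h hc
      obtain ⟨rfl, h1⟩ := List.cons.inj h
      exact (hN o _ h1).1 d _ rfl c u v x x' rest rfl hc

/-! ### Summing truncated differences of oracle answers -/

/-- Move the stack `T` to both of `s` and `t`. -/
def copy (s t : Reg) : Frag Unit :=
  loop (A := Unit) .T (fun _ b => match b with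
    | none => ret (.inr ())
    | some b => bind (push s b) fun _ => bind (push t b) fun _ => ret (.inl ())) ()

theorem det_copy {s t : Reg} (hs : s ≠ .T) (ht : t ≠ .T) (h : s ≠ t) :
    (copy s t).Det f σ () (((σ.set .T []).set s (σ.T.reverse ++ σ.get s)).set t
      (σ.T.reverse ++ σ.get t)) (3 * σ.T.length + 1) := by
  generalize hl : σ.T = l
  induction l generalizing σ with
  | nil =>
    refine (det_loop_nil (s := .T) (c := 0) hl (det_done ?_)).mono (by simp)
    have e : σ.set .T [] = σ := by rw [← hl]
    simp only [e, List.reverse_nil, List.nil_append]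
    rw [show σ.set s (σ.get s) = σ by simp, Store.set_get_self]
  | cons b l ih =>
    have h1 := ih (σ := ((σ.set .T l).set s (b :: σ.get s)).set t (b :: σ.get t)) (by
      have := Store.get_set_of_ne ((σ.set .T l).set s (b :: σ.get s)) (b :: σ.get t) ht.symm
      rw [Store.get_set_of_ne _ _ hs.symm] at this
      exact this)
    refine (det_loop_cons (s := .T) (c := 2) hl ?_ h1).congr ?_ |>.mono
      (by simp only [List.length_cons]; omega)
    · refine det_push_bind (by omega) (det_push_bind (by omega) (det_done ?_))
      rw [Store.get_set_of_ne _ _ hs, Store.get_set_of_ne _ _ h.symm, Store.get_set_of_ne _ _ ht]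
    · apply Store.get_injective
      repeat rw [Store.get_set]
      funext r
      simp only [Function.update_apply]
      split_ifs <;> simp_all

/-- Move the stack `T` to the code of a list on `Q`. -/
def encodeToQuery : Frag Unit :=
  loop (A := Unit) .T (fun _ b => match b with
    | none => ret (.inr ())
    | some b => bind (push .Q b) fun _ => bind (push .Q true) fun _ => ret (.inl ())) ()

/-- The code of a list grows at its front by two pushes per entry, so it is written from the last
entry to the first. -/
theorem det_encodeToQuery {o w : List Bool} (h : σ.Q = encodeBits o ++ w) :
    encodeToQuery.Det f σ () { σ with T := [], Q := encodeBits (σ.T.reverse ++ o) ++ w }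
      (3 * σ.T.length + 1) := by
  generalize hl : σ.T = l
  induction l generalizing σ o with
  | nil =>
    refine (det_loop_nil (s := .T) (c := 0) hl (det_done ?_)).mono (by simp)
    ext1 <;> simp [hl, h]
  | cons b l ih =>
    have h1 := ih (σ := { σ with T := l, Q := encodeBits (b :: o) ++ w }) rfl rfl
    refine (det_loop_cons (s := .T) (c := 2) hl ?_ h1).congr (by simp) |>.mono
      (by simp only [List.length_cons]; omega)
    exact det_push_bind (by omega) (det_push_bind (by omega) (det_done
      (by simp [Store.get, h, encodeBits_cons])))

/-- Guess a list of bits that is at most as long as the stack `I`; push the list on `O` and its code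
on `Q`. -/
def guessOutputs : Frag Unit :=
  loop (A := Unit) .I (fun _ b => match b with
    | none => ret (.inr ())
    | some _ => bind guess fun c => match c with
      | false => ret (.inr ())
      | true => bind guess fun b => bind (push .Q b) fun _ => bind (push .Q true) fun _ =>
          bind (push .O b) fun _ => ret (.inl ())) ()

/-- The number of outputs is not known before the circuit has been read, so all lengths up to that
of the input are tried, with `I` as a counter. Every round first guesses whether to stop, except
when `I` is exhausted; hence each list arises on exactly one path. -/
theorem runs_guessOutputs {Q : Unit → Store → ℕ → ℕ → Prop} {n t : ℕ} {F : List Bool → ℕ}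
    {w : List Bool} (hI : σ.I.length = n) (hQ : σ.Q = encodeBits σ.O ++ w)
    (h : ∀ y I, y.length ≤ n → Q () { σ with
      I := I, Q := encodeBits (y ++ σ.O) ++ w, O := y ++ σ.O } (F y) t) :
    guessOutputs.Runs f Q σ (∑ j ∈ Finset.range (n + 1), ((bitLists j).map F).sum)
      (t + (6 * n + 1)) := by
  induction n generalizing σ F with
  | zero =>
    have hI : σ.I = [] := List.eq_nil_of_length_eq_zero hI
    refine runs_loop_nil (s := .I) hI (runs_ret ?_)
    have := h [] [] le_rfl
    have e : ({ σ with I := [], Q := encodeBits σ.O ++ w } : Store) = σ := by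
      ext1 <;> simp [hI, hQ]
    simpa [e, bitLists] using this
  | succ n ih =>
    obtain ⟨b, l, hl⟩ := List.exists_cons_of_length_eq_add_one hI
    have hl' : l.length = n := by rw [hl] at hI; simpa using hI
    -- A list is empty or has a last entry, which is the bit guessed first.
    have e : ∑ j ∈ Finset.range (n + 1 + 1), ((bitLists j).map F).sum = F [] +
        (∑ j ∈ Finset.range (n + 1), ((bitLists j).map fun l => F (l ++ [false])).sum +
          ∑ j ∈ Finset.range (n + 1), ((bitLists j).map fun l => F (l ++ [true])).sum) := by
      rw [Finset.sum_range_succ', ← Finset.sum_add_distrib, add_comm]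
      simp only [sum_bitLists_succ]
      simp [bitLists]
    rw [e]
    refine Runs.mono (runs_loop_cons (s := .I) (t := t + (6 * n + 1) + 5) hl (runs_bind
      (runs_guess (t := t + (6 * n + 1) + 4) ((runs_ret (t := t) ?_).mono (by omega))
        (runs_bind (runs_guess (t := t + (6 * n + 1) + 3) ?_ ?_))))) (by omega)
    · have := h [] l (by simp)
      rw [List.nil_append, ← hQ] at this
      exact this
    all_goals
      refine (det_push _ _).runs_bind (t := t + (6 * n + 1) + 2) ((det_push _ _).runs_bind
        (t := t + (6 * n + 1) + 1) ((det_push _ _).runs_bind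
        (t := t + (6 * n + 1)) (runs_ret ?_)))
    · refine ih (F := fun l => F (l ++ [false])) hl'
        (by simp [Store.get, hQ, encodeBits_cons]) fun y I hy => ?_
      have := h (y ++ [false]) I (by simp [hy])
      simpa using this
    · refine ih (F := fun l => F (l ++ [true])) hl'
        (by simp [Store.get, hQ, encodeBits_cons]) fun y I hy => ?_
      have := h (y ++ [true]) I (by simp [hy])
      simpa using this

/-- With an input on `S`, a list of outputs on `O` and its code followed by the input on `Q`: count up to
the difference of the answers to the two queries. -/
def compareAnswers : Frag Bool :=
  bind (push .Q false) fun _ => bind query fun _ => bind (move .R .T) fun _ => bind (move .T .D) fun _ =>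
  bind (move .S .T) fun _ => bind (move .T .Q) fun _ => bind (push .Q false) fun _ =>
  bind (move .O .T) fun _ => bind encodeToQuery fun _ => bind (push .Q true) fun _ => bind query fun _ =>
  guessBetween .R .D

/-- A query is erased when it is answered. The second one is rebuilt from `S` and `O`, while the
first answer waits on `D`. -/
theorem runs_compareAnswers {o w I : List Bool} {L : ℕ} (ho : o.length ≤ w.length)
    (hL : ∀ b, (f (b :: (encodeBits o ++ w))).bits.length ≤ L) :
    compareAnswers.Runs f AtExit { initStore I with Q := encodeBits o ++ w, O := o, S := w }
      (f (true :: (encodeBits o ++ w)) - f (false :: (encodeBits o ++ w)))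
      (9 * w.length + 7 * L + 15) := by
  obtain ⟨N, h, rfl⟩ : compareAnswers.Counts f
      { initStore I with Q := encodeBits o ++ w, O := o, S := w } (9 * w.length + 7 * L + 15) fun N =>
      N = f (true :: (encodeBits o ++ w)) - f (false :: (encodeBits o ++ w)) := by
    have a1 := hL false
    have a2 := hL true
    refine (det_push _ _).counts_bind (by omega) (det_query.counts_bind (by omega) ?_)
    generalize hr : f (false :: (encodeBits o ++ w)) = r at *
    refine Det.counts_bind (((det_move (s := .R) (t := .T) (by decide)).congr (σ'' := { initStore I with
      O := o, S := w, T := r.bits.reverse }) (by simp [initStore, Store.get])).mono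
      (c' := 2 * L + 1) (by simp [Store.get, a1])) (by omega) ?_
    refine Det.counts_bind (((det_move (s := .T) (t := .D) (by decide)).congr (σ'' := { initStore I with
      O := o, S := w, D := r.bits }) (by simp [initStore, Store.get])).mono
      (c' := 2 * L + 1) (by simp [Store.get, a1])) (by omega) ?_
    refine Det.counts_bind (((det_move (s := .S) (t := .T) (by decide)).congr (σ'' := { initStore I with
      O := o, T := w.reverse, D := r.bits }) (by simp [initStore, Store.get])).mono
      (c' := 2 * w.length + 1) (by simp [Store.get])) (by omega) ?_
    refine Det.counts_bind (((det_move (s := .T) (t := .Q) (by decide)).congr (σ'' := { initStore I with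
      O := o, Q := w, D := r.bits }) (by simp [initStore, Store.get])).mono
      (c' := 2 * w.length + 1) (by simp [Store.get])) (by omega) ?_
    refine (det_push _ _).counts_bind (by omega) ?_
    refine Det.counts_bind (((det_move (s := .O) (t := .T) (by decide)).congr (σ'' := { initStore I with
      T := o.reverse, Q := false :: w, D := r.bits }) (by simp [initStore, Store.get])).mono
      (c' := 2 * w.length + 1) (by simp [Store.get, ho])) (by omega) ?_
    refine Det.counts_bind (((det_encodeToQuery (o := []) (w := w) rfl).congr (σ'' := { initStore I with
      Q := encodeBits o ++ w, D := r.bits }) (by simp [initStore])).mono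
      (c' := 3 * w.length + 1) (by simpa using ho)) (by omega) ?_
    refine (det_push _ _).counts_bind (by omega) (det_query.counts_bind (by omega) ?_)
    refine ⟨_, (runs_guessBetween (s := .R) (t := .D) (n := L) (by decide) a2 a1).mono (by omega), ?_⟩
    dsimp only [Store.get]
    rw [binVal_bits, binVal_bits]
  exact h

/-- Count, for all lists of bits that are at most as long as the input, the difference between the
answers of the oracle to the queries that consist of a flag, the code of the list, and the input. -/
def difference : Frag Bool :=
  bind (move .I .T) fun _ => bind (copy .I .S) fun _ => bind (move .S .T) fun _ =>
  bind (copy .Q .S) fun _ => bind (push .Q false) fun _ => bind guessOutputs fun _ => compareAnswers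

theorem runs_difference {w : List Bool} {L : ℕ}
    (hL : ∀ b o, o.length ≤ w.length → (f (b :: (encodeBits o ++ w))).bits.length ≤ L) :
    difference.Runs f AtExit (initStore w)
      (∑ j ∈ Finset.range (w.length + 1), ((bitLists j).map fun o =>
        f (true :: (encodeBits o ++ w)) - f (false :: (encodeBits o ++ w))).sum)
      (30 * (w.length + 1) + 10 * (L + 1)) := by
  -- The time is written with the costs of the fragments in reverse order, so that each composition
  -- peels off the last summand.
  suffices H : difference.Runs f AtExit (initStore w)
      (∑ j ∈ Finset.range (w.length + 1), ((bitLists j).map fun o =>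
        f (true :: (encodeBits o ++ w)) - f (false :: (encodeBits o ++ w))).sum)
      ((9 * w.length + 7 * L + 15) + (6 * w.length + 1) + 1 + (3 * w.length + 1) +
        (2 * w.length + 1) + (3 * w.length + 1) + (2 * w.length + 1)) from H.mono (by omega)
  refine (((det_move (f := f) (s := .I) (t := .T) (σ := initStore w) (by decide)).congr
    (σ'' := { initStore [] with T := w.reverse }) (by simp [initStore])).mono
    (c' := 2 * w.length + 1) (by simp [Store.get, initStore])).runs_bind ?_
  refine (((det_copy (f := f) (s := .I) (t := .S) (σ := { initStore [] with T := w.reverse })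
    (by decide) (by decide) (by decide)).congr (σ'' := { initStore w with S := w })
    (by simp [initStore])).mono (c' := 3 * w.length + 1) (by simp)).runs_bind ?_
  refine (((det_move (f := f) (s := .S) (t := .T) (σ := { initStore w with S := w })
    (by decide)).congr (σ'' := { initStore w with T := w.reverse }) (by simp [initStore])).mono
    (c' := 2 * w.length + 1) (by simp [Store.get])).runs_bind ?_
  refine (((det_copy (f := f) (s := .Q) (t := .S) (σ := { initStore w with T := w.reverse })
    (by decide) (by decide) (by decide)).congr (σ'' := { initStore w with Q := w, S := w })
    (by simp [initStore])).mono (c' := 3 * w.length + 1) (by simp)).runs_bind ?_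
  refine (det_push _ _).runs_bind (runs_bind (runs_guessOutputs (w := w) rfl rfl fun o I ho => ?_))
  simpa [initStore] using runs_compareAnswers (I := I) ho fun b => hL b o ho

/-! ### Existence of accepting paths -/

variable {A E : Type}

/-- From the store `σ`, all paths of `p` have at most `t` steps, and some path ends at the exit `true`
if and only if `P` holds. -/
def Accepts (p : Frag Bool) (f : List Bool → ℕ) (σ : Store) (t : ℕ) (P : Prop) : Prop :=
  p.Counts f σ t fun N => 0 < N ↔ P

theorem Accepts.congr {p : Frag Bool} {t : ℕ} {P P' : Prop} (h : p.Accepts f σ t P) (h' : P ↔ P') :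
    p.Accepts f σ t P' :=
  h.imp fun _ hN => hN.trans h'

theorem accepts_ret (b : Bool) (t : ℕ) : (ret b).Accepts f σ t (b = true) :=
  (counts_ret b t).imp fun N hN => by rw [hN]; cases b <;> simp

/-- Accepting whenever no parse exists matches the vacuous truth of the universal statement;
otherwise uniqueness of the parse reduces that statement to a single instance. -/
theorem Accepts.guard_decode {α : Type} {enc : α → List Bool} (henc : PrefixFree enc)
    {p q : Frag Bool} {c t : ℕ} {ok : α → Prop} {P : α → List Bool → Prop}
    {σ' : α → List Bool → Store} (ht : c ≤ t)
    (h1 : ∀ a rest, σ.I = enc a ++ rest → ok a → p.Det f σ true (σ' a rest) c)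
    (h0 : (¬ ∃ a rest, σ.I = enc a ++ rest ∧ ok a) → ∃ σ', p.Det f σ false σ' c)
    (hq : ∀ a rest, σ.I = enc a ++ rest → ok a → q.Accepts f (σ' a rest) (t - c) (P a rest)) :
    (guard true p q).Accepts f σ t (∀ a rest, σ.I = enc a ++ rest → ok a → P a rest) := by
  refine (counts_guard_decode henc ht h1 h0 hq).imp fun N hN => ?_
  by_cases hC : ∃ a rest, σ.I = enc a ++ rest ∧ ok a
  · obtain ⟨a, rest, h, ha⟩ := hC
    rw [hN.1 a rest h ha]
    refine ⟨fun h' a' rest' h'' _ => ?_, fun h' => h' a rest h ha⟩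
    obtain ⟨rfl, rfl⟩ := henc _ _ _ _ (h.symm.trans h'')
    exact h'
  · rw [hN.2 hC]
    exact ⟨fun _ a rest h ha => absurd ⟨a, rest, h, ha⟩ hC, fun _ => Nat.one_pos⟩

/-- Read a number in binary code to the stack `s`, and check its most significant bit, which is missing
for the number zero. -/
def readNumber (s : Reg) (ok : Option Bool → Bool) : Frag Bool :=
  bind (readBits s) fun r => ret (r.elim false ok)

theorem accepts_guard_readNumber {s : Reg} (hI : s ≠ .I) {ok : Option Bool → Bool} {q : Frag Bool}
    {t : ℕ} {P : List Bool → List Bool → Prop} (ht : 3 * σ.I.length + 2 ≤ t)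
    (hq : ∀ l rest, σ.I = encodeBits l ++ rest → ok l.getLast? = true → q.Accepts f
      ((σ.set .I rest).set s (l.reverse ++ σ.get s)) (t - (3 * σ.I.length + 2)) (P l rest)) :
    (guard true (readNumber s ok) q).Accepts f σ t
      (∀ l rest, σ.I = encodeBits l ++ rest → ok l.getLast? = true → P l rest) := by
  have hc : ∀ l rest, σ.I = encodeBits l ++ rest → 3 * l.length + 1 ≤ 3 * σ.I.length + 2 := by
    intro l rest h
    rw [h, List.length_append, length_encodeBits]
    omega
  refine Accepts.guard_decode prefixFree_encodeBits ht (fun l rest h hl => ?_) (fun h => ?_) hq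
  · exact (det_readBits hI h).step (hc l rest h) (by simpa [hl] using det_done rfl)
  · by_cases h' : ∃ l rest, σ.I = encodeBits l ++ rest
    · obtain ⟨l, rest, h'⟩ := h'
      have hl : ok l.getLast? = false := Bool.eq_false_iff.mpr fun hl => h ⟨l, rest, h', hl⟩
      exact ⟨_, (det_readBits hI h').step (hc l rest h') (by simpa [hl] using det_done rfl)⟩
    · obtain ⟨σ', h'⟩ := det_readBits_fail (f := f) hI h'
      exact ⟨σ', h'.step (by omega) (det_done rfl)⟩

/-- From the store `σ`, the fragment `p` reaches on its paths, within `c` steps, exactly the exits and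
stores described by `R`. -/
def Reach (p : Frag A) (f : List Bool → ℕ) (σ : Store) (c : ℕ) (R : A → Store → Prop) : Prop :=
  ∀ (Q : A → Store → ℕ → ℕ → Prop) (t : ℕ) (P : A → Store → Prop),
    (∀ a σ', R a σ' → ∃ N, Q a σ' N t ∧ (0 < N ↔ P a σ')) →
      ∃ N, p.Runs f Q σ N (t + c) ∧ (0 < N ↔ ∃ a σ', R a σ' ∧ P a σ')

theorem Reach.congr {p : Frag A} {c c' : ℕ} {R R' : A → Store → Prop} (h : p.Reach f σ c R)
    (hc : c ≤ c') (hR : ∀ a σ', R a σ' ↔ R' a σ') : p.Reach f σ c' R' := by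
  obtain rfl : R = R' := funext fun a => funext fun σ' => propext (hR a σ')
  exact fun Q t P hQ => (h Q t P hQ).imp fun N hN => ⟨hN.1.mono (by omega), hN.2⟩

theorem Det.reach {p : Frag A} {a : A} {σ' : Store} {c : ℕ} (h : p.Det f σ a σ' c) :
    p.Reach f σ c fun a' σ'' => a' = a ∧ σ'' = σ' := by
  intro Q t P hQ
  obtain ⟨N, h1, h2⟩ := hQ a σ' ⟨rfl, rfl⟩
  refine ⟨N, h Q N t h1, h2.trans ⟨fun h => ⟨a, σ', ⟨rfl, rfl⟩, h⟩, ?_⟩⟩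
  rintro ⟨_, _, ⟨rfl, rfl⟩, h'⟩
  exact h'

theorem reach_guess : guess.Reach f σ 1 fun _ σ' => σ' = σ := by
  intro Q t P hQ
  obtain ⟨N₀, h0, h0'⟩ := hQ false σ rfl
  obtain ⟨N₁, h1, h1'⟩ := hQ true σ rfl
  refine ⟨_, runs_guess h0 h1, ?_⟩
  simp only [Nat.add_pos_iff_pos_or_pos, h0', h1', Bool.exists_bool]
  simp

/-- Where only positivity of a count matters, a sum over branches becomes an existential quantifier,
and fragments compose like relations. -/
theorem Reach.bind [Finite A] {p : Frag A} {q : A → Frag E} {c c' : ℕ} {R : A → Store → Prop}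
    {R' : A → Store → E → Store → Prop} (hp : p.Reach f σ c R)
    (hq : ∀ a σ', R a σ' → (q a).Reach f σ' c' (R' a σ')) :
    (Frag.bind p q).Reach f σ (c' + c) fun e σ'' => ∃ a σ', R a σ' ∧ R' a σ' e σ'' := by
  intro Q t P hQ
  obtain ⟨N, h, h'⟩ := hp (fun a σ N t => (q a).Runs f Q σ N t) (t + c')
    (fun a σ' => ∃ e σ'', R' a σ' e σ'' ∧ P e σ'')
    fun a σ' ha => hq a σ' ha Q t P fun e σ'' he => hQ e σ'' ⟨a, σ', ha, he⟩
  refine ⟨N, (runs_bind h).mono (by omega), h'.trans ⟨?_, ?_⟩⟩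
  · rintro ⟨a, σ', h1, e, σ'', h2, h3⟩
    exact ⟨e, σ'', ⟨a, σ', h1, h2⟩, h3⟩
  · rintro ⟨e, σ'', ⟨a, σ', h1, h2⟩, h3⟩
    exact ⟨a, σ', h1, e, σ'', h2, h3⟩

theorem Det.reach_bind [Finite A] {p : Frag A} {q : A → Frag E} {a : A} {σ' : Store} {c c' : ℕ}
    {R : E → Store → Prop} (h : p.Det f σ a σ' c) (h' : (q a).Reach f σ' c' R) :
    (Frag.bind p q).Reach f σ (c' + c) R := by
  refine (h.reach.bind (R' := fun _ _ => R) ?_).congr le_rfl ?_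
  · rintro _ _ ⟨rfl, rfl⟩
    exact h'
  · simp

theorem Reach.accepts_bind [Finite A] {p : Frag A} {q : A → Frag Bool} {c t : ℕ}
    {R : A → Store → Prop} {P : A → Store → Prop} (h : p.Reach f σ c R) (ht : c ≤ t)
    (hq : ∀ a σ', R a σ' → (q a).Accepts f σ' (t - c) (P a σ')) :
    (Frag.bind p q).Accepts f σ t (∃ a σ', R a σ' ∧ P a σ') := by
  obtain ⟨N, h1, h2⟩ := h (fun a σ N t => (q a).Runs f AtExit σ N t) (t - c) P hq
  exact ⟨N, (runs_bind h1).mono (by omega), h2⟩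

theorem reach_loop_cons [Finite A] {s : Reg} {body : A → Option Bool → Frag (A ⊕ E)} {a : A} {b : Bool}
    {l : List Bool} {c c' : ℕ} {R : A → Store → Prop} {R' : A → Store → E → Store → Prop}
    (h : σ.get s = b :: l)
    (h' : (body a (some b)).Reach f (σ.set s l) c fun x σ' => ∃ a', x = .inl a' ∧ R a' σ')
    (h'' : ∀ a' σ', R a' σ' → (loop s body a').Reach f σ' c' (R' a' σ')) :
    (loop s body a).Reach f σ (c' + c + 1) fun e σ'' => ∃ a' σ', R a' σ' ∧ R' a' σ' e σ'' := by
  intro Q t P hQ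
  obtain ⟨N, h1, h2⟩ := h' (fun e σ N t => e.elim (fun a => (loop s body a).Runs f Q σ N t)
    (fun e => Q e σ N t)) (t + c')
    (fun x σ' => ∃ a', x = .inl a' ∧ ∃ e σ'', R' a' σ' e σ'' ∧ P e σ'') (by
      rintro _ σ' ⟨a', rfl, ha⟩
      obtain ⟨N, h1, h2⟩ := h'' a' σ' ha Q t P fun e σ'' he => hQ e σ'' ⟨a', σ', ha, he⟩
      exact ⟨N, h1, h2.trans ⟨fun h => ⟨a', rfl, h⟩, fun ⟨a'', h, h'⟩ => by
        obtain rfl := Sum.inl.inj h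
        exact h'⟩⟩)
  refine ⟨N, (runs_loop_cons h h1).mono (by omega), h2.trans ⟨?_, ?_⟩⟩
  · rintro ⟨_, σ', ⟨a', rfl, h3⟩, _, h4, e, σ'', h5, h6⟩
    obtain rfl := Sum.inl.inj h4
    exact ⟨e, σ'', ⟨a', σ', h3, h5⟩, h6⟩
  · rintro ⟨e, σ'', ⟨a', σ', h3, h5⟩, h6⟩
    exact ⟨_, σ', ⟨a', rfl, h3⟩, a', rfl, e, σ'', h5, h6⟩

/-- Guess a bit on `V` and `X`, and a bit on `Y`, which is the same one unless `c` holds. -/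
def guessPair (c : Bool) : Frag Unit :=
  bind guess fun b => bind (push .V b) fun _ => bind (push .X b) fun _ =>
    bind (if c then guess else ret b) fun b' => push .Y b'

theorem reach_guessPair (c : Bool) : (guessPair c).Reach f σ 5 fun _ σ' =>
    ∃ b b', (c = false → b = b') ∧
      σ' = { σ with V := b :: σ.V, X := b :: σ.X, Y := b' :: σ.Y } := by
  have h1 : ∀ (b : Bool) (σ : Store), (if c then guess else ret b).Reach f σ 1 fun b' σ' =>
      (c = false → b = b') ∧ σ' = σ := by
    intro b σ
    cases c with
    | false => exact (det_ret b).reach.congr (by omega) (by simp [eq_comm])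
    | true => exact reach_guess.congr le_rfl (by simp)
  refine (reach_guess.bind (c' := 4) (R' := fun b _ _ σ' => ∃ b', (c = false → b = b') ∧
    σ' = { σ with V := b :: σ.V, X := b :: σ.X, Y := b' :: σ.Y }) ?_).congr le_rfl ?_
  · rintro b _ rfl
    refine (det_push _ _).reach_bind (c' := 3) ((det_push _ _).reach_bind (c' := 2) ?_)
    refine ((h1 b _).bind fun b' σ' _ => (det_push .Y b').reach).congr le_rfl fun _ σ' => ⟨?_, ?_⟩
    · rintro ⟨b', _, ⟨h, rfl⟩, _, rfl⟩
      exact ⟨b', h, rfl⟩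
    · rintro ⟨b', h, rfl⟩
      exact ⟨b', _, ⟨h, rfl⟩, rfl, rfl⟩
  · rintro _ σ'
    simp

/-- Guess a row of bits on `V` and `X` for each bit on `B`, and a row on `Y` that is the same unless `c`
holds. -/
def guessRowPair (c : Bool) : Frag Unit :=
  loop (A := Unit) .B (fun _ b => match b with
    | none => ret (.inr ())
    | some _ => bind (push .T true) fun _ => bind (guessPair c) fun _ => ret (.inl ())) ()

theorem reach_guessRowPair {c : Bool} {k : ℕ} (hB : σ.B = List.replicate k true) :
    (guessRowPair c).Reach f σ (7 * k + 1) fun _ σ' =>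
      ∃ z z' : Fin k → Bool, (c = false → z = z') ∧ σ' = { σ with
        B := [], T := List.replicate k true ++ σ.T, V := List.ofFn z ++ σ.V, X := List.ofFn z ++ σ.X,
        Y := List.ofFn z' ++ σ.Y } := by
  induction k generalizing σ with
  | zero =>
    refine (det_loop_nil (s := .B) (c := 0) hB (det_done rfl)).reach.congr (by omega) fun _ σ' => ?_
    have e : σ = { σ with B := [] } := by rw [show ([] : List Bool) = σ.B from hB.symm]
    refine ⟨?_, ?_⟩
    · rintro ⟨-, rfl⟩
      exact ⟨Fin.elim0, Fin.elim0, fun _ => rfl, by simpa using e⟩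
    · rintro ⟨z, z', -, rfl⟩
      exact ⟨rfl, by simpa using e.symm⟩
  | succ k ih =>
    refine (reach_loop_cons (s := .B) (hB.trans List.replicate_succ)
      (R := fun _ σ' => ∃ b b', (c = false → b = b') ∧ σ' = { σ with
        B := List.replicate k true, T := true :: σ.T, V := b :: σ.V, X := b :: σ.X, Y := b' :: σ.Y })
      (c := 6) ?_ fun _ σ' h => ih (σ := σ') ?_).congr (by omega) fun _ σ' => ?_
    · refine (det_push _ _).reach_bind (c' := 5) ?_
      refine ((reach_guessPair c).bind fun _ σ' _ => (det_ret _).reach).congr (by omega) fun x σ' => ?_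
      constructor
      · rintro ⟨_, _, ⟨b, b', h, rfl⟩, rfl, rfl⟩
        exact ⟨(), rfl, b, b', h, rfl⟩
      · rintro ⟨_, rfl, b, b', h, rfl⟩
        exact ⟨(), _, ⟨b, b', h, rfl⟩, rfl, rfl⟩
    · obtain ⟨b, b', _, rfl⟩ := h
      rfl
    · constructor
      · rintro ⟨_, _, ⟨b, b', h, rfl⟩, z, z', hz, rfl⟩
        refine ⟨Fin.snoc z b, Fin.snoc z' b', fun hc => by rw [h hc, hz hc], ?_⟩
        simp only [List.ofFn_succ', Fin.snoc_castSucc, Fin.snoc_last]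
        simp [List.replicate_succ']
      · rintro ⟨z, z', hz, rfl⟩
        refine ⟨(), _, ⟨z (Fin.last k), z' (Fin.last k), fun hc => by rw [hz hc], rfl⟩,
          fun i => z i.castSucc, fun i => z' i.castSucc, fun hc => by rw [hz hc], ?_⟩
        simp only [List.ofFn_succ']
        simp [List.replicate_succ']

/-- Guess two lists of rows that differ in at most one row, which is chosen explicitly; the exit tells
whether a row has been chosen. -/
def guessNeighbors : Bool → Frag Bool :=
  loop (A := Bool) .A (fun used b => match b with
    | none => ret (.inr used)
    | some _ => bind (if used then ret false else guess) fun c => bind (guessRowPair c) fun _ =>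
        bind (move .T .B) fun _ => ret (.inl (used || c)))

end Frag

theorem flatBits_succ {n k : ℕ} (x : Fin (n + 1) → Fin k → Bool) :
    flatBits x = (flatBits fun i : Fin n => x i.castSucc) ++ List.ofFn (x (Fin.last n)) := by
  simp only [flatBits, List.ofFn_succ', List.concat_eq_append, List.flatMap_append,
    List.flatMap_singleton]

theorem eq_iff_init_last {n : ℕ} {α : Type} {x x' : Fin (n + 1) → α} :
    x = x' ↔ (fun i : Fin n => x i.castSucc) = (fun i => x' i.castSucc) ∧
      x (Fin.last n) = x' (Fin.last n) := by
  constructor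
  · rintro rfl
    exact ⟨rfl, rfl⟩
  · rintro ⟨h, h'⟩
    funext i
    exact Fin.lastCases h' (fun i => congrFun h i) i

/-- The position where a difference is allowed is either among the first n or the last one; in the
latter case the last rows are unrestricted. -/
theorem neighboring_succ {n k : ℕ} {x x' : Fin (n + 1) → Fin k → Bool} :
    Neighboring x x' ↔ (x (Fin.last n) = x' (Fin.last n) ∧
        Neighboring (fun i : Fin n => x i.castSucc) fun i => x' i.castSucc) ∨
      (fun i : Fin n => x i.castSucc) = fun i => x' i.castSucc := by
  constructor
  · rintro ⟨i, hi⟩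
    induction i using Fin.lastCases with
    | last => exact .inr (funext fun j => hi _ (Fin.castSucc_lt_last j).ne)
    | cast i =>
      exact .inl ⟨hi _ (Fin.castSucc_lt_last i).ne', i, fun j hj =>
        hi _ fun h => hj (Fin.castSucc_injective _ h)⟩
  · rintro (⟨h, i, hi⟩ | h)
    · refine ⟨i.castSucc, fun j => ?_⟩
      exact Fin.lastCases (fun _ => h) (fun j hj => hi j fun h => hj (congrArg _ h)) j
    · refine ⟨Fin.last n, fun j => ?_⟩
      exact Fin.lastCases (fun h => absurd rfl h) (fun j _ => congrFun h j) j

/-- `x` and `x'` are equal if `used = used'`, and may differ in one position if `used` changes to `true`. -/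
def Differ {n k : ℕ} (used used' : Bool) (x x' : Fin n → Fin k → Bool) : Prop :=
  (used = true → used' = true) ∧ (used = used' → x = x') ∧ (used ≠ used' → Neighboring x x')

/-- The last row is the one guessed first. The bit c says that this row uses up the single permitted
difference; the two rows may still coincide. -/
theorem differ_succ {n k : ℕ} {used used' : Bool} {x x' : Fin (n + 1) → Fin k → Bool} :
    Differ used used' x x' ↔ ∃ c : Bool, (used = true → c = false) ∧
      (c = false → x (Fin.last n) = x' (Fin.last n)) ∧
      Differ (used || c) used' (fun i : Fin n => x i.castSucc) fun i => x' i.castSucc := by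
  cases used <;> cases used' <;>
    simp [Differ, eq_iff_init_last, neighboring_succ, and_comm]

namespace Frag

/-- Started with `false`, the exit `true` is reached exactly with the neighboring pairs, and the
exit `false` exactly with pairs of equal arrays. -/
theorem reach_guessNeighbors {used : Bool} {n k : ℕ} (hA : σ.A = List.replicate n true)
    (hB : σ.B = List.replicate k true) (hT : σ.T = []) :
    (guessNeighbors used).Reach f σ (n * (9 * k + 4) + 1) fun used' σ' =>
      ∃ x x' : Fin n → Fin k → Bool, Differ used used' x x' ∧ σ' = { σ with
        A := [], V := flatBits x ++ σ.V, X := flatBits x ++ σ.X, Y := flatBits x' ++ σ.Y } := by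
  induction n generalizing σ used with
  | zero =>
    refine (det_loop_nil (s := .A) (c := 0) hA (det_done rfl)).reach.congr (by omega) fun used' σ' => ?_
    have e : σ = { σ with A := [] } := by rw [show ([] : List Bool) = σ.A from hA.symm]
    refine ⟨?_, ?_⟩
    · rintro ⟨rfl, rfl⟩
      exact ⟨Fin.elim0, Fin.elim0, ⟨id, fun _ => rfl, fun h => absurd rfl h⟩, by
        simpa [flatBits] using e⟩
    · rintro ⟨x, x', ⟨-, -, h⟩, rfl⟩
      refine ⟨?_, by simpa [flatBits] using e.symm⟩
      -- Without rows there is no position, so no two arrays are neighboring and the flag cannot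
      -- have changed.
      by_contra h'
      exact (h (Ne.symm h')).choose.elim0
  | succ n ih =>
    refine (reach_loop_cons (s := .A) (hA.trans List.replicate_succ)
      (R := fun used' σ' => ∃ c : Bool, (used = true → c = false) ∧ used' = (used || c) ∧
        ∃ z z' : Fin k → Bool, (c = false → z = z') ∧ σ' = { σ with
        A := List.replicate n true, V := List.ofFn z ++ σ.V, X := List.ofFn z ++ σ.X,
        Y := List.ofFn z' ++ σ.Y })
      (c := (2 * k + 1 + (7 * k + 1)) + 1) ?_ fun used' σ' h => ih (σ := σ') ?_ ?_ ?_).congr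
        (by rw [add_mul n 1]; omega) fun used' σ' => ?_
    · have h1 : (if used then ret false else guess).Reach f (σ.set .A (List.replicate n true)) 1
          fun c σ' => (used = true → c = false) ∧ σ' = σ.set .A (List.replicate n true) := by
        cases used with
        | false => exact reach_guess.congr le_rfl (by simp)
        | true => exact (det_ret _).reach.congr (by omega) (by simp)
      refine (h1.bind (R' := fun c _ x σ'' => x = .inl (used || c) ∧
        ∃ z z' : Fin k → Bool, (c = false → z = z') ∧ σ'' = { σ with
          A := List.replicate n true, V := List.ofFn z ++ σ.V, X := List.ofFn z ++ σ.X,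
          Y := List.ofFn z' ++ σ.Y }) fun c σ' h => ?_).congr le_rfl fun x σ' => ?_
      · obtain ⟨hc, rfl⟩ := h
        refine ((reach_guessRowPair (σ := { σ with A := List.replicate n true }) (c := c) (k := k)
          hB).bind (c' := 2 * k + 1)
          (R' := fun _ σ' x σ'' => x = Sum.inl (used || c) ∧ σ'' = { σ' with B := σ.B, T := [] })
          fun _ σ' h => ?_).congr le_rfl fun x σ' => ?_
        · obtain ⟨z, z', h, rfl⟩ := h
          have h2 : ((move .T .B).bind fun _ => ret (E := Bool ⊕ Bool) (.inl (used || c))).Det f { σ with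
              A := List.replicate n true, B := [], T := List.replicate k true ++ σ.T,
              V := List.ofFn z ++ σ.V, X := List.ofFn z ++ σ.X, Y := List.ofFn z' ++ σ.Y }
              (.inl (used || c)) { σ with
              A := List.replicate n true, B := σ.B, T := [], V := List.ofFn z ++ σ.V,
              X := List.ofFn z ++ σ.X, Y := List.ofFn z' ++ σ.Y } (2 * k + 1) :=
            (det_move (by decide)).step (by simp [Store.get, hT])
              (det_done (by simp [Store.get, hT, hB]))
          exact h2.reach
        · constructor
          · rintro ⟨_, _, ⟨z, z', h, rfl⟩, rfl, rfl⟩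
            refine ⟨rfl, z, z', h, ?_⟩
            ext1 <;> simp [hT]
          · rintro ⟨rfl, z, z', h, rfl⟩
            refine ⟨(), _, ⟨z, z', h, rfl⟩, rfl, ?_⟩
            ext1 <;> simp [hT]
      · constructor
        · rintro ⟨c, _, ⟨h, rfl⟩, rfl, z, z', h', rfl⟩
          exact ⟨_, rfl, c, h, rfl, z, z', h', rfl⟩
        · rintro ⟨_, rfl, c, h, rfl, z, z', h', rfl⟩
          exact ⟨c, _, ⟨h, rfl⟩, rfl, z, z', h', rfl⟩
    · obtain ⟨c, -, -, z, z', -, rfl⟩ := h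
      rfl
    · obtain ⟨c, -, -, z, z', -, rfl⟩ := h
      exact hB
    · obtain ⟨c, -, -, z, z', -, rfl⟩ := h
      exact hT
    · constructor
      · rintro ⟨_, _, ⟨c, hc, rfl, z, z', hz, rfl⟩, x, x', hx, rfl⟩
        refine ⟨Fin.snoc x z, Fin.snoc x' z', differ_succ.mpr ⟨c, hc, ?_, ?_⟩, ?_⟩
        · simpa using hz
        · simpa using hx
        · simp [flatBits_succ]
      · rintro ⟨x, x', hx, rfl⟩
        obtain ⟨c, hc, hz, hx⟩ := differ_succ.mp hx
        refine ⟨_, _, ⟨c, hc, rfl, _, _, hz, rfl⟩, _, _, hx, ?_⟩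
        simp [flatBits_succ]

/-- Push a zero on `V` for each bit on `B`, and move `B` to `P`. -/
def pushZeros : Frag Unit :=
  loop (A := Unit) .B (fun _ b => match b with
    | none => ret (.inr ())
    | some _ => bind (push .V false) fun _ => bind (push .P true) fun _ => ret (.inl ())) ()

/-- The refuting machine reads the circuit only to check its code, so zeros can stand in for the
random bits: only the length of `V` matters. The unary m is kept on `P` for the factor 2^m. -/
theorem det_pushZeros {m : ℕ} (hB : σ.B = List.replicate m true) :
    pushZeros.Det f σ () { σ with
      B := [], V := List.replicate m false ++ σ.V, P := List.replicate m true ++ σ.P }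
      (3 * m + 1) := by
  induction m generalizing σ with
  | zero =>
    refine (det_loop_nil (s := .B) (c := 0) hB (det_done ?_)).mono (by simp)
    ext1 <;> simp [hB]
  | succ m ih =>
    have h1 := ih (σ := { σ with
      B := List.replicate m true, V := false :: σ.V, P := true :: σ.P }) rfl
    refine (det_loop_cons (s := .B) (c := 2) (hB.trans List.replicate_succ) ?_ h1).congr
      (by simp [List.replicate_succ']) |>.mono (by omega)
    exact det_push_bind (by omega) (det_push_bind (by omega) (det_done (by simp [Store.get])))

/-- Move the stack `I` to `R`, and pop as many bits from `T`. -/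
def dropRest : Frag Unit :=
  loop (A := Unit) .I (fun _ b => match b with
    | none => ret (.inr ())
    | some b => bind (push .R b) fun _ => bind (pop .T) fun _ => ret (.inl ())) ()

theorem det_dropRest {l t : List Bool} (hT : σ.T = l ++ t) (hl : l.length = σ.I.length) :
    dropRest.Det f σ () { σ with I := [], R := σ.I.reverse ++ σ.R, T := t } (3 * σ.I.length + 1) := by
  generalize hI : σ.I = i at *
  induction i generalizing σ l with
  | nil =>
    obtain rfl := List.eq_nil_of_length_eq_zero hl
    refine (det_loop_nil (s := .I) (c := 0) hI (det_done ?_)).mono (by simp)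
    ext1 <;> simp [hI, hT]
  | cons b i ih =>
    obtain ⟨c, l, rfl⟩ := List.exists_cons_of_length_eq_add_one hl
    have h1 := ih (σ := { σ with I := i, R := b :: σ.R, T := l ++ t }) rfl rfl (by simpa using hl)
    refine (det_loop_cons (s := .I) (c := 2) hI ?_ h1).congr (by simp) |>.mono
      (by simp only [List.length_cons]; omega)
    exact det_push_bind (by omega) (det_pop_cons_bind (s := .T) (b := c) (l := l ++ t)
      (by simp [Store.get, hT]) (by omega) (det_done (by simp [Store.get])))

/-- With an input on `R` and the rest of it on `I`: move the part that has been read to `T`, in reverse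
order. -/
def splitInput : Frag Unit :=
  bind (move .R .T) fun _ => bind dropRest fun _ => move .R .I

/-- The oracle query starts with the part of the input that has been read. This part is recovered
from the reversed full copy by dropping one bit for each unread one. -/
theorem det_splitInput {p : List Bool} (hR : σ.R = p ++ σ.I) (hT : σ.T = []) :
    splitInput.Det f σ () { σ with T := p.reverse, R := [] } (7 * σ.R.length + 3) := by
  have l := congrArg List.length hR
  rw [List.length_append] at l
  have h1 := (det_move (f := f) (σ := σ) (s := .R) (t := .T) (by decide)).congr (σ'' := { σ with
    T := σ.I.reverse ++ p.reverse, R := [] }) (by simp [Store.get, hR, hT])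
  have h2 := det_dropRest (f := f) (σ := { σ with T := σ.I.reverse ++ p.reverse, R := [] })
    (l := σ.I.reverse) (t := p.reverse) rfl (by simp)
  have h3 := (det_move (f := f) (σ := { σ with I := [], T := p.reverse, R := σ.I.reverse }) (s := .R)
    (t := .I) (by decide)).congr (σ'' := { σ with T := p.reverse, R := [] }) (by simp [Store.get])
  exact h1.step (by dsimp only [Store.get]; omega) ((h2.congr (by simp)).step
    (by dsimp only [Store.get]; omega) (h3.mono (by simp [Store.get]; omega)))

/-- Write the query that consists of the reverse of `T` and the codes of `X` and `Y`. -/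
def writeQuery : Frag Unit :=
  bind (move .T .R) fun _ => bind (push .Q false) fun _ => bind (move .Y .T) fun _ =>
  bind encodeToQuery fun _ => bind (push .Q false) fun _ => bind (move .X .T) fun _ =>
  bind encodeToQuery fun _ => bind (move .R .T) fun _ => move .T .Q

theorem det_writeQuery {p : List Bool} (hT : σ.T = p.reverse) (hQ : σ.Q = []) (hR : σ.R = []) :
    writeQuery.Det f σ () { σ with
      T := [], X := [], Y := [], R := [], Q := p ++ (encodeBits σ.X ++ encodeBits σ.Y) }
      (6 * p.length + 5 * σ.X.length + 5 * σ.Y.length + 9) := by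
  refine Det.step (((det_move (by decide)).congr (σ'' := { σ with T := [], R := p })
    (by simp [Store.get, hT, hR])).mono (c' := 2 * p.length + 1) (by simp [Store.get, hT])) (by omega) ?_
  refine det_push_bind (by omega) ?_
  refine Det.step (((det_move (by decide)).congr (σ'' := { σ with
    T := σ.Y.reverse, Y := [], R := p, Q := encodeBits [] })
    (by simp [Store.get, hQ, encodeList_nil])).mono (c' := 2 * σ.Y.length + 1)
    (by simp [Store.get])) (by omega) ?_
  refine Det.step (((det_encodeToQuery (o := []) (w := []) (by simp)).congr (σ'' := { σ with
    T := [], Y := [], R := p, Q := encodeBits σ.Y }) (by simp)).mono (c' := 3 * σ.Y.length + 1)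
    (by simp)) (by omega) ?_
  refine det_push_bind (by omega) ?_
  refine Det.step (((det_move (by decide)).congr (σ'' := { σ with
    T := σ.X.reverse, X := [], Y := [], R := p, Q := encodeBits [] ++ encodeBits σ.Y })
    (by simp [Store.get, encodeList_nil])).mono (c' := 2 * σ.X.length + 1)
    (by simp [Store.get])) (by omega) ?_
  refine Det.step (((det_encodeToQuery (o := []) (w := encodeBits σ.Y) rfl).congr (σ'' := { σ with
    T := [], X := [], Y := [], R := p, Q := encodeBits σ.X ++ encodeBits σ.Y }) (by simp)).mono
    (c' := 3 * σ.X.length + 1) (by simp)) (by omega) ?_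
  refine Det.step (((det_move (by decide)).congr (σ'' := { σ with
    T := p.reverse, X := [], Y := [], R := [], Q := encodeBits σ.X ++ encodeBits σ.Y })
    (by simp [Store.get])).mono (c' := 2 * p.length + 1) (by simp [Store.get])) (by omega) ?_
  exact (((det_move (by decide)).congr (by simp [Store.get])).mono (c' := 2 * p.length + 1)
    (by simp [Store.get])).mono (by omega)

/-- Push a zero on `R` for each bit on `P`. -/
def shift : Frag Unit :=
  loop (A := Unit) .P (fun _ b => match b with
    | none => ret (.inr ())
    | some _ => bind (push .R false) fun _ => ret (.inl ())) ()

theorem det_shift {m : ℕ} (hP : σ.P = List.replicate m true) :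
    shift.Det f σ () { σ with P := [], R := List.replicate m false ++ σ.R } (2 * m + 1) := by
  induction m generalizing σ with
  | zero =>
    refine (det_loop_nil (s := .P) (c := 0) hP (det_done ?_)).mono (by simp)
    ext1 <;> simp [hP]
  | succ m ih =>
    have h1 := ih (σ := { σ with P := List.replicate m true, R := false :: σ.R }) rfl
    refine (det_loop_cons (s := .P) (c := 1) (hP.trans List.replicate_succ) ?_ h1).congr
      (by simp [List.replicate_succ']) |>.mono (by omega)
    exact det_push_bind (by omega) (det_done (by simp [Store.get]))

/-- Count up to the difference between the product of `R` and `S`, and the product of `D`, `W` and a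
power of two. -/
def compareProducts : Frag Bool :=
  bind mul fun _ => bind (move .R .U) fun _ => bind (move .D .R) fun _ => bind shift fun _ =>
  bind (move .I .T) fun _ => bind (move .T .D) fun _ => bind (move .W .T) fun _ =>
  bind (move .T .S) fun _ => bind mul fun _ => guessBetween .D .I

/-- `guessBetween` has a path to acceptance exactly if the truncated difference of the two products
is positive, so it serves as a strict comparison. -/
theorem accepts_compareProducts {G d v e : List Bool} {m s L t : ℕ} (hI : σ.I = []) (hT : σ.T = [])
    (hX : σ.X = []) (hY : σ.Y = []) (hR : σ.R = G) (hS : σ.S = e.reverse) (hD : σ.D = d.reverse)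
    (hW : σ.W = v.reverse) (hP : σ.P = List.replicate m true)
    (hs : m + d.length + v.length + e.length ≤ s) (hG : G.length ≤ L)
    (ht : 60 * (s + 1) * (L + s + 1) ≤ t) :
    compareProducts.Accepts f σ t (binVal d * binVal v * 2 ^ m < binVal G * binVal e) := by
  have hmul : ∀ a b : ℕ, a ≤ s → b ≤ L + 2 * s →
      (a + 1) * (8 * b + 9) ≤ 16 * ((s + 1) * (L + s + 1)) := fun a b ha hb =>
    (Nat.mul_le_mul (show a + 1 ≤ s + 1 by omega)
      (show 8 * b + 9 ≤ 16 * (L + s + 1) by omega)).trans (by ring_nf; rfl)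
  have e1 : 60 * (s + 1) * (L + s + 1) = 60 * ((s + 1) * (L + s + 1)) := by ring
  have e2 : L + s + 1 ≤ (s + 1) * (L + s + 1) := Nat.le_mul_of_pos_left _ (by omega)
  obtain ⟨L₁, hL₁, hL₁', h1⟩ := det_mul (f := f) (M := L + 2 * s) hX hY
    (by rw [hR, hS, List.length_reverse]; omega)
    (by rw [hI, hS, List.length_reverse, List.length_nil]; omega)
  rw [hI, hS, hR, List.reverse_reverse] at hL₁
  rw [hS, List.length_reverse] at h1
  have a1 := hmul e.length (L + 2 * s) (by omega) le_rfl
  refine h1.counts_bind (by omega) ?_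
  refine Det.counts_bind (((det_move (by decide)).congr (σ'' := { σ with
    I := L₁, S := [], R := [], U := G.reverse ++ σ.U }) (by simp [Store.get, hR])).mono
    (c' := 2 * L + 1) (by simp [Store.get, hR, hG])) (by omega) ?_
  refine Det.counts_bind (((det_move (by decide)).congr (σ'' := { σ with
    I := L₁, S := [], R := d, D := [], U := G.reverse ++ σ.U }) (by simp [Store.get, hD])).mono
    (c' := 2 * s + 1) (by simp [Store.get, hD]; omega)) (by omega) ?_
  refine Det.counts_bind (((det_shift (σ := { σ with
    I := L₁, S := [], R := d, D := [], U := G.reverse ++ σ.U }) hP).congr (σ'' := { σ with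
    I := L₁, S := [], R := List.replicate m false ++ d, D := [], U := G.reverse ++ σ.U, P := [] })
    (by simp)).mono (c' := 2 * s + 1) (by omega)) (by omega) ?_
  refine Det.counts_bind (((det_move (by decide)).congr (σ'' := { σ with
    I := [], T := L₁.reverse, S := [], R := List.replicate m false ++ d, D := [],
    U := G.reverse ++ σ.U, P := [] }) (by simp [Store.get, hT])).mono (c' := 2 * (L + 2 * s) + 1)
    (by simpa [Store.get] using hL₁')) (by omega) ?_
  refine Det.counts_bind (((det_move (by decide)).congr (σ'' := { σ with
    I := [], T := [], S := [], R := List.replicate m false ++ d, D := L₁,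
    U := G.reverse ++ σ.U, P := [] }) (by simp [Store.get])).mono (c' := 2 * (L + 2 * s) + 1)
    (by simpa [Store.get] using hL₁')) (by omega) ?_
  refine Det.counts_bind (((det_move (by decide)).congr (σ'' := { σ with
    I := [], T := v, S := [], R := List.replicate m false ++ d, D := L₁, W := [],
    U := G.reverse ++ σ.U, P := [] }) (by simp [Store.get, hW])).mono (c' := 2 * s + 1)
    (by simp [Store.get, hW]; omega)) (by omega) ?_
  refine Det.counts_bind (((det_move (by decide)).congr (σ'' := { σ with
    I := [], T := [], S := v.reverse, R := List.replicate m false ++ d, D := L₁, W := [],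
    U := G.reverse ++ σ.U, P := [] }) (by simp [Store.get])).mono (c' := 2 * s + 1)
    (by simp [Store.get]; omega)) (by omega) ?_
  obtain ⟨L₂, hL₂, hL₂', h2⟩ := det_mul (f := f) (M := 2 * s) (σ := { σ with
    I := [], T := [], S := v.reverse, R := List.replicate m false ++ d, D := L₁, W := [],
    U := G.reverse ++ σ.U, P := [] }) hX hY (by simp; omega) (by simp; omega)
  have a2 := hmul v.length (2 * s) (by omega) (by omega)
  refine h2.counts_bind (by simp only [List.length_reverse]; omega) ?_
  refine ⟨_, (runs_guessBetween (n := L + 2 * s) (s := .D) (t := .I) (by decide) hL₁'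
    (by dsimp only [Store.get]; omega)).mono ?_, ?_⟩
  · simp only [List.length_reverse]; omega
  · dsimp only [Store.get]
    rw [hL₁, hL₂]
    simp only [binVal, binVal_append, List.reverse_reverse, binVal_replicate_false,
      List.length_replicate]
    rw [Nat.sub_pos_iff_lt]
    ring_nf

/-- With two inputs on `X` and `Y` and the gates, the outputs and four numbers on `I`: look for an error
in the code on `I`, or else compare the value of the oracle with the numbers. -/
def checkBody (used : Bool) : Frag Bool :=
  guard true readBody <| guard true (readNumber .U (· == some true)) <|
  guard true (readNumber .W (· == some true)) <| bind splitInput fun _ =>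
  guard true (readNumber .D (· != some false)) <| guard true (readNumber .S (· == some true)) <|
  bind (pop .I) fun b => match b with
  | some _ => ret true
  | none => match used with
    | false => ret false
    | true => bind writeQuery fun _ => bind query fun _ => compareProducts

/-- With `M` = (s + 1)², reading the body costs O(s·M) steps; query, products and comparison stay
below (s + 1)·M·(L + 1) up to a constant, where `L` bounds the length of the answer. -/
theorem accepts_checkBody {used : Bool} {p rest x x' V B : List Bool} {m s L t : ℕ}
    (hσ : σ = { initStore rest with
      R := p ++ rest, V := V, B := B, P := List.replicate m true, X := x, Y := x' })
    (hs : m + rest.length ≤ s) (hp : p.length + rest.length ≤ s)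
    (hV : V.length + s ≤ (s + 1) ^ 2) (hx : x.length ≤ (s + 1) ^ 2) (hx' : x'.length ≤ (s + 1) ^ 2)
    (hL : ∀ q, q.length ≤ s + x.length * 2 + x'.length * 2 + 2 → (f q).bits.length ≤ L)
    (ht : 300 * ((s + 1) ^ 3 * (L + 1)) ≤ t) :
    (checkBody used).Accepts f σ t
      (∀ c r₁, rest = encodeBody c ++ r₁ → BodyWf V.length c →
        ∀ u r₂, r₁ = encodeBits u ++ r₂ → (u.getLast? == some true) = true →
        ∀ v r₃, r₂ = encodeBits v ++ r₃ → (v.getLast? == some true) = true →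
        ∀ d r₄, r₃ = encodeBits d ++ r₄ → (d.getLast? != some false) = true →
        ∀ e r₅, r₄ = encodeBits e ++ r₅ → (e.getLast? == some true) = true → r₅ = [] →
          used = true ∧ binVal d * binVal v * 2 ^ m < f (p ++ (encodeBody c ++ (encodeBits u ++
            (encodeBits v ++ (encodeBits x ++ encodeBits x'))))) * binVal e) := by
  obtain ⟨M, hM⟩ : ∃ M, M = (s + 1) ^ 2 := ⟨_, rfl⟩
  rw [← hM] at hV hx hx'
  have b1 : (s + 1) ^ 3 * (L + 1) = (s + 1) * M * (L + 1) := by rw [hM]; ring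
  have b2 : (s + 1) * M ≤ (s + 1) * M * (L + 1) := Nat.le_mul_of_pos_right _ (by omega)
  have b3 : M ≤ (s + 1) * M := Nat.le_mul_of_pos_left _ (by omega)
  have b4 : s + 1 ≤ M := by rw [hM]; nlinarith
  have b5 : (s + 1) * (L + s + 1) ≤ (s + 1) * M * (L + 1) := by
    rw [mul_assoc]
    exact Nat.mul_le_mul_left _ (by nlinarith)
  have b6 : 60 * (s + 1) * (L + s + 1) = 60 * ((s + 1) * (L + s + 1)) := by ring
  have b7 : (rest.length + 1) * (19 * M + 27) ≤ 46 * ((s + 1) * M) :=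
    (Nat.mul_le_mul (show rest.length + 1 ≤ s + 1 by omega)
      (show 19 * M + 27 ≤ 46 * M by omega)).trans (by ring_nf; rfl)
  subst hσ
  refine Accepts.congr (Accepts.guard_decode prefixFree_encodeBody
    (c := (rest.length + 1) * (19 * M + 27)) (ok := BodyWf V.length) (by omega)
    (fun c r h hc => det_readBody h hc rfl (by dsimp only [initStore]; omega))
    (fun h => det_readBody_fail h rfl (by dsimp only [initStore]; omega)) fun c r₁ h1 hc =>
    accepts_guard_readNumber (by decide) ?_ fun u r₂ h2 hu =>
    accepts_guard_readNumber (by decide) ?_ fun v r₃ h3 hv => ?_) Iff.rfl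
  all_goals
    dsimp only [initStore, Store.set, Store.get] at *
    have l1 := congrArg List.length h1
    simp only [List.length_append] at l1
  · omega
  all_goals
    have l2 := congrArg List.length h2
    rw [List.length_append, length_encodeBits] at l2
  · omega
  have l3 := congrArg List.length h3
  rw [List.length_append, length_encodeBits] at l3
  refine Det.counts_bind ((det_splitInput (p := p ++ (encodeBody c ++ (encodeBits u ++ encodeBits v)))
    (by rw [h1, h2, h3]; simp [List.append_assoc]) rfl).mono (c' := 7 * s + 3)
    (by simp; omega)) (by omega) ?_
  refine Accepts.congr (accepts_guard_readNumber (by decide) ?_ fun d r₄ h4 hd =>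
    accepts_guard_readNumber (by decide) ?_ fun e r₅ h5 he => ?_) Iff.rfl
  all_goals
    dsimp only [Store.set, Store.get] at *
  · omega
  all_goals
    have l4 := congrArg List.length h4
    rw [List.length_append, length_encodeBits] at l4
  · omega
  have l5 := congrArg List.length h5
  rw [List.length_append, length_encodeBits] at l5
  cases r₅ with
  -- Bits after the last number: the word is not a code, and it is accepted.
  | cons b r =>
    refine Accepts.congr (P := true = true) (Det.counts_bind (det_pop_cons (s := .I) rfl) (by omega)
      (accepts_ret true _)) (by simp)
  | nil =>
    refine Det.counts_bind (det_pop_nil (s := .I) rfl) (by omega) ?_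
    cases used with
    -- A correct code, but no position was chosen, so the pair of inputs is no evidence against
    -- privacy.
    | false => exact Accepts.congr (accepts_ret false _) (by simp)
    | true =>
      refine Det.counts_bind ((det_writeQuery rfl rfl rfl).mono (c' := 6 * s + 10 * M + 9) ?_)
        (by omega) (det_query.counts_bind (by omega) ?_)
      · simp only [List.length_append, length_encodeBits]
        omega
      dsimp only
      have hq : (f (p ++ (encodeBody c ++ (encodeBits u ++ encodeBits v)) ++
          (encodeBits x ++ encodeBits x'))).bits.length ≤ L := hL _ (by
        simp only [List.length_append, length_encodeBits]
        omega)
      refine (accepts_compareProducts (d := d) (v := v) (e := e) (m := m) (s := s) rfl rfl rfl rfl rfl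
        (by simp) (by simp) (by simp) rfl (by omega) hq (by omega)).congr ?_
      rw [binVal_bits]
      simp [List.append_assoc]

/-- Look for two neighboring inputs that refute the differential privacy of a circuit, or for an error in
the code of the instance. -/
def refute : Frag Bool :=
  bind (move .I .T) fun _ => bind (copy .I .R) fun _ => guard true readDims <|
  bind pushZeros fun _ => bind (move .C .B) fun _ => bind (guessNeighbors false) checkBody

theorem length_flatBits {n k : ℕ} (x : Fin n → Fin k → Bool) : (flatBits x).length = n * k := by
  simp [flatBits, List.length_flatMap, Function.comp_def]

/-- A query consists of a prefix of the input and two codes of n·k bits, with length 2n·k + 1 each.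
Since n·k ≤ |w|², it is at most 5(|w| + 1)² bits long. -/
theorem accepts_refute {w : List Bool} {L t : ℕ}
    (hL : ∀ q, q.length ≤ 5 * (w.length + 1) ^ 2 → (f q).bits.length ≤ L)
    (ht : 400 * ((w.length + 1) ^ 3 * (L + 1)) ≤ t) :
    refute.Accepts f (initStore w) t
      (∀ D rest, w = encodeDims D ++ rest → True →
        ∃ (used : Bool) (x x' : Fin D.1 → Fin D.2.1 → Bool), Differ false used x x' ∧
        ∀ c r₁, rest = encodeBody c ++ r₁ → BodyWf (D.1 * D.2.1 + D.2.2) c →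
        ∀ u r₂, r₁ = encodeBits u ++ r₂ → (u.getLast? == some true) = true →
        ∀ v r₃, r₂ = encodeBits v ++ r₃ → (v.getLast? == some true) = true →
        ∀ d r₄, r₃ = encodeBits d ++ r₄ → (d.getLast? != some false) = true →
        ∀ e r₅, r₄ = encodeBits e ++ r₅ → (e.getLast? == some true) = true → r₅ = [] →
          used = true ∧ binVal d * binVal v * 2 ^ D.2.2 < f (encodeDims D ++ (encodeBody c ++
            (encodeBits u ++ (encodeBits v ++ (encodeBits (flatBits x) ++
              encodeBits (flatBits x')))))) * binVal e) := by
  obtain ⟨s, hs⟩ : ∃ s, s = w.length := ⟨_, rfl⟩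
  rw [← hs] at hL ht
  have b1 : (s + 1) ^ 3 ≤ (s + 1) ^ 3 * (L + 1) := Nat.le_mul_of_pos_right _ (by omega)
  have b2 : (s + 1) ^ 2 ≤ (s + 1) ^ 3 := Nat.pow_le_pow_right (by omega) (by omega)
  have b3 : s * s + 2 * s + 1 = (s + 1) ^ 2 := by ring
  refine Det.counts_bind (((det_move (by decide)).congr (σ'' := { initStore [] with T := w.reverse })
    (by simp [Store.get, initStore])).mono (c' := 2 * s + 1) (by simp [Store.get, initStore, hs]))
    (by omega) ?_
  refine Det.counts_bind (((det_copy (by decide) (by decide) (by decide)).congr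
    (σ'' := { initStore w with R := w }) (by simp [Store.get, initStore])).mono
    (c' := 3 * s + 1) (by simp [hs])) (by omega) ?_
  refine Accepts.guard_decode prefixFree_encodeDims (c := 6 * s + 3) (by omega)
    (σ' := fun D rest => { initStore rest with
      R := w, A := List.replicate D.1 true, B := List.replicate D.2.2 true,
      C := List.replicate D.2.1 true })
    (fun D rest h _ => (det_readDims h rfl rfl rfl).mono (by dsimp only [initStore]; omega))
    (fun h => ?_) fun D rest h _ => ?_
  · obtain ⟨σ', h'⟩ := det_readDims_fail (f := f) (σ := { initStore w with R := w })
      (by simpa using h)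
    exact ⟨σ', h'.mono (by dsimp only [initStore]; omega)⟩
  · obtain ⟨n, k, m⟩ := D
    have l := congrArg List.length h
    simp only [initStore, List.length_append, length_encodeUnary] at l
    have hnk : n * k ≤ s * s := Nat.mul_le_mul (by omega) (by omega)
    dsimp only
    refine Det.counts_bind (((det_pushZeros rfl).congr (σ'' := { initStore rest with
      R := w, A := List.replicate n true, C := List.replicate k true, V := List.replicate m false,
      P := List.replicate m true }) (by simp [initStore])).mono (c' := 3 * s + 1) (by omega))
      (by omega) ?_
    refine Det.counts_bind (((det_move (by decide)).congr (σ'' := { initStore rest with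
      R := w, A := List.replicate n true, B := List.replicate k true, V := List.replicate m false,
      P := List.replicate m true }) (by simp [initStore, Store.get])).mono (c' := 2 * s + 1)
      (by simp [Store.get]; omega)) (by omega) ?_
    have hc : n * (9 * k + 4) + 1 ≤ 9 * (s * s) + 4 * s + 1 := by
      rw [show n * (9 * k + 4) = 9 * (n * k) + 4 * n by ring]
      omega
    refine Accepts.congr (((reach_guessNeighbors (k := k) rfl rfl rfl).congr hc
      fun _ _ => Iff.rfl).accepts_bind (by omega) (P := fun used σ' =>
        ∀ c r₁, rest = encodeBody c ++ r₁ → BodyWf (n * k + m) c →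
        ∀ u r₂, r₁ = encodeBits u ++ r₂ → (u.getLast? == some true) = true →
        ∀ v r₃, r₂ = encodeBits v ++ r₃ → (v.getLast? == some true) = true →
        ∀ d r₄, r₃ = encodeBits d ++ r₄ → (d.getLast? != some false) = true →
        ∀ e r₅, r₄ = encodeBits e ++ r₅ → (e.getLast? == some true) = true → r₅ = [] →
          used = true ∧ binVal d * binVal v * 2 ^ m < f (encodeDims (n, k, m) ++ (encodeBody c ++
            (encodeBits u ++ (encodeBits v ++ (encodeBits σ'.X ++ encodeBits σ'.Y))))) * binVal e)
      fun used σ' h' => ?_) ⟨?_, ?_⟩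
    · obtain ⟨x, x', -, rfl⟩ := h'
      have hV : (flatBits x ++ List.replicate m false).length = n * k + m := by simp [length_flatBits]
      have lx := length_flatBits x
      have lx' := length_flatBits x'
      rw [← hV]
      refine Accepts.congr (accepts_checkBody (p := encodeDims (n, k, m)) (rest := rest) (m := m)
        (s := s) (x := flatBits x) (x' := flatBits x') (V := flatBits x ++ List.replicate m false)
        (B := List.replicate k true) (L := L) ?_ (by omega) ?_ (by omega) (by omega) (by omega)
        (fun q hq => hL q (by omega)) (by omega)) ?_
      · rw [show w = encodeDims (n, k, m) ++ rest from h]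
        simp [initStore]
      · simp only [encodeDims, List.length_append, length_encodeUnary]; omega
      · simp [initStore]
    · rintro ⟨used, _, ⟨x, x', hx, rfl⟩, h'⟩
      exact ⟨used, x, x', hx, by simpa [initStore] using h'⟩
    · rintro ⟨used, x, x', hx, h'⟩
      exact ⟨used, _, ⟨x, x', hx, rfl⟩, by simpa [initStore] using h'⟩

end Frag

/-! ### Circuits and their codes -/

theorem gatesWf_iff {b : ℕ} {gs : List Gate} :
    GatesWf b gs ↔ ∀ (i : ℕ) (hi : i < gs.length), ∀ a ∈ gs[i].preds, a < b + i := by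
  induction gs generalizing b with
  | nil => simp [GatesWf]
  | cons g gs ih =>
    rw [GatesWf, ih]
    constructor
    · rintro ⟨h, h'⟩ (_ | i) hi a ha
      · exact h a ha
      · have := h' i (by simpa using hi) a ha
        omega
    · intro h
      refine ⟨fun a ha => h 0 (by simp) a ha, fun i hi a ha => ?_⟩
      have := h (i + 1) (by simpa using hi) a ha
      omega

variable {n k ℓ m : ℕ}

/-- The gates and the outputs of a circuit. -/
def RandCircuit.body (ψ : RandCircuit n k ℓ m) : List Gate × List ℕ :=
  (ψ.gates, List.ofFn ψ.outputs)

theorem RandCircuit.bodyWf (ψ : RandCircuit n k ℓ m) : BodyWf (n * k + m) ψ.body := by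
  refine ⟨gatesWf_iff.mpr ψ.gates_wf, fun j hj => ?_⟩
  obtain ⟨i, rfl⟩ := List.mem_ofFn.mp hj
  exact ψ.outputs_wf i

/-- The circuit with given gates and outputs. -/
def RandCircuit.ofBody (c : List Gate × List ℕ) (hc : BodyWf (n * k + m) c) :
    RandCircuit n k c.2.length m where
  gates := c.1
  outputs := c.2.get
  gates_wf := gatesWf_iff.mp hc.1
  outputs_wf _ := hc.2 _ (List.get_mem _ _)

theorem RandCircuit.body_ofBody (c : List Gate × List ℕ) (hc : BodyWf (n * k + m) c) :
    (ofBody c hc).body = c :=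
  Prod.ext rfl (List.ofFn_get _)

theorem RandCircuit.evalBody_body (ψ : RandCircuit n k ℓ m) (x : Fin n → Fin k → Bool)
    (r : Fin m → Bool) : evalBody ψ.body (flatBits x ++ List.ofFn r) = List.ofFn (ψ.eval x r) := by
  simp only [evalBody, body, List.map_ofFn]
  rfl

theorem encodeCircuit_eq (ψ : RandCircuit n k ℓ m) :
    encodeCircuit ψ = encodeDims (n, k, m) ++ encodeBody ψ.body := by
  simp [encodeCircuit, encodeDims, encodeBody, RandCircuit.body, List.append_assoc]

theorem encodeWithInputs_eq (ψ : RandCircuit n k ℓ m) (u v : ℕ) (x x' : Fin n → Fin k → Bool) :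
    encodeWithInputs ψ u v x x' = encodeDims (n, k, m) ++ (encodeBody ψ.body ++
      (encodeBits u.bits ++ (encodeBits v.bits ++ (encodeBits (flatBits x) ++
        encodeBits (flatBits x'))))) := by
  simp only [encodeWithInputs, encodeCircuit_eq, encodeBinary, List.append_assoc]

/-- Up to v this agrees with `encodeWithInputs_eq`, which is why the query can begin with a copy of
the input. -/
theorem DPInstance.encode_eq (I : DPInstance) :
    I.encode = encodeDims (I.n, I.k, I.m) ++ (encodeBody I.ψ.body ++
      (encodeBits I.u.bits ++ (encodeBits I.v.bits ++ (encodeBits I.d.bits ++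
        encodeBits I.e.bits)))) := by
  simp only [encode, encodeCircuit_eq, encodeBinary, List.append_assoc]

/-! ### Counting -/

/-- The number of random bit strings for which a circuit has a given output. -/
noncomputable def RandCircuit.count (ψ : RandCircuit n k ℓ m) (x : Fin n → Fin k → Bool)
    (o : Fin ℓ → Bool) : ℕ :=
  {r : Fin m → Bool | ψ.eval x r = o}.ncard

/-- Of all guesses for the input only the right one survives the comparison, so guessing the input
does not change the count. -/
theorem sum_bitLists_eq {N a : ℕ} {x : List Bool} (hx : x.length = N) (P : List Bool → Prop)
    [DecidablePred P] :
    ((bitLists N).map fun y => if P y then if y = x then a else 0 else 0).sum =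
      if P x then a else 0 := by
  subst hx
  rw [sum_bitLists]
  have h : ∀ z : Fin x.length → Bool, (if P (List.ofFn z) then if List.ofFn z = x then a else 0 else 0) =
      if z = x.get then if P x then a else 0 else 0 := by
    intro z
    by_cases hz : z = x.get
    · simp [hz]
    · have : List.ofFn z ≠ x := fun h => hz (List.ofFn_injective (h.trans (List.ofFn_get x).symm))
      simp [hz, this]
  rw [Finset.sum_congr rfl fun z _ => h z]
  simp

theorem outputSum_eq (ψ : RandCircuit n k ℓ m) (u v : ℕ) (x x' : Fin n → Fin k → Bool) (b : Bool)
    (o : List Bool) :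
    Frag.outputSum b o (n, k, m) ψ.body u.bits v.bits (flatBits x) (flatBits x') =
      ∑ r : Fin m → Bool, if List.ofFn (ψ.eval (if b then x else x') r) = o then
        if b then v else u else 0 := by
  have h : (if b then flatBits x else flatBits x') = flatBits (if b then x else x') := by
    cases b <;> rfl
  have h' : binVal (if b then v.bits else u.bits) = if b then v else u := by
    cases b <;> exact binVal_bits _
  rw [Frag.outputSum, sum_bitLists]
  refine Finset.sum_congr rfl fun r _ => ?_
  rw [sum_bitLists_eq (by rw [h, Frag.length_flatBits])
    (fun y => (evalBody ψ.body (y ++ List.ofFn r)).reverse = o.reverse), h, h', ψ.evalBody_body]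
  simp only [List.reverse_inj]

theorem outputSum_ofFn (ψ : RandCircuit n k ℓ m) (u v : ℕ) (x x' : Fin n → Fin k → Bool) (b : Bool)
    (o : Fin ℓ → Bool) :
    Frag.outputSum b (List.ofFn o) (n, k, m) ψ.body u.bits v.bits (flatBits x) (flatBits x') =
      (if b then v else u) * ψ.count (if b then x else x') o := by
  rw [outputSum_eq, RandCircuit.count, Set.ncard_eq_toFinset_card', ← Finset.sum_filter,
    Finset.sum_const, smul_eq_mul, mul_comm]
  congr 2
  ext r
  simp [List.ofFn_inj]

theorem outputSum_eq_zero (ψ : RandCircuit n k ℓ m) (u v : ℕ) (x x' : Fin n → Fin k → Bool) (b : Bool)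
    {o : List Bool} (ho : o.length ≠ ℓ) :
    Frag.outputSum b o (n, k, m) ψ.body u.bits v.bits (flatBits x) (flatBits x') = 0 := by
  rw [outputSum_eq]
  refine Finset.sum_eq_zero fun r _ => if_neg ?_
  rintro rfl
  exact ho (List.length_ofFn)

/-! ### Differential privacy -/

namespace RandCircuit

theorem pr_singleton (ψ : RandCircuit n k ℓ m) (x : Fin n → Fin k → Bool) (o : Fin ℓ → Bool) :
    ψ.pr x {o} = (ψ.count x o : ℝ) / 2 ^ m := rfl

theorem pr_eq_sum (ψ : RandCircuit n k ℓ m) (x : Fin n → Fin k → Bool) (E : Set (Fin ℓ → Bool))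
    [DecidablePred (· ∈ E)] : ψ.pr x E = ∑ o with o ∈ E, ψ.pr x {o} := by
  simp only [← Finset.sum_div, pr]
  congr 1
  rw [← Nat.cast_sum, Nat.cast_inj]
  simp only [Set.ncard_eq_toFinset_card']
  rw [← Finset.card_biUnion]
  · congr 1
    ext r
    simp
  · intro o _ o' _ h
    refine Finset.disjoint_left.mpr fun r hr hr' => h ?_
    rw [Set.mem_toFinset] at hr hr'
    exact hr.symm.trans hr'

/-- For fixed x, x' the supremum over E of Pr[ψ(x) ∈ E] - e^ε Pr[ψ(x') ∈ E] is the sum of the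
positive parts over single outputs, attained where the difference is nonnegative. -/
theorem isDP_iff (ψ : RandCircuit n k ℓ m) (ε δ : ℝ) :
    ψ.IsDP ε δ ↔ ∀ x x' : Fin n → Fin k → Bool, Neighboring x x' →
      ∑ o, ψ.pointwiseDelta ε x x' o ≤ δ := by
  classical
  refine forall₃_congr fun x x' _ => ⟨fun h => ?_, fun h E => ?_⟩
  · have := h {o | 0 ≤ ψ.pr x {o} - Real.exp ε * ψ.pr x' {o}}
    rw [pr_eq_sum, pr_eq_sum, Finset.mul_sum, ← sub_le_iff_le_add', ← Finset.sum_sub_distrib,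
      Finset.sum_filter] at this
    refine le_trans (Finset.sum_le_sum fun o _ => ?_) this
    simp only [pointwiseDelta, Set.mem_ofPred_eq]
    split_ifs with h0
    · exact (max_eq_left h0).le
    · exact (max_eq_right (not_le.mp h0).le).le
  · rw [pr_eq_sum, pr_eq_sum, Finset.mul_sum, ← sub_le_iff_le_add', ← Finset.sum_sub_distrib]
    refine le_trans ?_ h
    refine le_trans (Finset.sum_le_sum fun o _ => le_max_left _ 0) ?_
    exact Finset.sum_le_sum_of_subset_of_nonneg (Finset.subset_univ _) fun o _ _ => le_max_right _ _

/-- The factor v·2^m makes both terms of the difference natural numbers, and truncated subtraction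
then plays the role of the maximum with 0. -/
theorem sum_pointwiseDelta (ψ : RandCircuit n k ℓ m) {u v : ℕ} {ε : ℝ} (hv : 0 < v)
    (hε : Real.exp ε = (u : ℝ) / (v : ℝ)) (x x' : Fin n → Fin k → Bool) :
    ((∑ o : Fin ℓ → Bool, (v * ψ.count x o - u * ψ.count x' o) : ℕ) : ℝ) =
      v * 2 ^ m * ∑ o, ψ.pointwiseDelta ε x x' o := by
  rw [Nat.cast_sum, Finset.mul_sum]
  refine Finset.sum_congr rfl fun o _ => ?_
  have hv' : (0 : ℝ) < v := Nat.cast_pos.mpr hv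
  have h2 : (0 : ℝ) < v * 2 ^ m := by positivity
  rw [pointwiseDelta, pr_singleton, pr_singleton, hε, mul_max_of_nonneg _ _ h2.le, mul_zero]
  have e : (v : ℝ) * 2 ^ m * (ψ.count x o / 2 ^ m - u / v * (ψ.count x' o / 2 ^ m)) =
      v * ψ.count x o - u * ψ.count x' o := by
    field_simp
  rw [e]
  rcases le_total (u * ψ.count x' o) (v * ψ.count x o) with h | h
  · rw [Nat.cast_sub h, max_eq_left]
    · push_cast; rfl
    · rw [sub_nonneg]; exact_mod_cast h
  · rw [Nat.sub_eq_zero_of_le h, max_eq_right]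
    · simp
    · rw [sub_nonpos]; exact_mod_cast h

end RandCircuit

/-! ### The two oracle functions and the refuting machine -/

open Polynomial in
/-- The running time of the machine for `Frag.outputCount`. -/
noncomputable def outputTime : Polynomial ℕ := C 200 * (X + C 1) ^ 3

theorem eval_outputTime (s : ℕ) : outputTime.eval s = 200 * (s + 1) ^ 3 := by
  simp [outputTime]

/-- The function in `#P` that counts the random bits for which a circuit has a given output. -/
noncomputable def outputFun : List Bool → ℕ :=
  Frag.outputCount.machine.acceptingPaths (fun _ => 0) outputTime

theorem outputFun_mem : outputFun ∈ SharpP := by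
  refine ⟨_, rfl, Frag.outputCount.machine, outputTime, fun w => ?_, fun _ => rfl⟩
  obtain ⟨N, h, -⟩ := Frag.counts_outputCount (f := fun _ => 0) w
  rw [eval_outputTime]
  exact h.machine.1

theorem outputFun_eq (b : Bool) (o u v x x' : List Bool) (d : ℕ × ℕ × ℕ) (c : List Gate × List ℕ)
    (hc : BodyWf (d.1 * d.2.1 + d.2.2) c) :
    outputFun (b :: (encodeBits o ++ (encodeDims d ++ (encodeBody c ++
      (encodeBits u ++ (encodeBits v ++ (encodeBits x ++ encodeBits x'))))))) =
      Frag.outputSum b o d c u v x x' := by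
  obtain ⟨N, h, hN⟩ := Frag.counts_outputCount (f := fun _ => 0) (b :: (encodeBits o ++ (encodeDims d ++
    (encodeBody c ++ (encodeBits u ++ (encodeBits v ++ (encodeBits x ++ encodeBits x')))))))
  rw [← hN b o d c u v x x' [] (by simp) hc, outputFun, OracleNTM.acceptingPaths, eval_outputTime]
  exact h.machine.2

theorem length_bits_outputFun_le (q : List Bool) :
    (outputFun q).bits.length ≤ 200 * (q.length + 1) ^ 3 + 1 := by
  rw [← eval_outputTime]
  exact OracleNTM.length_bits_acceptingPaths_le _ _ _ _

open Polynomial in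
/-- The running time of the machine for `Frag.difference`. -/
noncomputable def differenceTime : Polynomial ℕ :=
  C 30 * (X + C 1) + C 10 * (C 200 * (C 3 * X + C 3) ^ 3 + C 2)

theorem eval_differenceTime (s : ℕ) :
    differenceTime.eval s = 30 * (s + 1) + 10 * (200 * (3 * s + 3) ^ 3 + 2) := by
  simp [differenceTime]

/-- The function in `#P^#P` that computes the excess of one output distribution over another one. -/
noncomputable def differenceFun : List Bool → ℕ :=
  Frag.difference.machine.acceptingPaths outputFun differenceTime

theorem runs_difference_outputFun (w : List Bool) :
    Frag.difference.Runs outputFun Frag.AtExit (initStore w)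
      (∑ j ∈ Finset.range (w.length + 1), ((bitLists j).map fun o =>
        outputFun (true :: (encodeBits o ++ w)) - outputFun (false :: (encodeBits o ++ w))).sum)
      (differenceTime.eval w.length) := by
  rw [eval_differenceTime]
  refine Frag.runs_difference (L := 200 * (3 * w.length + 3) ^ 3 + 1) fun b o ho =>
    (length_bits_outputFun_le _).trans ?_
  -- One bit for the flag, at most 2|w| + 1 for the code of o, and |w| for the input.
  have : (b :: (encodeBits o ++ w)).length + 1 ≤ 3 * w.length + 3 := by
    rw [List.length_cons, List.length_append, length_encodeBits]
    omega
  gcongr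

theorem differenceTime_runs : Frag.difference.machine.RunsInTime outputFun differenceTime :=
  fun w => (runs_difference_outputFun w).machine.1

theorem differenceFun_eq (w : List Bool) : differenceFun w =
    ∑ j ∈ Finset.range (w.length + 1), ((bitLists j).map fun o =>
      outputFun (true :: (encodeBits o ++ w)) - outputFun (false :: (encodeBits o ++ w))).sum :=
  (runs_difference_outputFun w).machine.2

theorem length_bits_differenceFun_le {q : List Bool} {s : ℕ} (h : q.length ≤ s) :
    (differenceFun q).bits.length ≤ differenceTime.eval s + 1 := by
  refine (OracleNTM.length_bits_acceptingPaths_le _ _ _ _).trans ?_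
  rw [eval_differenceTime, eval_differenceTime]
  gcongr

theorem differenceFun_encode (ψ : RandCircuit n k ℓ m) (u v : ℕ) (x x' : Fin n → Fin k → Bool) :
    differenceFun (encodeWithInputs ψ u v x x') =
      ∑ o : Fin ℓ → Bool, (v * ψ.count x o - u * ψ.count x' o) := by
  -- Each output takes at least one bit of the code, so the right length is among those tried.
  have hℓ : ℓ ∈ Finset.range ((encodeWithInputs ψ u v x x').length + 1) := by
    have := length_le_length_encodeList encodeUnary (List.ofFn ψ.outputs)
    rw [List.length_ofFn] at this
    simp only [encodeWithInputs, encodeCircuit, List.length_append, Finset.mem_range]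
    omega
  have hq : ∀ b o, outputFun (b :: (encodeBits o ++ encodeWithInputs ψ u v x x')) =
      Frag.outputSum b o (n, k, m) ψ.body u.bits v.bits (flatBits x) (flatBits x') := by
    intro b o
    rw [encodeWithInputs_eq]
    exact outputFun_eq b o _ _ _ _ (n, k, m) ψ.body ψ.bodyWf
  rw [differenceFun_eq]
  simp only [hq]
  -- For lists of any other length both answers are zero.
  rw [Finset.sum_eq_single_of_mem ℓ hℓ, sum_bitLists]
  · refine Finset.sum_congr rfl fun o _ => ?_
    rw [outputSum_ofFn, outputSum_ofFn]
    rfl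
  · intro j _ hj
    refine List.sum_eq_zero fun N hN => ?_
    obtain ⟨o, ho, rfl⟩ := List.mem_map.mp hN
    rw [outputSum_eq_zero _ _ _ _ _ _ (by rw [length_of_mem_bitLists ho]; exact hj), Nat.zero_sub]

/-- The value of the function on two inputs decides whether they refute differential privacy. -/
theorem lt_differenceFun_iff (I : DPInstance) (x x' : Fin I.n → Fin I.k → Bool) :
    I.d * I.v * 2 ^ I.m < differenceFun (encodeWithInputs I.ψ I.u I.v x x') * I.e ↔
      I.δ < ∑ o, I.ψ.pointwiseDelta I.ε x x' o := by
  have hu : (0 : ℝ) < I.u := Nat.cast_pos.mpr I.u_pos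
  have hv : (0 : ℝ) < I.v := Nat.cast_pos.mpr I.v_pos
  have he : (0 : ℝ) < I.e := Nat.cast_pos.mpr I.e_pos
  have h := I.ψ.sum_pointwiseDelta (ε := I.ε) I.v_pos (by
    rw [DPInstance.ε, Real.exp_log (by positivity)]) x x'
  rw [← differenceFun_encode] at h
  rw [← Nat.cast_lt (α := ℝ), Nat.cast_mul _ I.e, h, DPInstance.δ, div_lt_iff₀ he]
  push_cast
  have h2 : (0 : ℝ) < I.v * 2 ^ I.m := by positivity
  -- Both sides carry the positive factor v·2^m, which is cancelled.
  rw [mul_assoc _ (∑ o, _), mul_assoc (I.d : ℝ), mul_comm (I.d : ℝ), mul_lt_mul_iff_right₀ h2]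

theorem getLast?_bits_of_pos {a : ℕ} (ha : 0 < a) : a.bits.getLast? = some true := by
  have h := getLast?_bits a
  rcases hl : a.bits.getLast? with _ | _ | _
  · rw [List.getLast?_eq_none_iff] at hl
    have := binVal_bits a
    rw [hl] at this
    exact absurd this ha.ne
  · exact absurd hl h
  · rfl

/-- For u, v and e a last bit `true` certifies that the expansion is canonical and the number
positive; for d, which may be zero, only a last bit `false` is excluded. -/
theorem binVal_pos {l : List Bool} (h : l.getLast? = some true) : 0 < binVal l := by
  have := bits_binVal (l := l) (by simp [h])
  refine Nat.pos_of_ne_zero fun h0 => ?_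
  rw [h0, Nat.zero_bits] at this
  simp [← this] at h

open Polynomial in
/-- The running time of the machine for `Frag.refute`. -/
noncomputable def refuteTime : Polynomial ℕ :=
  C 400 * ((X + C 1) ^ 3 * (differenceTime.comp (C 5 * (X + C 1) ^ 2) + C 2))

theorem eval_refuteTime (s : ℕ) :
    refuteTime.eval s = 400 * ((s + 1) ^ 3 * (differenceTime.eval (5 * (s + 1) ^ 2) + 1 + 1)) := by
  simp [refuteTime]

/-- The machine for `Frag.refute` accepts exactly the words that are not in the language. -/
theorem accepts_refute_differenceFun (w : List Bool) :
    Frag.refute.Accepts differenceFun (initStore w) (refuteTime.eval w.length) (w ∉ DecideDP) := by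
  rw [eval_refuteTime]
  refine (Frag.accepts_refute (fun q hq => length_bits_differenceFun_le hq) le_rfl).congr ?_
  constructor
  · rintro h ⟨I, rfl, hI⟩
    obtain ⟨used, x, x', hx, h⟩ := h (I.n, I.k, I.m) _ I.encode_eq trivial
    obtain ⟨rfl, h'⟩ := h _ _ rfl I.ψ.bodyWf _ _ rfl (by simp [getLast?_bits_of_pos I.u_pos]) _ _ rfl
      (by simp [getLast?_bits_of_pos I.v_pos]) _ _ rfl (by simp [getLast?_bits]) I.e.bits []
      (by simp) (by simp [getLast?_bits_of_pos I.e_pos]) rfl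
    simp only [binVal_bits] at h'
    rw [← encodeWithInputs_eq, lt_differenceFun_iff] at h'
    -- The flag is `true`, so `Differ` yields that x and x' are neighboring.
    exact absurd ((I.ψ.isDP_iff _ _).mp hI x x' (hx.2.2 (by simp))) (not_le.mpr h')
  · rintro hw ⟨n, k, m⟩ rest hrest -
    -- Words without readable dimensions are covered vacuously; what follows the dimensions either
    -- completes the code of an instance or does not.
    by_cases h : ∃ c u v d e, rest = encodeBody c ++ (encodeBits u ++ (encodeBits v ++
        (encodeBits d ++ encodeBits e))) ∧ BodyWf (n * k + m) c ∧ u.getLast? = some true ∧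
        v.getLast? = some true ∧ d.getLast? ≠ some false ∧ e.getLast? = some true
    · obtain ⟨c, u, v, d, e, hr, hc, hu, hv, hd, he⟩ := h
      let I : DPInstance :=
        ⟨n, k, c.2.length, m, .ofBody c hc, binVal u, binVal v, binVal d, binVal e, binVal_pos hu,
          binVal_pos hv, binVal_pos he⟩
      have hI : w = I.encode := by
        rw [hrest, hr, I.encode_eq]
        simp only [I, RandCircuit.body_ofBody]
        rw [bits_binVal (by simp [hu]), bits_binVal (by simp [hv]), bits_binVal hd,
          bits_binVal (by simp [he])]
      have hdp : ¬ I.ψ.IsDP I.ε I.δ := fun h => hw ⟨I, hI, h⟩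
      rw [RandCircuit.isDP_iff] at hdp
      push Not at hdp
      obtain ⟨x, x', hx, hlt⟩ := hdp
      rw [← lt_differenceFun_iff, encodeWithInputs_eq] at hlt
      refine ⟨true, x, x', ⟨by simp, by simp, fun _ => hx⟩, ?_⟩
      intro c' r₁ h1 _ u' r₂ h2 _ v' r₃ h3 _ d' r₄ h4 _ e' r₅ h5 _ h6
      -- Any other parse of the word coincides with the given one, field by field.
      obtain ⟨rfl, rfl⟩ := prefixFree_encodeBody _ _ _ _ (hr.symm.trans h1)
      obtain ⟨rfl, rfl⟩ := prefixFree_encodeBits _ _ _ _ h2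
      obtain ⟨rfl, rfl⟩ := prefixFree_encodeBits _ _ _ _ h3
      obtain ⟨rfl, rfl⟩ := prefixFree_encodeBits _ _ _ _ h4
      obtain ⟨rfl, _⟩ := prefixFree_encodeBits e e' [] r₅ ((List.append_nil _).trans h5)
      refine ⟨rfl, ?_⟩
      simp only [I, RandCircuit.body_ofBody] at hlt
      rwa [bits_binVal (by simp [hu]), bits_binVal (by simp [hv])] at hlt
    -- No valid parse exists, so any guess leads to acceptance; two equal arrays with the flag
    -- `false` are available even without rows.
    · refine ⟨false, fun _ _ => false, fun _ _ => false, ⟨by simp, fun _ => rfl, by simp⟩, ?_⟩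
      intro c r₁ h1 hc u r₂ h2 hu v r₃ h3 hv d r₄ h4 hd e r₅ h5 he h6
      refine absurd ⟨c, u, v, d, e, ?_, hc, by simpa using hu, by simpa using hv, by simpa using hd,
        by simpa using he⟩ h
      rw [h1, h2, h3, h4, h5, h6, List.append_nil]

theorem decideDP_mem : DecideDP ∈ coNPRel {differenceFun} := by
  have h := accepts_refute_differenceFun
  choose N hN hN' using h
  refine ⟨_, rfl, Frag.refute.machine, refuteTime, fun w => (hN w).machine.1, fun w => ?_⟩
  rw [OracleNTM.acceptingPaths, (hN w).machine.2]
  exact (hN' w).symm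

end DPComplexity

theorem mainTheorem3 :
    (∃ f ∈ DPComplexity.SharpP, ∃ (M : DPComplexity.OracleNTM) (p : Polynomial ℕ),
      M.RunsInTime f p ∧
      (∀ (n k ℓ m : ℕ) (ψ : DPComplexity.RandCircuit n k ℓ m) (u v : ℕ) (ε : ℝ), 0 < v →
        Real.exp ε = (u : ℝ) / (v : ℝ) → ∀ x x' : Fin n → Fin k → Bool,
          (M.acceptingPaths f p (DPComplexity.encodeWithInputs ψ u v x x') : ℝ) =
            v * 2 ^ m * ∑ o : Fin ℓ → Bool, ψ.pointwiseDelta ε x x' o) ∧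
      DPComplexity.DecideDP ∈ DPComplexity.coNPRel {M.acceptingPaths f p}) ∧
    DPComplexity.DecideDP ∈ DPComplexity.coNPRel (DPComplexity.SharpPRel DPComplexity.SharpP) := by
  have h := DPComplexity.decideDP_mem
  refine ⟨⟨_, DPComplexity.outputFun_mem, DPComplexity.Frag.difference.machine,
    DPComplexity.differenceTime, DPComplexity.differenceTime_runs, ?_, h⟩, ?_⟩
  · intro n k ℓ m ψ u v ε hv hε x x'
    rw [← ψ.sum_pointwiseDelta hv hε, ← DPComplexity.differenceFun_encode]
    rfl
  -- The single oracle g itself belongs to the class of functions with an oracle in #P, so the same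
  -- machine serves for the larger class.
  · obtain ⟨f, rfl, N, p, hp⟩ := h
    exact ⟨_, ⟨_, DPComplexity.outputFun_mem, _, _, DPComplexity.differenceTime_runs, fun _ => rfl⟩, N, p,
      hp⟩
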